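/- Notation. For $d\in\mathbb N$ and $z=(x,\omega)\in\mathbb R^{2d}$ let $\pi(z)f(t)=e^{2\pi i\omega\cdot t}f(t-x)$ and $V_\varphi\psi(z)=\langle\psi,\pi(z)\varphi\rangle=\int_{\mathbb R^d}\psi(t)\overline{\varphi(t-x)}e^{-2\pi i\omega\cdot t}\,dt$. Fix a nonzero Schwartz function $g$ on $\mathbb R^d$; for $1\le s\le\infty$, $M^s(\mathbb R^d)$ is the space of tempered distributions $\psi$ with $\|\psi\|_{M^s}=\|V_g\psi\|_{L^s(\mathbb R^{2d})}<\infty$ (for $s\le 2$ these are $L^2$ functions), and $\langle u,v\rangle=\|g\|_2^{-2}\int_{\mathbb R^{2d}}V_gu\,\overline{V_gv}\,dz$ is the duality pairing of $M^{s'}$ and $M^{s}$, which extends the inner product of $L^2(\mathbb R^d)$. $\mathcal FL^p(\mathbb R^{2d})$ is the space of tempered distributions $\mu$ whose Fourier transform $\hat\mu$ is a function in $L^p(\mathbb R^{2d})$. The time-frequency blurring operator is $B_\mu^\varphi\psi=V_\varphi^*(\mu*V_\varphi\psi)$, where the convolution is defined by $\widehat{\mu*F}=\hat\mu\cdot\hat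 F$ and $V_\varphi^*H=\int_{\mathbb R^{2d}}H(z)\,\pi(z)\varphi\,dz$ weakly, as a tempered distribution. Proposition. Let $1\le p\le\infty$ and $1\le q,r\le 2\le q',r'\le\infty$ be such that $\frac1p+\frac1{q'}+\frac1{r'}=1$, $\frac1q+\frac1{q'}=1$ and $\frac1r+\frac1{r'}=1$, and let $\varphi\in M^1(\mathbb R^d)$. Then there is a constant $C$, depending only on $d,p,q,r,g$ and $\varphi$, such that for all $\mu\in\mathcal FL^p(\mathbb R^{2d})$, $\psi\in M^q(\mathbb R^d)$ and $\phi\in M^r(\mathbb R^d)$ the tempered distribution $B_\mu^\varphi\psi$ is well defined, the integral defining $\langle B_\mu^\varphi\psi,\phi\rangle$ converges absolutely, and $$|\langle B_\mu^\varphi\psi,\phi\rangle|\le C\,\|\hat\mu\|_{L^p(\mathbb R^{2d})}\,\|\psi\|_{M^q(\mathbb R^d)}\,\|\phi\|_{M^r(\mathbb R^d)} .$$ -/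

import Mathlib

open MeasureTheory Complex
open scoped SchwartzMap FourierTransform ENNReal NNReal ComplexConjugate

noncomputable section

namespace TFBlur

/-- The signal domain `ℝᵈ`. -/
abbrev E (d : ℕ) : Type := EuclideanSpace ℝ (Fin d)

/-- Phase space `ℝ²ᵈ = ℝᵈ × ℝᵈ` with its Euclidean structure; a point `z = (x, ω)` has
time `x = z.fst` and frequency `ω = z.snd`. -/
abbrev Phase (d : ℕ) : Type := WithLp 2 (E d × E d)

/-- The character `t ↦ e^{2πi ω·t}`. -/
def chi {d : ℕ} (ω t : E d) : ℂ := cexp (((2 * Real.pi * inner ℝ ω t : ℝ) : ℂ) * I)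

/-- The time-frequency shift `π(x, ω) w (t) = e^{2πi ω·t} w(t - x)` of a function. -/
def tfShift {d : ℕ} (z : Phase d) (w : E d → ℂ) (t : E d) : ℂ := chi z.snd t * w (t - z.fst)

/-- The short-time Fourier transform of a function `f` with a window function `w`,
`V_w f (x, ω) = ∫ f(t) conj(w(t - x)) e^{-2πi ω·t} dt`. -/
def stft {d : ℕ} (w f : E d → ℂ) (z : Phase d) : ℂ := ∫ t, f t * conj (tfShift z w t)

/-! ### Time-frequency shifts of Schwartz functions -/

theorem hasTemperateGrowth_exp_mul_I :
    (fun s : ℝ => cexp ((s : ℂ) * I)).HasTemperateGrowth := by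
  have hd : ∀ n : ℕ, iteratedDeriv n (fun s : ℝ => cexp ((s : ℂ) * I)) =
      fun s : ℝ => I ^ n * cexp ((s : ℂ) * I) := by
    intro n
    induction n with
    | zero => simp
    | succ n ih =>
      rw [iteratedDeriv_succ, ih]
      funext s
      have h1 : HasDerivAt (fun s : ℝ => (s : ℂ) * I) (1 * I) s :=
        (HasDerivAt.ofReal_comp (hasDerivAt_id s)).mul_const I
      have h2 := (h1.cexp).const_mul (I ^ n)
      rw [h2.deriv]
      ring
  refine ⟨?_, ?_⟩
  · have : ContDiff ℝ (⊤ : ℕ∞) (fun s : ℝ => (s : ℂ) * I) :=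
      Complex.ofRealCLM.contDiff.mul contDiff_const
    exact this.cexp
  · intro n
    refine ⟨0, 1, fun s => ?_⟩
    rw [norm_iteratedFDeriv_eq_norm_iteratedDeriv, hd]
    simp [Complex.norm_exp]

theorem chi_hasTemperateGrowth {d : ℕ} (ω : E d) : (chi ω).HasTemperateGrowth := by
  have h : (fun t : E d => 2 * Real.pi * inner ℝ ω t).HasTemperateGrowth :=
    ((2 * Real.pi) • innerSL ℝ ω).hasTemperateGrowth
  exact hasTemperateGrowth_exp_mul_I.comp h

/-- The complex conjugate of a Schwartz function. -/
def conjS {d : ℕ} (g : 𝓢(E d, ℂ)) : 𝓢(E d, ℂ) :=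
  SchwartzMap.postcompCLM (𝕜 := ℝ) (Complex.conjCLE : ℂ →L[ℝ] ℂ) g

@[simp]
theorem conjS_apply {d : ℕ} (g : 𝓢(E d, ℂ)) (t : E d) : conjS g t = conj (g t) := rfl

/-- The time-frequency shift `π(z) g` of a Schwartz function, as a Schwartz function. -/
def tfShiftS {d : ℕ} (z : Phase d) (g : 𝓢(E d, ℂ)) : 𝓢(E d, ℂ) :=
  SchwartzMap.smulLeftCLM ℂ (chi z.snd) (SchwartzMap.compSubConstCLM ℂ z.fst g)

theorem tfShiftS_apply {d : ℕ} (z : Phase d) (g : 𝓢(E d, ℂ)) (t : E d) :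
    tfShiftS z g t = tfShift z g t := by
  simp [tfShiftS, tfShift, SchwartzMap.smulLeftCLM_apply_apply (chi_hasTemperateGrowth z.snd)]

/-! ### Modulation spaces -/

/-- The short-time Fourier transform of a tempered distribution `T` with a Schwartz window `g`,
`V_g T (z) = ⟨T, π(z) g⟩`; the bracket is conjugate-linear in its second entry. -/
def stftD {d : ℕ} (g : 𝓢(E d, ℂ)) (T : 𝓢'(E d, ℂ)) (z : Phase d) : ℂ :=
  T (conjS (tfShiftS z g))

/-- The norm of `M^p(ℝᵈ) = M^{p,p}(ℝᵈ)` with respect to the Schwartz window `g`. -/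
def modNorm {d : ℕ} (g : 𝓢(E d, ℂ)) (p : ℝ≥0∞) (T : 𝓢'(E d, ℂ)) : ℝ≥0∞ :=
  eLpNorm (stftD g T) p volume

/-- The tempered distribution `T` belongs to `M^p(ℝᵈ)` (for a nonzero Schwartz window `g`). -/
def MemMod {d : ℕ} (g : 𝓢(E d, ℂ)) (p : ℝ≥0∞) (T : 𝓢'(E d, ℂ)) : Prop :=
  modNorm g p T < ∞

/-- The integrand of the duality pairing of modulation spaces. -/
def pairingIntegrand {d : ℕ} (g : 𝓢(E d, ℂ)) (u v : 𝓢'(E d, ℂ)) (z : Phase d) : ℂ :=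
  stftD g u z * conj (stftD g v z)

/-- The duality pairing `⟨u, v⟩ = ‖g‖₂⁻² ∫ V_g u (z) conj (V_g v (z)) dz` of the modulation spaces
`M^{r'}` and `M^r`, which extends the inner product of `L²(ℝᵈ)`. -/
def dualPairing {d : ℕ} (g : 𝓢(E d, ℂ)) (u v : 𝓢'(E d, ℂ)) : ℂ :=
  (((∫ t, ‖g t‖ ^ 2 : ℝ) : ℂ))⁻¹ * ∫ z, pairingIntegrand g u v z

/-! ### The blurring operator -/

/-- The tempered distribution `T` is given by the function `G`. -/
def Represents {V : Type*} [NormedAddCommGroup V] [NormedSpace ℝ V] [MeasureSpace V]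
    (G : V → ℂ) (T : 𝓢'(V, ℂ)) : Prop :=
  ∀ h : 𝓢(V, ℂ), Integrable (fun x => G x * h x) ∧ T h = ∫ x, G x * h x

/-- The function `H` is the convolution `μ * F` of the tempered distribution `μ`, whose Fourier
transform is a function `m`, with the function `F`: one has `(μ * F)^ = m · F^`, with Fourier
transforms of tempered distributions. -/
def IsConvolution {d : ℕ} (μ : 𝓢'(Phase d, ℂ)) (F H : Phase d → ℂ) : Prop :=
  ∃ (TF TH : 𝓢'(Phase d, ℂ)) (m Fhat : Phase d → ℂ),
    Represents F TF ∧ Represents H TH ∧ Represents m (𝓕 μ) ∧ Represents Fhat (𝓕 TF) ∧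
      Represents (fun ξ => m ξ * Fhat ξ) (𝓕 TH)

/-- The tempered distribution `u` is the synthesis `V_w^* H = ∫ H(z) π(z) w dz`, the integral being
understood weakly. -/
def IsSynthesis {d : ℕ} (w : E d → ℂ) (H : Phase d → ℂ) (u : 𝓢'(E d, ℂ)) : Prop :=
  ∀ h : 𝓢(E d, ℂ), Integrable (fun z => H z * ∫ t, tfShift z w t * h t) ∧
    u h = ∫ z, H z * ∫ t, tfShift z w t * h t

/-- The tempered distribution `u` is `B_μ^φ ψ = V_φ^* (μ * V_φ ψ)`; the window `φ` and the signal
`ψ` are given by the square-integrable functions `w` and `f`. -/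
def IsBlur {d : ℕ} (φ : 𝓢'(E d, ℂ)) (μ : 𝓢'(Phase d, ℂ)) (ψ u : 𝓢'(E d, ℂ)) : Prop :=
  ∃ (w f : E d → ℂ) (H : Phase d → ℂ), MemLp w 2 ∧ MemLp f 2 ∧ Represents w φ ∧ Represents f ψ ∧
    IsConvolution μ (stft w f) H ∧ IsSynthesis w H u

end TFBlur

end

/-! Up to a chirp, the Fourier transform of `stft w f` is a tensor product: `rih v f (ξ, η) = e^{2πi
ξ·η} conj(v ξ) f(-η)` with `v = 𝓕 w`. In the pairing of `m · 𝓕(V_w f)` with `𝓕(V_w h)` the chirps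
cancel and only `|v ξ|²` depends on the window, so Fubini turns the blurring operator into a
multiplication operator: `B f (t) = f t * fibreMean v m (-t)`, where `fibreMean v m` is the integral
of `m` in the first variable against `|v|²`.

The estimate is then a chain of norm bounds. A window in `M¹` has `v ∈ L² ∩ L^∞`, so `fibreMean v`
is bounded from `L^p(ℝ²ᵈ)` to `L^p(ℝᵈ)` (`eLpNorm_fibreMean_le`). A signal in `M^q` lies in `L^{q'}`
(`exists_eLpNorm_le_stft`). The exponent relation gives `1/p + 1/q' = 1/r`, so Hölder puts `B f` in
`L^r`. Since `r ≤ 2`, `V_g` maps `L^r` to `L^{r'}` (`exists_eLpNorm_stft_le`), and Hölder on phase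
space pairs this with `V_g χ ∈ L^r`.

The bound `V_g : L^q → L^{q'}` is of Hausdorff–Young type and comes from real interpolation between
`L¹ → L^∞` and `L² → L²`; the inclusion of `M^q` in `L^{q'}` is its dual, by Moyal's identity. As
elements of `M^q` are only given as tempered distributions, a reproducing formula for distributions
(`stftD_spec`) first shows that for `q ≤ 2` they are `L²` functions. Finally `exists_isBlur` checks
that the multiplication operator satisfies the weak definition of the blur, and `IsBlur.unique` that
nothing else does. -/

namespace TFBlur

/-! ### Real interpolation between `L¹ → L^∞` and `L² → L²`. -/

section Interpolation

open Set

variable {α β : Type*} [MeasurableSpace α] [MeasurableSpace β] {μ : Measure α} {ν : Measure β}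

/-- The computation of the inner integral in the real interpolation argument. -/
theorem lintegral_rpow_indicator_le {q s c a : ℝ} (hq : 1 < q) (hq2 : q < 2) (hs : s = q / (q - 1))
    (hc : 0 < c) (ha : 0 ≤ a) :
    ENNReal.ofReal (a ^ 2) * ∫⁻ t in Ioi (0 : ℝ),
      ENNReal.ofReal (t ^ (s - 3)) * ({t : ℝ | a ≤ (t / c) ^ (-(1 / (q - 1)))}.indicator 1 t) ≤
    ENNReal.ofReal (c ^ (s - 2) / (s - 2)) * ENNReal.ofReal (a ^ q) := by
  have hq1 : 0 < q - 1 := by linarith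
  have hs2 : 2 < s := by rw [hs, lt_div_iff₀ hq1]; linarith
  rcases ha.eq_or_lt with rfl | ha
  · simp
  -- `l` is the value of `t` at which the threshold `(t / c) ^ (-(1 / (q - 1)))` equals `a`; the
  -- indicator is supported in `(0, l]`. The power `t ^ (s - 3)` is integrable at `0` because `s >
  -- 2`.
  set l := c * a ^ (-(q - 1)) with hl
  have hlpos : 0 < l := by positivity
  have hsub : ∀ t ∈ Ioi (0 : ℝ), ENNReal.ofReal (t ^ (s - 3)) *
      ({t : ℝ | a ≤ (t / c) ^ (-(1 / (q - 1)))}.indicator 1 t) ≤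
      (Ioc 0 l).indicator (fun t => ENNReal.ofReal (t ^ (s - 3))) t := by
    intro t ht
    by_cases h : a ≤ (t / c) ^ (-(1 / (q - 1)))
    · have : t ≤ l := by
        have htc : 0 < t / c := div_pos ht hc
        have h1 : ((t / c) ^ (-(1 / (q - 1)))) ^ (-(q - 1)) ≤ a ^ (-(q - 1)) :=
          Real.rpow_le_rpow_of_nonpos ha h (by linarith)
        rw [← Real.rpow_mul htc.le] at h1
        have : -(1 / (q - 1)) * -(q - 1) = 1 := by field_simp
        rw [this, Real.rpow_one, div_le_iff₀ hc] at h1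
        rw [hl]; linarith
      rw [indicator_of_mem (show t ∈ Ioc 0 l from ⟨ht, this⟩)]
      rw [indicator_of_mem (show t ∈ {t : ℝ | a ≤ (t / c) ^ (-(1 / (q - 1)))} from h)]
      simp
    · rw [indicator_of_notMem (show t ∉ {t : ℝ | a ≤ (t / c) ^ (-(1 / (q - 1)))} from h)]
      simp
  have hint : ∫⁻ t in Ioi (0 : ℝ), (Ioc 0 l).indicator (fun t => ENNReal.ofReal (t ^ (s - 3))) t =
      ENNReal.ofReal (l ^ (s - 2) / (s - 2)) := by
    rw [lintegral_indicator measurableSet_Ioc, Measure.restrict_restrict measurableSet_Ioc,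
      inter_eq_self_of_subset_left Ioc_subset_Ioi_self]
    rw [← ofReal_integral_eq_lintegral_ofReal]
    · rw [← intervalIntegral.integral_of_le hlpos.le, integral_rpow (Or.inl (by linarith))]
      congr 1
      have : s - 3 + 1 = s - 2 := by ring
      rw [this, Real.zero_rpow (by linarith), sub_zero]
    · have := (intervalIntegral.intervalIntegrable_rpow' (a := 0) (b := l) (r := s - 3)
        (by linarith))
      rwa [intervalIntegrable_iff_integrableOn_Ioc_of_le hlpos.le] at this
    · filter_upwards [ae_restrict_mem measurableSet_Ioc] with t ht
      exact Real.rpow_nonneg ht.1.le _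
  calc _ ≤ ENNReal.ofReal (a ^ 2) * ENNReal.ofReal (l ^ (s - 2) / (s - 2)) := by
        rw [← hint]
        gcongr ENNReal.ofReal (a ^ 2) * ?_
        exact setLIntegral_mono' measurableSet_Ioi hsub
    _ = _ := by
        rw [← ENNReal.ofReal_mul (by positivity), ← ENNReal.ofReal_mul (by
          have : 0 < s - 2 := by linarith
          positivity)]
        congr 1
        -- For `s = q / (q - 1)` one has `(q - 1) * (s - 2) = 2 - q`, so with the factor `a ^ 2`
        -- exactly `a ^ q` is left.
        have h3 : l ^ (s - 2) = c ^ (s - 2) * a ^ (q - 2) := by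
          rw [hl, Real.mul_rpow hc.le (by positivity), ← Real.rpow_mul ha.le]
          congr 2
          rw [hs]; field_simp; ring
        have h4 : a ^ q = a ^ 2 * a ^ (q - 2) := by
          rw [← Real.rpow_natCast, ← Real.rpow_add ha]
          congr 1; push_cast; ring
        rw [h3, h4]; ring

/-- The integration step of the real interpolation argument between `L¹ → L^∞` and `L² → L²`. -/
theorem lintegral_rpow_le_of_meas_lt_le [SFinite μ] {q s c K : ℝ} (hq : 1 < q) (hq2 : q < 2)
    (hs : s = q / (q - 1)) (hc : 0 < c) (hK : 0 ≤ K) {a : α → ℝ} {b : β → ℝ}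
    (ha : Measurable a) (ha0 : ∀ x, 0 ≤ a x) (hb : AEMeasurable b ν) (hb0 : ∀ y, 0 ≤ b y)
    (hmeas : ∀ t : ℝ, 0 < t → ν {y | t < b y} ≤ ENNReal.ofReal (K * t ^ (-2 : ℝ)) *
      ∫⁻ x, ENNReal.ofReal (a x ^ 2) *
        ({t : ℝ | a x ≤ (t / c) ^ (-(1 / (q - 1)))}.indicator 1 t) ∂μ) :
    ∫⁻ y, ENNReal.ofReal (b y ^ s) ∂ν ≤
      ENNReal.ofReal (s * K * (c ^ (s - 2) / (s - 2))) * ∫⁻ x, ENNReal.ofReal (a x ^ q) ∂μ := by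
  have hq1 : 0 < q - 1 := by linarith
  have hs2 : 2 < s := by rw [hs, lt_div_iff₀ hq1]; linarith
  rw [lintegral_rpow_eq_lintegral_meas_lt_mul ν (Filter.Eventually.of_forall hb0) hb (by linarith)]
  have hS : MeasurableSet {p : ℝ × α | a p.2 ≤ (p.1 / c) ^ (-(1 / (q - 1)))} :=
    measurableSet_le (by fun_prop) (by fun_prop)
  have hind : Measurable (fun p : ℝ × α =>
      ({t : ℝ | a p.2 ≤ (t / c) ^ (-(1 / (q - 1)))}.indicator (1 : ℝ → ℝ≥0∞) p.1)) := by
    have : (fun p : ℝ × α =>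
      ({t : ℝ | a p.2 ≤ (t / c) ^ (-(1 / (q - 1)))}.indicator (1 : ℝ → ℝ≥0∞) p.1)) =
      {p : ℝ × α | a p.2 ≤ (p.1 / c) ^ (-(1 / (q - 1)))}.indicator 1 := by
      ext p; simp [indicator]
    rw [this]
    exact measurable_one.indicator hS
  -- Layer-cake formula for `b ^ s`, with the level-set bound inserted; Tonelli then allows the
  -- `t`-integral to be done first.
  calc _ ≤ ENNReal.ofReal s * ∫⁻ t in Ioi (0 : ℝ), ENNReal.ofReal K * ∫⁻ x,
          ENNReal.ofReal (a x ^ 2) * (ENNReal.ofReal (t ^ (s - 3)) *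
          ({t : ℝ | a x ≤ (t / c) ^ (-(1 / (q - 1)))}.indicator 1 t)) ∂μ := by
        gcongr ENNReal.ofReal s * ?_
        refine setLIntegral_mono' measurableSet_Ioi fun t ht => ?_
        have ht' : (0 : ℝ) < t := ht
        calc _ ≤ (ENNReal.ofReal (K * t ^ (-2 : ℝ)) * ∫⁻ x, ENNReal.ofReal (a x ^ 2) *
            ({t : ℝ | a x ≤ (t / c) ^ (-(1 / (q - 1)))}.indicator 1 t) ∂μ) *
              ENNReal.ofReal (t ^ (s - 1)) := by gcongr; exact hmeas t ht
          _ = ENNReal.ofReal K * (ENNReal.ofReal (t ^ (s - 3)) * ∫⁻ x, ENNReal.ofReal (a x ^ 2) *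
            ({t : ℝ | a x ≤ (t / c) ^ (-(1 / (q - 1)))}.indicator 1 t) ∂μ) := by
              have : t ^ (s - 3) = t ^ (-2 : ℝ) * t ^ (s - 1) := by
                rw [← Real.rpow_add ht']; congr 1; ring
              rw [this, ENNReal.ofReal_mul hK, ENNReal.ofReal_mul (by positivity)]
              ring
          _ = _ := by
              rw [← lintegral_const_mul' _ _ ENNReal.ofReal_ne_top]
              congr 2; ext x; ring
    _ = ENNReal.ofReal s * (ENNReal.ofReal K * ∫⁻ x, ENNReal.ofReal (a x ^ 2) *
          (∫⁻ t in Ioi (0 : ℝ), (ENNReal.ofReal (t ^ (s - 3)) *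
          ({t : ℝ | a x ≤ (t / c) ^ (-(1 / (q - 1)))}.indicator 1 t))) ∂μ) := by
        rw [lintegral_const_mul' _ _ ENNReal.ofReal_ne_top, lintegral_lintegral_swap]
        · congr 3; ext x
          rw [lintegral_const_mul' _ _ ENNReal.ofReal_ne_top]
        · apply Measurable.aemeasurable
          apply Measurable.mul (by fun_prop)
          exact Measurable.mul (by fun_prop) hind
    _ ≤ ENNReal.ofReal s * (ENNReal.ofReal K * ∫⁻ x, ENNReal.ofReal (c ^ (s - 2) / (s - 2)) *
          ENNReal.ofReal (a x ^ q) ∂μ) := by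
        refine mul_le_mul_right (mul_le_mul_right (lintegral_mono fun x => ?_) _) _
        exact lintegral_rpow_indicator_le hq hq2 hs hc (ha0 x)
    _ = _ := by
        have : 0 < s := by linarith
        rw [lintegral_const_mul' _ _ ENNReal.ofReal_ne_top, ENNReal.ofReal_mul (by positivity),
          ENNReal.ofReal_mul (by positivity)]
        ring

theorem indicator_lt_add_indicator_le {α : Type*} (F : α → ℂ) (σ : ℝ) :
    {x | σ < ‖F x‖}.indicator F + {x | ‖F x‖ ≤ σ}.indicator F = F := by
  have : {x | ‖F x‖ ≤ σ} = {x | σ < ‖F x‖}ᶜ := by ext; simp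
  rw [this, indicator_self_add_compl]

/-- Where `‖F x‖ > σ` and `q > 1`, `‖F x‖ ≤ σ ^ (1 - q) * ‖F x‖ ^ q`: the high part of an `L^q`
function is in `L¹`. -/
theorem eLpNorm_one_indicator_lt_le {F : α → ℂ} {q σ : ℝ} (hq : 1 < q) (hσ : 0 < σ) :
    eLpNorm ({x | σ < ‖F x‖}.indicator F) 1 μ ≤
      ENNReal.ofReal (σ ^ (1 - q)) * ∫⁻ x, ENNReal.ofReal (‖F x‖ ^ q) ∂μ := by
  rw [eLpNorm_one_eq_lintegral_enorm, ← lintegral_const_mul' _ _ ENNReal.ofReal_ne_top]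
  refine lintegral_mono fun x => ?_
  by_cases h : σ < ‖F x‖
  · rw [indicator_of_mem (show x ∈ {x | σ < ‖F x‖} from h),
      ← ENNReal.ofReal_mul (by positivity), ← ofReal_norm]
    apply ENNReal.ofReal_le_ofReal
    have hpos : 0 < ‖F x‖ := hσ.trans h
    calc ‖F x‖ = ‖F x‖ ^ (1 - q) * ‖F x‖ ^ q := by
          rw [← Real.rpow_add hpos]; simp
      _ ≤ _ := by
          gcongr ?_ * _
          exact Real.rpow_le_rpow_of_nonpos hσ h.le (by linarith)
  · rw [indicator_of_notMem (show x ∉ {x | σ < ‖F x‖} from h)]; simp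

/-- The counterpart for the low part, where `‖F x‖ ^ (2 - q) ≤ σ ^ (2 - q)`. It serves only to know
that the low part is in `L²`; the interpolation keeps the exact integral. -/
theorem lintegral_sq_indicator_le {F : α → ℂ} {q σ : ℝ} (hq2 : q < 2) (hσ : 0 < σ) :
    ∫⁻ x, ENNReal.ofReal (‖F x‖ ^ 2) * ({x | ‖F x‖ ≤ σ}.indicator 1 x) ∂μ ≤
      ENNReal.ofReal (σ ^ (2 - q)) * ∫⁻ x, ENNReal.ofReal (‖F x‖ ^ q) ∂μ := by
  rw [← lintegral_const_mul' _ _ ENNReal.ofReal_ne_top]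
  refine lintegral_mono fun x => ?_
  by_cases h : ‖F x‖ ≤ σ
  · rw [indicator_of_mem (show x ∈ {x | ‖F x‖ ≤ σ} from h), Pi.one_apply, mul_one,
      ← ENNReal.ofReal_mul (by positivity)]
    apply ENNReal.ofReal_le_ofReal
    calc ‖F x‖ ^ 2 = ‖F x‖ ^ (2 - q) * ‖F x‖ ^ q := by
          rw [← Real.rpow_add' (norm_nonneg _) (by norm_num)]; norm_num
      _ ≤ _ := by gcongr
  · rw [indicator_of_notMem (show x ∉ {x | ‖F x‖ ≤ σ} from h)]; simp

theorem eLpNorm_two_sq_eq_lintegral (F : α → ℂ) :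
    eLpNorm F 2 μ ^ (2 : ℝ) = ∫⁻ x, ENNReal.ofReal (‖F x‖ ^ 2) ∂μ := by
  rw [eLpNorm_eq_lintegral_rpow_enorm_toReal (by norm_num) (by norm_num), ← ENNReal.rpow_mul]
  norm_num [ENNReal.ofReal_pow]

theorem eLpNorm_two_sq_indicator_le (F : α → ℂ) (σ : ℝ) :
    eLpNorm ({x | ‖F x‖ ≤ σ}.indicator F) 2 μ ^ (2 : ℝ) =
      ∫⁻ x, ENNReal.ofReal (‖F x‖ ^ 2) * ({x | ‖F x‖ ≤ σ}.indicator 1 x) ∂μ := by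
  rw [eLpNorm_two_sq_eq_lintegral]
  congr 1; ext x
  by_cases h : ‖F x‖ ≤ σ
  · rw [indicator_of_mem (show x ∈ {x | ‖F x‖ ≤ σ} from h),
      indicator_of_mem (show x ∈ {x | ‖F x‖ ≤ σ} from h)]; simp
  · rw [indicator_of_notMem (show x ∉ {x | ‖F x‖ ≤ σ} from h),
      indicator_of_notMem (show x ∉ {x | ‖F x‖ ≤ σ} from h)]; simp

theorem lintegral_ofReal_norm_rpow (F : α → ℂ) {q : ℝ} (hq : 0 < q) :
    ∫⁻ x, ENNReal.ofReal (‖F x‖ ^ q) ∂μ = eLpNorm F (ENNReal.ofReal q) μ ^ q := by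
  rw [eLpNorm_eq_lintegral_rpow_enorm_toReal (by simpa using hq) (by simp), ← ENNReal.rpow_mul,
    ENNReal.toReal_ofReal hq.le, one_div, inv_mul_cancel₀ hq.ne', ENNReal.rpow_one]
  congr 1; ext x
  rw [← ofReal_norm, ENNReal.ofReal_rpow_of_nonneg (norm_nonneg _) hq.le]

/-- A subadditive operator that maps `L¹` to bounded functions and `L²` to `L²`. -/
structure BoundedOneTwo (T : (α → ℂ) → β → ℂ) (μ : Measure α) (ν : Measure β) (C₁ C₂ : ℝ≥0) :
    Prop where
  congr : ∀ F G, F =ᵐ[μ] G → T F = T G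
  smul : ∀ (c : ℂ) F y, T (c • F) y = c * T F y
  add : ∀ F G, MemLp F 1 μ → MemLp G 2 μ → ∀ y, T (F + G) y = T F y + T G y
  meas : ∀ F, AEStronglyMeasurable F μ → AEStronglyMeasurable (T F) ν
  one : ∀ F, MemLp F 1 μ → ∀ y, ‖T F y‖ₑ ≤ C₁ * eLpNorm F 1 μ
  two : ∀ F, MemLp F 2 μ → eLpNorm (T F) 2 ν ≤ C₂ * eLpNorm F 2 μ

/-- Split `F` at a height `σ` depending on `t`. The high part is so small in `L¹` that its image is
pointwise at most `t / 2`, hence `‖T F y‖ > t` forces the image of the low part to be at least `t /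
2`, and Chebyshev in `L²` applies. -/
theorem BoundedOneTwo.meas_lt_le {T : (α → ℂ) → β → ℂ} {C₁ C₂ : ℝ≥0}
    (hT : BoundedOneTwo T μ ν C₁ C₂) {q c : ℝ} (hq : 1 < q) (hq2 : q < 2) (hc : 0 < c)
    (hcC : 2 * C₁ ≤ c) {F : α → ℂ} (hF : StronglyMeasurable F)
    (hF1 : ∫⁻ x, ENNReal.ofReal (‖F x‖ ^ q) ∂μ = 1) (t : ℝ) (ht : 0 < t) :
    ν {y | t < ‖T F y‖} ≤ ENNReal.ofReal (4 * C₂ ^ 2 * t ^ (-2 : ℝ)) *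
      ∫⁻ x, ENNReal.ofReal (‖F x‖ ^ 2) *
        ({t : ℝ | ‖F x‖ ≤ (t / c) ^ (-(1 / (q - 1)))}.indicator 1 t) ∂μ := by
  have hq1 : 0 < q - 1 := by linarith
  set σ := (t / c) ^ (-(1 / (q - 1))) with hσ
  -- The height is chosen so that `σ ^ (1 - q) = t / c`. With `2 * C₁ ≤ c` the image of the high
  -- part is then at most `C₁ * (t / c) ≤ t / 2`.
  have hσpos : 0 < σ := by positivity
  have hσq : σ ^ (1 - q) = t / c := by
    rw [hσ, ← Real.rpow_mul (by positivity)]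
    have : -(1 / (q - 1)) * (1 - q) = 1 := by field_simp; ring
    rw [this, Real.rpow_one]
  set F₁ := {x | σ < ‖F x‖}.indicator F
  set F₂ := {x | ‖F x‖ ≤ σ}.indicator F
  have hadd : F₁ + F₂ = F := indicator_lt_add_indicator_le F σ
  have hm₁ : MeasurableSet {x | σ < ‖F x‖} := measurableSet_lt measurable_const hF.norm.measurable
  have hm₂ : MeasurableSet {x | ‖F x‖ ≤ σ} := measurableSet_le hF.norm.measurable measurable_const
  have h1 : eLpNorm F₁ 1 μ ≤ ENNReal.ofReal (t / c) := by
    have := eLpNorm_one_indicator_lt_le (μ := μ) (F := F) hq hσpos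
    rwa [hF1, mul_one, hσq] at this
  have hF₁ : MemLp F₁ 1 μ :=
    ⟨(hF.indicator hm₁).aestronglyMeasurable, h1.trans_lt ENNReal.ofReal_lt_top⟩
  have hF₂eq : eLpNorm F₂ 2 μ ^ (2 : ℝ) = _ := eLpNorm_two_sq_indicator_le (μ := μ) F σ
  have hF₂ : MemLp F₂ 2 μ := by
    refine ⟨(hF.indicator hm₂).aestronglyMeasurable, ?_⟩
    have := lintegral_sq_indicator_le (μ := μ) (F := F) hq2 hσpos
    rw [← hF₂eq, hF1, mul_one] at this
    have h2 := this.trans_lt ENNReal.ofReal_lt_top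
    exact (ENNReal.rpow_lt_top_iff_of_pos (by norm_num)).1 h2
  have hsub : {y | t < ‖T F y‖} ⊆ {y | ENNReal.ofReal (t / 2) ≤ ‖T F₂ y‖ₑ} := by
    intro y hy
    have hb : ‖T F₁ y‖ ≤ t / 2 := by
      have := (hT.one F₁ hF₁ y).trans (mul_le_mul_right h1 _)
      rw [← ENNReal.ofReal_coe_nnreal, ← ENNReal.ofReal_mul (by positivity),
        ← ofReal_norm, ENNReal.ofReal_le_ofReal_iff (by positivity)] at this
      refine this.trans ?_
      rw [mul_div_assoc', div_le_iff₀ hc]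
      nlinarith
    have := hT.add F₁ F₂ hF₁ hF₂ y
    rw [hadd] at this
    have h3 : t < ‖T F₁ y + T F₂ y‖ := by rw [← this]; exact hy
    have h4 := norm_add_le (T F₁ y) (T F₂ y)
    change ENNReal.ofReal (t / 2) ≤ ‖T F₂ y‖ₑ
    rw [← ofReal_norm]
    exact ENNReal.ofReal_le_ofReal (by linarith)
  have hch := meas_ge_le_mul_pow_eLpNorm_enorm ν (p := 2) (by norm_num) (by norm_num)
    (hT.meas F₂ hF₂.1) (ε := ENNReal.ofReal (t / 2)) (by simpa using ht) (by simp)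
  calc _ ≤ _ := measure_mono hsub
    _ ≤ _ := hch
    _ ≤ (ENNReal.ofReal (t / 2))⁻¹ ^ (2 : ℝ) * (C₂ * eLpNorm F₂ 2 μ) ^ (2 : ℝ) := by
        simp only [ENNReal.toReal_ofNat]
        gcongr
        exact hT.two F₂ hF₂
    _ = _ := by
        rw [ENNReal.mul_rpow_of_nonneg _ _ (by norm_num), hF₂eq, ← mul_assoc]
        congr 1
        rw [← ENNReal.ofReal_inv_of_pos (by positivity), ← ENNReal.ofReal_coe_nnreal,
          ENNReal.ofReal_rpow_of_nonneg (by positivity) (by norm_num),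
          ENNReal.ofReal_rpow_of_nonneg (by positivity) (by norm_num),
          ← ENNReal.ofReal_mul (by positivity)]
        congr 1
        rw [Real.rpow_neg ht.le]
        norm_num
        field_simp
        ring

/-- Real interpolation between `L¹ → L^∞` and `L² → L²`, for functions of norm one. -/
theorem BoundedOneTwo.eLpNorm_le_of_normalized [SFinite μ] {C₁ C₂ : ℝ≥0} {q s : ℝ} (hq : 1 < q)
    (hq2 : q < 2) (hs : s = q / (q - 1)) : ∃ C : ℝ≥0, ∀ T : (α → ℂ) → β → ℂ,
    BoundedOneTwo T μ ν C₁ C₂ → ∀ F : α → ℂ, StronglyMeasurable F →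
    eLpNorm F (ENNReal.ofReal q) μ = 1 → eLpNorm (T F) (ENNReal.ofReal s) ν ≤ C := by
  have hq1 : 0 < q - 1 := by linarith
  have hs2 : 2 < s := by rw [hs, lt_div_iff₀ hq1]; linarith
  -- The summand `1` keeps `c` positive when `C₁ = 0`.
  set c : ℝ := 2 * C₁ + 1
  have hc : 0 < c := by positivity
  refine ⟨(Real.toNNReal (s * (4 * C₂ ^ 2) * (c ^ (s - 2) / (s - 2)))) ^ (1 / s), ?_⟩
  intro T hT F hF hF1
  have hF1' : ∫⁻ x, ENNReal.ofReal (‖F x‖ ^ q) ∂μ = 1 := by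
    rw [lintegral_ofReal_norm_rpow F (by linarith), hF1, ENNReal.one_rpow]
  have := lintegral_rpow_le_of_meas_lt_le (μ := μ) (ν := ν) (a := fun x => ‖F x‖)
    (b := fun y => ‖T F y‖) (K := 4 * C₂ ^ 2) hq hq2 hs hc (by positivity) hF.norm.measurable
    (fun x => norm_nonneg _) (hT.meas F hF.aestronglyMeasurable).norm.aemeasurable
    (fun x => norm_nonneg _) (hT.meas_lt_le hq hq2 hc (by linarith) hF hF1')
  rw [hF1', mul_one, lintegral_ofReal_norm_rpow _ (by linarith)] at this
  have h2 := ENNReal.rpow_le_rpow this (z := 1 / s) (by positivity)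
  rw [← ENNReal.rpow_mul, mul_one_div_cancel (by linarith), ENNReal.rpow_one] at h2
  rwa [ENNReal.coe_rpow_of_nonneg _ (by positivity)]

/-- Real interpolation between `L¹ → L^∞` and `L² → L²`. -/
theorem BoundedOneTwo.exists_eLpNorm_le [SFinite μ] {T : (α → ℂ) → β → ℂ} {C₁ C₂ : ℝ≥0}
    (hT : BoundedOneTwo T μ ν C₁ C₂) {q q' : ℝ≥0∞} (hq : 1 ≤ q) (hq2 : q ≤ 2)
    (hqq : q⁻¹ + q'⁻¹ = 1) :
    ∃ C : ℝ≥0, ∀ F, MemLp F q μ → eLpNorm (T F) q' ν ≤ C * eLpNorm F q μ := by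
  rcases hq.eq_or_lt with rfl | hq
  · have : q' = ∞ := by
      rw [inv_one] at hqq
      have : q'⁻¹ = 0 := by
        have h := hqq.trans (add_zero (1 : ℝ≥0∞)).symm
        exact (ENNReal.add_right_inj ENNReal.one_ne_top).1 h
      simpa using this
    subst this
    refine ⟨C₁, fun F hF => ?_⟩
    rw [eLpNorm_exponent_top]
    exact essSup_le_of_ae_le _ (Filter.Eventually.of_forall fun y => hT.one F hF y)
  rcases hq2.eq_or_lt with rfl | hq2
  · have : q' = 2 := by
      have h2 : q'⁻¹ = 2⁻¹ := by
        refine (ENNReal.add_right_inj (a := (2 : ℝ≥0∞)⁻¹) (by simp)).1 ?_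
        rw [hqq, ENNReal.inv_two_add_inv_two]
      exact inv_injective h2
    subst this
    exact ⟨C₂, fun F hF => hT.two F hF⟩
  have hqtop : q ≠ ∞ := (hq2.trans (by norm_num)).ne
  obtain ⟨x, hx⟩ : ∃ x : ℝ, x = q.toReal := ⟨_, rfl⟩
  have hqx : q = ENNReal.ofReal x := by rw [hx, ENNReal.ofReal_toReal hqtop]
  have hx1 : 1 < x := by rw [hqx] at hq; simpa using hq
  have hx2 : x < 2 := by
    rw [hqx, ENNReal.ofReal_lt_iff_lt_toReal (by linarith) (by norm_num)] at hq2; simpa using hq2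
  have hq's : q' = ENNReal.ofReal (x / (x - 1)) := by
    have hx0 : 0 < x := by linarith
    have h1 : (ENNReal.ofReal (x / (x - 1)))⁻¹ = ENNReal.ofReal (1 - x⁻¹) := by
      rw [← ENNReal.ofReal_inv_of_pos (div_pos hx0 (by linarith))]
      congr 1
      have : x - 1 ≠ 0 := by linarith
      field_simp
    have h2 : q'⁻¹ = ENNReal.ofReal (1 - x⁻¹) := by
      refine (ENNReal.add_right_inj (a := q⁻¹) (by simpa using (zero_lt_one.trans hq).ne')).1 ?_
      rw [hqq, hqx, ← ENNReal.ofReal_inv_of_pos hx0, ← ENNReal.ofReal_add (by positivity)]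
      · simp
      · rw [sub_nonneg]; exact inv_le_one_of_one_le₀ hx1.le
    exact inv_injective (h2.trans h1.symm)
  obtain ⟨C, hC⟩ := BoundedOneTwo.eLpNorm_le_of_normalized (μ := μ) (ν := ν) (C₁ := C₁) (C₂ := C₂)
    hx1 hx2 rfl
  refine ⟨C, fun F hF => ?_⟩
  set G := hF.1.mk F
  have hFG : F =ᵐ[μ] G := hF.1.ae_eq_mk
  rw [hT.congr F G hFG, eLpNorm_congr_ae hFG]
  have hG : MemLp G q μ := (memLp_congr_ae hFG).1 hF
  by_cases h0 : eLpNorm G q μ = 0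
  · have hG0 : G =ᵐ[μ] 0 := (eLpNorm_eq_zero_iff hG.1 (zero_lt_one.trans hq).ne').1 h0
    have h1 : MemLp (0 : α → ℂ) 1 μ := MemLp.zero
    have : ∀ y, T 0 y = 0 := fun y => by
      have := hT.one 0 h1 y
      simpa using this
    rw [hT.congr G 0 hG0, h0, mul_zero, show T 0 = 0 from funext this, eLpNorm_zero]
  -- The uniform constant is known for functions of norm one; homogeneity transfers it to `G`.
  · set N := (eLpNorm G q μ).toReal with hN
    have hNe : eLpNorm G q μ = ENNReal.ofReal N := (ENNReal.ofReal_toReal hG.2.ne).symm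
    have hNpos : 0 < N := ENNReal.toReal_pos h0 hG.2.ne
    have hne : ‖((N⁻¹ : ℝ) : ℂ)‖ₑ = ENNReal.ofReal N⁻¹ := by
      rw [← ofReal_norm, Complex.norm_real, Real.norm_of_nonneg (by positivity)]
    have hnorm : eLpNorm (((N⁻¹ : ℝ) : ℂ) • G) q μ = 1 := by
      rw [eLpNorm_const_smul, hne, hNe, ← ENNReal.ofReal_mul (by positivity),
        inv_mul_cancel₀ hNpos.ne', ENNReal.ofReal_one]
    have := hC T hT (((N⁻¹ : ℝ) : ℂ) • G) (hF.1.stronglyMeasurable_mk.const_smul _)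
      (by rw [← hqx]; exact hnorm)
    have h3 : T (((N⁻¹ : ℝ) : ℂ) • G) = ((N⁻¹ : ℝ) : ℂ) • T G := by
      ext y; rw [hT.smul]; rfl
    rw [h3, ← hq's, eLpNorm_const_smul, hne] at this
    have h4 := mul_le_mul_right this (ENNReal.ofReal N)
    rw [← mul_assoc, ← ENNReal.ofReal_mul hNpos.le, mul_inv_cancel₀ hNpos.ne',
      ENNReal.ofReal_one, one_mul] at h4
    rw [hNe, mul_comm]
    exact h4

end Interpolation

/-! ### Lebesgue norms by duality. -/

section Duality

open Set Filter

variable {α : Type*} [MeasurableSpace α] {μ : Measure α}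

/-- For `M > K`, test with the conjugate phase of `f` on `{‖f‖ > M}`, which has finite measure
because `f ∈ L²`. This gives `M * μ A ≤ K * μ A`, so `A` is null. -/
theorem eLpNorm_top_le_of_integral_le {f : α → ℂ} (hf : MemLp f 2 μ) {K : ℝ≥0∞}
    (h : ∀ k : α → ℂ, MemLp k 1 μ → MemLp k 2 μ → ‖∫ x, f x * k x ∂μ‖ₑ ≤ K * eLpNorm k 1 μ) :
    eLpNorm f ∞ μ ≤ K := by
  wlog hsm : StronglyMeasurable f generalizing f
  · have hae := hf.1.ae_eq_mk
    rw [eLpNorm_congr_ae hae]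
    refine this ((memLp_congr_ae hae).1 hf) (fun k hk1 hk2 => ?_) hf.1.stronglyMeasurable_mk
    convert h k hk1 hk2 using 2
    refine integral_congr_ae ?_
    filter_upwards [hae] with x hx
    rw [hx]
  refine le_of_forall_gt_imp_ge_of_dense fun M hM => ?_
  rcases eq_or_ne M ∞ with rfl | hMtop
  · exact le_top
  lift M to ℝ≥0 using hMtop
  have hM0 : 0 < M := by
    have := pos_of_gt hM
    simpa using this
  set A : Set α := {x | (M : ℝ) < ‖f x‖} with hA
  have hAm : MeasurableSet A := measurableSet_lt measurable_const hsm.norm.measurable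
  have hAfin : μ A < ∞ := by
    refine (measure_mono fun x (hx : (M : ℝ) < ‖f x‖) => ?_).trans_lt
      (hf.meas_ge_lt_top' (by norm_num) (by norm_num) (ε := (M : ℝ≥0∞)) (by simpa using hM0.ne'))
    have : M ≤ ‖f x‖₊ := by exact_mod_cast hx.le
    simpa using this
  set k : α → ℂ := A.indicator fun x => conj (f x) / ‖f x‖ with hk
  have hkm : StronglyMeasurable k := by
    refine StronglyMeasurable.indicator ?_ hAm
    exact ((Complex.continuous_conj.comp_stronglyMeasurable hsm).measurable.div
      (Complex.continuous_ofReal.comp_stronglyMeasurable hsm.norm).measurable).stronglyMeasurable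
  have hkn : ∀ x, ‖k x‖ₑ = A.indicator 1 x := by
    intro x
    by_cases hx : x ∈ A
    · have : 0 < ‖f x‖ := lt_of_le_of_lt M.2 hx
      rw [hk, indicator_of_mem hx, indicator_of_mem hx, ← ofReal_norm]
      simp [this.ne']
    · simp [hk, indicator_of_notMem hx]
  have hk1 : eLpNorm k 1 μ = μ A := by
    rw [eLpNorm_one_eq_lintegral_enorm]
    simp_rw [hkn]
    rw [lintegral_indicator_one hAm]
  have hkL : ∀ p, MemLp k p μ := by
    intro p
    have : MemLp (A.indicator fun _ => (1 : ℝ)) p μ := memLp_indicator_const p hAm 1 (Or.inr hAfin.ne)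
    refine this.of_le hkm.aestronglyMeasurable (Eventually.of_forall fun x => ?_)
    rw [← ENNReal.ofReal_le_ofReal_iff (norm_nonneg _), ofReal_norm, ofReal_norm, hkn]
    by_cases hx : x ∈ A <;> simp [hx]
  have hint : ∫ x, f x * k x ∂μ = ((∫ x in A, ‖f x‖ ∂μ : ℝ) : ℂ) := by
    rw [← integral_indicator hAm, ← integral_complex_ofReal]
    congr 1; ext x
    by_cases hx : x ∈ A
    · have : 0 < ‖f x‖ := lt_of_le_of_lt M.2 hx
      have hne : (‖f x‖ : ℂ) ≠ 0 := by exact_mod_cast this.ne'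
      rw [hk]
      simp only [indicator_of_mem hx]
      rw [← mul_div_assoc, Complex.mul_conj, Complex.normSq_eq_norm_sq, div_eq_iff hne]
      push_cast; ring
    · simp [hk, indicator_of_notMem hx]
  have hfA : IntegrableOn (fun x => ‖f x‖) A μ := by
    have : IsFiniteMeasure (μ.restrict A) := ⟨by simpa using hAfin⟩
    exact ((hf.restrict A).integrable (by norm_num)).norm
  have hlow : (M : ℝ≥0∞) * μ A ≤ ‖∫ x, f x * k x ∂μ‖ₑ := by
    rw [hint, ← ofReal_norm, Complex.norm_real, Real.norm_of_nonneg (by positivity),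
      ofReal_integral_eq_lintegral_ofReal hfA (Eventually.of_forall fun x => norm_nonneg _),
      ← setLIntegral_const]
    refine setLIntegral_mono' hAm fun x hx => ?_
    rw [← ENNReal.ofReal_coe_nnreal]
    exact ENNReal.ofReal_le_ofReal (le_of_lt hx)
  have hle := hlow.trans (h k (hkL 1) (hkL 2))
  rw [hk1] at hle
  have hA0 : μ A = 0 := by
    by_contra h0
    exact absurd ((ENNReal.mul_le_mul_iff_left h0 hAfin.ne).1 hle) (not_le.2 hM)
  rw [eLpNorm_exponent_top]
  refine essSup_le_of_ae_le _ ?_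
  have : ∀ᵐ x ∂μ, x ∉ A := measure_eq_zero_iff_ae_notMem.1 hA0
  filter_upwards [this] with x hx
  have : ‖f x‖ ≤ M := not_lt.1 hx
  rw [← ofReal_norm, ← ENNReal.ofReal_coe_nnreal]
  exact ENNReal.ofReal_le_ofReal this

/-- The extremal function `conj F * ‖F‖ ^ (s - 2)` of Hölder's inequality is used as the test
function. Truncating `f` at height `n` keeps it in `L²` and makes `∫ ‖F‖ ^ s` finite (here `s ≥ 2`
matters), so that `X ≤ K * X ^ (1 / q)` may be divided by `X ^ (1 / q)`. -/
theorem eLpNorm_indicator_le_of_integral_le {f : α → ℂ} (hf : MemLp f 2 μ)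
    (hsm : StronglyMeasurable f) {q s : ℝ} (hqs : q.HolderConjugate s) (hs2 : 2 ≤ s) {K : ℝ≥0∞}
    (h : ∀ k : α → ℂ, MemLp k (ENNReal.ofReal q) μ → MemLp k 2 μ →
      ‖∫ x, f x * k x ∂μ‖ₑ ≤ K * eLpNorm k (ENNReal.ofReal q) μ) (n : ℕ) :
    eLpNorm ({x | ‖f x‖ ≤ n}.indicator f) (ENNReal.ofReal s) μ ≤ K := by
  have hq0 : 0 < q := hqs.pos
  have hs0 : 0 < s := hqs.symm.pos
  set A : Set α := {x | ‖f x‖ ≤ n} with hA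
  have hAm : MeasurableSet A := measurableSet_le hsm.norm.measurable measurable_const
  set F : α → ℂ := A.indicator f with hF
  have hFm : StronglyMeasurable F := hsm.indicator hAm
  have hFn : ∀ x, ‖F x‖ ≤ n := by
    intro x
    by_cases hx : x ∈ A
    · rw [hF, indicator_of_mem hx]; exact hx
    · simp [hF, hx]
  set k : α → ℂ := fun x => conj (F x) * ((‖F x‖ ^ (s - 2) : ℝ) : ℂ) with hk
  have hkm : StronglyMeasurable k :=
    (Complex.continuous_conj.comp_stronglyMeasurable hFm).mul
      (Complex.continuous_ofReal.comp_stronglyMeasurable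
        ((Measurable.pow_const hFm.norm.measurable _).stronglyMeasurable))
  have hkn : ∀ x, ‖k x‖ = ‖F x‖ ^ (s - 1) := by
    intro x
    simp only [hk, norm_mul, RCLike.norm_conj, Complex.norm_real]
    rw [Real.norm_of_nonneg (by positivity)]
    rcases (norm_nonneg (F x)).eq_or_lt with h0 | h0
    · rw [← h0, zero_mul, Real.zero_rpow (by linarith)]
    · nth_rewrite 1 [← Real.rpow_one ‖F x‖]
      rw [← Real.rpow_add h0]; congr 1; ring
  have hF2 : MemLp F 2 μ := hf.indicator hAm
  have hk2 : MemLp k 2 μ := by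
    refine hF2.of_le_mul (c := (n : ℝ) ^ (s - 2)) hkm.aestronglyMeasurable
      (Eventually.of_forall fun x => ?_)
    simp only [hk, norm_mul, RCLike.norm_conj, Complex.norm_real]
    rw [Real.norm_of_nonneg (by positivity), mul_comm]
    gcongr
    exact hFn x
  have hkq : ∀ x, ‖k x‖ ^ q = ‖F x‖ ^ s := by
    intro x
    rw [hkn, ← Real.rpow_mul (norm_nonneg _)]
    congr 1
    have := hqs.symm.sub_one_mul_conj
    linarith
  set X := ∫⁻ x, ENNReal.ofReal (‖F x‖ ^ s) ∂μ with hX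
  have hXF : X = eLpNorm F (ENNReal.ofReal s) μ ^ s := lintegral_ofReal_norm_rpow F hs0
  have hXk : X = eLpNorm k (ENNReal.ofReal q) μ ^ q := by
    rw [← lintegral_ofReal_norm_rpow k hq0]; simp_rw [hkq]; rfl
  have hint : Integrable (fun x => ‖F x‖ ^ s) μ := by
    refine (hF2.integrable_norm_pow (by norm_num)).const_mul ((n : ℝ) ^ (s - 2)) |>.mono'
      (Measurable.pow_const hFm.norm.measurable _).aestronglyMeasurable
      (Eventually.of_forall fun x => ?_)
    rw [Real.norm_of_nonneg (by positivity)]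
    calc ‖F x‖ ^ s = ‖F x‖ ^ (s - 2) * ‖F x‖ ^ 2 := by
          rw [← Real.rpow_natCast, ← Real.rpow_add' (norm_nonneg _)]
          · congr 1; push_cast; ring
          · push_cast; linarith
      _ ≤ _ := by
          gcongr
          exact hFn x
  have hXtop : X ≠ ∞ := by
    rw [hX, ← ofReal_integral_eq_lintegral_ofReal hint (Eventually.of_forall fun x => by positivity)]
    exact ENNReal.ofReal_ne_top
  have hkL : MemLp k (ENNReal.ofReal q) μ := by
    refine ⟨hkm.aestronglyMeasurable, ?_⟩
    rw [← ENNReal.rpow_lt_top_iff_of_pos hq0, ← hXk]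
    exact hXtop.lt_top
  have hfk : ‖∫ x, f x * k x ∂μ‖ₑ = X := by
    have : ∀ x, f x * k x = ((‖F x‖ ^ s : ℝ) : ℂ) := by
      intro x
      by_cases hx : x ∈ A
      · have hFx : F x = f x := by rw [hF, indicator_of_mem hx]
        simp only [hk]
        rw [← hFx, ← mul_assoc, Complex.mul_conj, Complex.normSq_eq_norm_sq, ← Complex.ofReal_mul]
        congr 1
        rw [← Real.rpow_natCast, ← Real.rpow_add' (norm_nonneg _)]
        · congr 1; push_cast; ring
        · push_cast; linarith
      · have hFx : F x = 0 := by rw [hF, indicator_of_notMem hx]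
        simp [hk, hFx, Real.zero_rpow hs0.ne']
    simp_rw [this]
    rw [integral_complex_ofReal, ← ofReal_norm, Complex.norm_real,
      Real.norm_of_nonneg (integral_nonneg fun x => by positivity),
      ofReal_integral_eq_lintegral_ofReal hint (Eventually.of_forall fun x => by positivity)]
  have hle := h k hkL hk2
  rw [hfk] at hle
  have hsX : eLpNorm F (ENNReal.ofReal s) μ = X ^ (1 / s) := by
    rw [hXF, ← ENNReal.rpow_mul, mul_one_div_cancel hs0.ne', ENNReal.rpow_one]
  have hqX : eLpNorm k (ENNReal.ofReal q) μ = X ^ (1 / q) := by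
    rw [hXk, ← ENNReal.rpow_mul, mul_one_div_cancel hq0.ne', ENNReal.rpow_one]
  rw [hsX]
  rw [hqX] at hle
  by_cases h0 : X = 0
  · rw [h0, ENNReal.zero_rpow_of_pos (by positivity)]; exact zero_le
  · have h1 : X = X ^ (1 / s) * X ^ (1 / q) := by
      rw [← ENNReal.rpow_add _ _ h0 hXtop]
      have := hqs.symm.inv_add_inv_eq_one
      rw [one_div, one_div, this, ENNReal.rpow_one]
    have h2 : X ^ (1 / q) ≠ 0 := by simp [h0, hXtop]
    have h3 : X ^ (1 / q) ≠ ∞ := ENNReal.rpow_ne_top_of_nonneg (by positivity) hXtop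
    refine (ENNReal.mul_le_mul_iff_left h2 h3).1 ?_
    rwa [← h1]

/-- A square-integrable function that is bounded as a functional on `L^q` lies in `L^q'`. -/
theorem eLpNorm_le_of_integral_le {f : α → ℂ} (hf : MemLp f 2 μ) {q q' : ℝ≥0∞} (hq : 1 ≤ q)
    (hq2 : q ≤ 2) (hqq : q⁻¹ + q'⁻¹ = 1) {K : ℝ≥0∞}
    (h : ∀ k : α → ℂ, MemLp k q μ → MemLp k 2 μ → ‖∫ x, f x * k x ∂μ‖ₑ ≤ K * eLpNorm k q μ) :
    eLpNorm f q' μ ≤ K := by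
  have hconj : q.HolderConjugate q' := ⟨by rw [hqq, inv_one]⟩
  rcases hq.eq_or_lt with rfl | hq
  · have : q' = ∞ := (ENNReal.HolderConjugate.unique 1 ∞ q').symm
    subst this
    exact eLpNorm_top_le_of_integral_le hf h
  wlog hsm : StronglyMeasurable f generalizing f
  · have hae := hf.1.ae_eq_mk
    rw [eLpNorm_congr_ae hae]
    refine this ((memLp_congr_ae hae).1 hf) (fun k hk1 hk2 => ?_) hf.1.stronglyMeasurable_mk
    convert h k hk1 hk2 using 2
    refine integral_congr_ae ?_
    filter_upwards [hae] with x hx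
    rw [hx]
  have hqtop : q ≠ ∞ := (hq2.trans_lt (by norm_num)).ne
  have hq'top : q' ≠ ∞ := by
    rintro rfl
    simp at hqq
    exact hq.ne' hqq
  have hreal : q.toReal.HolderConjugate q'.toReal := by
    exact ENNReal.HolderConjugate.toReal_of_ne_top hqtop hq'top
  have hs2 : 2 ≤ q'.toReal := by
    have h1 : q.toReal ≤ 2 := ENNReal.toReal_le_of_le_ofReal (by norm_num) (by simpa using hq2)
    have := hreal.mul_eq_add
    nlinarith [hreal.pos, hreal.lt, hreal.symm.lt]
  have key := eLpNorm_indicator_le_of_integral_le hf hsm hreal hs2 (K := K)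
    (by rwa [ENNReal.ofReal_toReal hqtop])
  rw [ENNReal.ofReal_toReal hq'top] at key
  -- Fatou's lemma removes the truncation.
  have hlim := Lp.eLpNorm_lim_le_liminf_eLpNorm (p := q') (μ := μ)
    (f := fun n : ℕ => {x | ‖f x‖ ≤ n}.indicator f)
    (fun n => (hsm.indicator (measurableSet_le hsm.norm.measurable
      measurable_const)).aestronglyMeasurable) f
    (Eventually.of_forall fun x => by
      obtain ⟨N, hN⟩ := exists_nat_ge ‖f x‖
      refine tendsto_const_nhds.congr' ?_
      filter_upwards [eventually_ge_atTop N] with n hn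
      rw [indicator_of_mem]
      exact hN.trans (by exact_mod_cast hn))
  refine hlim.trans ?_
  refine (liminf_le_liminf (Eventually.of_forall key)).trans ?_
  simp

end Duality

/-! ### Phase space and the Fourier transform of the short-time Fourier transform for Schwartz
functions. -/

noncomputable section PhaseSpace

variable {d : ℕ}

theorem chi_comm (ω t : E d) : chi ω t = chi t ω := by
  rw [chi, chi, real_inner_comm]

theorem norm_chi (ω t : E d) : ‖chi ω t‖ = 1 := by
  rw [chi, Complex.norm_exp_ofReal_mul_I]

theorem chi_add_left (ω η t : E d) : chi (ω + η) t = chi ω t * chi η t := by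
  rw [chi, chi, chi, ← Complex.exp_add, inner_add_left]
  congr 1; push_cast; ring

theorem chi_add_right (ω s t : E d) : chi ω (s + t) = chi ω s * chi ω t := by
  rw [chi_comm, chi_add_left, chi_comm s, chi_comm t]

theorem conj_chi (ω t : E d) : conj (chi ω t) = chi (-ω) t := by
  rw [chi, chi, ← Complex.exp_conj, inner_neg_left]
  congr 1
  rw [map_mul, Complex.conj_ofReal, Complex.conj_I]
  push_cast; ring

theorem chi_neg_right (ω t : E d) : chi ω (-t) = chi (-ω) t := by
  rw [chi, chi, inner_neg_left, inner_neg_right]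

theorem chi_mul_conj (ω t : E d) : chi ω t * conj (chi ω t) = 1 := by
  rw [Complex.mul_conj, Complex.normSq_eq_norm_sq, norm_chi]; simp

theorem continuous_chi : Continuous fun p : E d × E d => chi p.1 p.2 := by
  unfold chi; fun_prop

@[fun_prop]
theorem Continuous.chi {X : Type*} [TopologicalSpace X] {f g : X → E d} (hf : Continuous f)
    (hg : Continuous g) : Continuous fun x => chi (f x) (g x) :=
  continuous_chi.comp (hf.prodMk hg)

theorem norm_tfShift (z : Phase d) (w : E d → ℂ) (t : E d) : ‖tfShift z w t‖ = ‖w (t - z.fst)‖ := by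
  rw [tfShift, norm_mul, norm_chi, one_mul]

theorem fourierInv_eq_integral_chi {V : Type*} [NormedAddCommGroup V] [InnerProductSpace ℝ V]
    [MeasurableSpace V] [BorelSpace V] [FiniteDimensional ℝ V] (f : V → ℂ) (z : V) :
    𝓕⁻ f z = ∫ ξ, cexp (((2 * Real.pi * inner ℝ ξ z : ℝ) : ℂ) * I) * f ξ := by
  rw [Real.fourierInv_eq']
  rfl

/-- The identification of `ℝᵈ × ℝᵈ` with phase space. -/
abbrev mkP (p : E d × E d) : Phase d := WithLp.toLp 2 p

theorem measurePreserving_mkP : MeasurePreserving (mkP : E d × E d → Phase d) :=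
  WithLp.volume_preserving_toLp (E d) (E d)

theorem measurableEmbedding_mkP : MeasurableEmbedding (mkP : E d × E d → Phase d) :=
  (MeasurableEquiv.toLp 2 (E d × E d)).measurableEmbedding

theorem integral_phase {G : Type*} [NormedAddCommGroup G] [NormedSpace ℝ G] (F : Phase d → G) :
    ∫ z, F z = ∫ p : E d × E d, F (mkP p) :=
  (measurePreserving_mkP.integral_comp measurableEmbedding_mkP F).symm

theorem lintegral_phase (F : Phase d → ℝ≥0∞) : ∫⁻ z, F z = ∫⁻ p : E d × E d, F (mkP p) :=
  (measurePreserving_mkP.lintegral_comp_emb measurableEmbedding_mkP F).symm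

theorem integrable_phase_iff {G : Type*} [NormedAddCommGroup G] {F : Phase d → G} :
    Integrable F ↔ Integrable fun p : E d × E d => F (mkP p) :=
  (measurePreserving_mkP.integrable_comp_emb measurableEmbedding_mkP).symm

@[fun_prop]
theorem continuous_fst' : Continuous (fun z : Phase d => z.fst) :=
  WithLp.continuous_fst 2 (E d) (E d)

@[fun_prop]
theorem continuous_snd' : Continuous (fun z : Phase d => z.snd) :=
  WithLp.continuous_snd 2 (E d) (E d)

theorem quasiMeasurePreserving_fst :
    Measure.QuasiMeasurePreserving (WithLp.fst : Phase d → E d) :=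
  Measure.quasiMeasurePreserving_fst.comp
    (WithLp.volume_preserving_ofLp (E d) (E d)).quasiMeasurePreserving

theorem quasiMeasurePreserving_snd :
    Measure.QuasiMeasurePreserving (WithLp.snd : Phase d → E d) :=
  Measure.quasiMeasurePreserving_snd.comp
    (WithLp.volume_preserving_ofLp (E d) (E d)).quasiMeasurePreserving

theorem norm_phase_le (z : Phase d) : ‖z‖ ≤ ‖z.fst‖ + ‖z.snd‖ := by
  refine le_of_sq_le_sq ?_ (by positivity)
  rw [WithLp.prod_norm_sq_eq_of_L2]
  nlinarith [norm_nonneg z.fst, norm_nonneg z.snd]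

theorem norm_fst_le (z : Phase d) : ‖z.fst‖ ≤ ‖z‖ := by
  refine le_of_sq_le_sq ?_ (by positivity)
  rw [WithLp.prod_norm_sq_eq_of_L2]; nlinarith [norm_nonneg z.snd]

theorem norm_snd_le (z : Phase d) : ‖z.snd‖ ≤ ‖z‖ := by
  refine le_of_sq_le_sq ?_ (by positivity)
  rw [WithLp.prod_norm_sq_eq_of_L2]; nlinarith [norm_nonneg z.fst]

/-! ### Tensor products of Schwartz functions -/

theorem norm_iteratedFDeriv_comp_le {f : 𝓢(E d, ℂ)} {A : Phase d →L[ℝ] E d} (hA : ‖A‖ ≤ 1) (n : ℕ)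
    (ξ : Phase d) : ‖iteratedFDeriv ℝ n (fun ξ => f (A ξ)) ξ‖ ≤ ‖iteratedFDeriv ℝ n f (A ξ)‖ := by
  have := A.iteratedFDeriv_comp_right (f.smooth n) ξ (i := n) le_rfl
  change ‖iteratedFDeriv ℝ n (f ∘ A) ξ‖ ≤ _
  rw [this]
  refine (ContinuousMultilinearMap.norm_compContinuousLinearMap_le _ _).trans ?_
  refine mul_le_of_le_one_right (norm_nonneg _) ?_
  exact Finset.prod_le_one (fun _ _ => norm_nonneg _) fun _ _ => hA

/-- Projection to the time variable. -/
abbrev fstCLM (d : ℕ) : Phase d →L[ℝ] E d := WithLp.fstL 2 ℝ (E d) (E d)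

/-- Projection to the frequency variable. -/
abbrev sndCLM (d : ℕ) : Phase d →L[ℝ] E d := WithLp.sndL 2 ℝ (E d) (E d)

theorem norm_fstCLM_le : ‖fstCLM d‖ ≤ 1 :=
  ContinuousLinearMap.opNorm_le_bound _ zero_le_one fun z => by
    rw [one_mul]; exact norm_fst_le z

theorem norm_sndCLM_le : ‖sndCLM d‖ ≤ 1 :=
  ContinuousLinearMap.opNorm_le_bound _ zero_le_one fun z => by
    rw [one_mul]; exact norm_snd_le z

/-- The tensor product of two Schwartz functions. -/
def tensorS (f h : 𝓢(E d, ℂ)) : 𝓢(Phase d, ℂ) where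
  toFun ξ := f ξ.fst * h ξ.snd
  smooth' := by
    have h1 : ContDiff ℝ (⊤ : ℕ∞) fun ξ : Phase d => f (fstCLM d ξ) :=
      (f.smooth ⊤).comp (fstCLM d).contDiff
    have h2 : ContDiff ℝ (⊤ : ℕ∞) fun ξ : Phase d => h (sndCLM d ξ) :=
      (h.smooth ⊤).comp (sndCLM d).contDiff
    exact h1.mul h2
  decay' k n := by
    choose C _ hC using f.decay
    choose D _ hD using h.decay
    -- Leibniz rule, together with `‖ξ‖ ^ k ≤ 2 ^ (k - 1) * (‖ξ.fst‖ ^ k + ‖ξ.snd‖ ^ k)`; each power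
    -- of a coordinate is absorbed by the factor living in that coordinate.
    refine ⟨∑ i ∈ Finset.range (n + 1), (n.choose i : ℝ) * (2 ^ (k - 1) *
      (C k i * D 0 (n - i) + C 0 i * D k (n - i))), fun ξ => ?_⟩
    have h1 : ContDiff ℝ n fun ξ : Phase d => f (fstCLM d ξ) :=
      (f.smooth n).comp (fstCLM d).contDiff
    have h2 : ContDiff ℝ n fun ξ : Phase d => h (sndCLM d ξ) :=
      (h.smooth n).comp (sndCLM d).contDiff
    calc _ ≤ ‖ξ‖ ^ k * ∑ i ∈ Finset.range (n + 1), (n.choose i : ℝ) *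
          ‖iteratedFDeriv ℝ i (fun ξ => f (fstCLM d ξ)) ξ‖ *
          ‖iteratedFDeriv ℝ (n - i) (fun ξ => h (sndCLM d ξ)) ξ‖ := by
          gcongr
          exact norm_iteratedFDeriv_mul_le h1 h2 ξ le_rfl
      _ ≤ _ := by
          rw [Finset.mul_sum]
          refine Finset.sum_le_sum fun i _ => ?_
          set a := ‖iteratedFDeriv ℝ i f (fstCLM d ξ)‖
          set b := ‖iteratedFDeriv ℝ (n - i) h (sndCLM d ξ)‖
          have ha : ‖iteratedFDeriv ℝ i (fun ξ => f (fstCLM d ξ)) ξ‖ ≤ a :=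
            norm_iteratedFDeriv_comp_le norm_fstCLM_le i ξ
          have hb : ‖iteratedFDeriv ℝ (n - i) (fun ξ => h (sndCLM d ξ)) ξ‖ ≤ b :=
            norm_iteratedFDeriv_comp_le norm_sndCLM_le (n - i) ξ
          have hξ : ‖ξ‖ ^ k ≤ 2 ^ (k - 1) * (‖ξ.fst‖ ^ k + ‖ξ.snd‖ ^ k) :=
            (pow_le_pow_left₀ (norm_nonneg _) (norm_phase_le ξ) k).trans
              (add_pow_le (norm_nonneg _) (norm_nonneg _) k)
          have h3 : ‖ξ.fst‖ ^ k * a ≤ C k i := hC k i _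
          have h4 : ‖ξ.snd‖ ^ k * b ≤ D k (n - i) := hD k (n - i) _
          have h5 : a ≤ C 0 i := by
            have := hC 0 i ξ.fst
            rw [pow_zero, one_mul] at this
            exact this
          have h6 : b ≤ D 0 (n - i) := by
            have := hD 0 (n - i) ξ.snd
            rw [pow_zero, one_mul] at this
            exact this
          have ha0 : 0 ≤ a := norm_nonneg _
          have hb0 : 0 ≤ b := norm_nonneg _
          calc _ ≤ (2 ^ (k - 1) * (‖ξ.fst‖ ^ k + ‖ξ.snd‖ ^ k)) * ((n.choose i : ℝ) * a * b) := by
                gcongr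
            _ = (n.choose i : ℝ) * (2 ^ (k - 1) * ((‖ξ.fst‖ ^ k * a) * b + a * (‖ξ.snd‖ ^ k * b))) := by
                ring
            _ ≤ _ := by
                gcongr
                · exact h3.trans' (by positivity)
                · exact h5.trans' ha0

@[simp]
theorem tensorS_apply (f h : 𝓢(E d, ℂ)) (ξ : Phase d) : tensorS f h ξ = f ξ.fst * h ξ.snd := rfl

theorem chirp_hasTemperateGrowth : (fun ξ : Phase d => chi ξ.fst ξ.snd).HasTemperateGrowth := by
  have h : (fun ξ : Phase d => 2 * Real.pi * inner ℝ ξ.fst ξ.snd).HasTemperateGrowth := by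
    have h1 := (innerSL ℝ : E d →L[ℝ] E d →L[ℝ] ℝ).bilinear_hasTemperateGrowth
      (fstCLM d).hasTemperateGrowth (sndCLM d).hasTemperateGrowth
    exact (Function.HasTemperateGrowth.const (2 * Real.pi)).mul h1
  exact hasTemperateGrowth_exp_mul_I.comp h

/-- The Fourier transform of the short-time Fourier transform of `f` with a window that has the
Fourier transform `v`. -/
def rih (v f : E d → ℂ) (ξ : Phase d) : ℂ := chi ξ.fst ξ.snd * (conj (v ξ.fst) * f (-ξ.snd))

/-- `rih v f` for Schwartz functions. -/
def rihS (v f : 𝓢(E d, ℂ)) : 𝓢(Phase d, ℂ) :=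
  SchwartzMap.smulLeftCLM ℂ (fun ξ : Phase d => chi ξ.fst ξ.snd) (tensorS (conjS v)
    (SchwartzMap.compCLMOfContinuousLinearEquiv ℂ (ContinuousLinearEquiv.neg ℝ) f))

@[simp]
theorem rihS_apply (v f : 𝓢(E d, ℂ)) (ξ : Phase d) : rihS v f ξ = rih v f ξ := by
  simp [rihS, rih, SchwartzMap.smulLeftCLM_apply_apply chirp_hasTemperateGrowth]

/-- Fubini: integrating over the first frequency variable inverts the Fourier transform of the
window, the chirp supplying the shift by `-s`; the reflection `s ↦ -s` then yields the defining
integral. -/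
theorem stft_fourierInv_eq (v f : 𝓢(E d, ℂ)) (z : Phase d) :
    stft (𝓕⁻ v : 𝓢(E d, ℂ)) f z = (𝓕⁻ (rihS v f) : 𝓢(Phase d, ℂ)) z := by
  have key : ∀ η s : E d, chi (mkP (η, s)).fst z.fst * chi (mkP (η, s)).snd z.snd * rihS v f (mkP (η, s)) =
      (f (-s) * chi s z.snd) * conj (chi η (-s - z.fst) * v η) := by
    intro η s
    rw [rihS_apply, rih, map_mul, conj_chi]
    have : chi (-η) (-s - z.fst) = chi η s * chi η z.fst := by
      rw [← chi_neg_right, ← chi_add_right]; congr 1; abel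
    rw [this]
    simp only [WithLp.toLp_fst, WithLp.toLp_snd]
    ring
  have hint : Integrable fun p : E d × E d =>
      chi (mkP p).fst z.fst * chi (mkP p).snd z.snd * rihS v f (mkP p) := by
    have h0 : Integrable fun p : E d × E d => rihS v f (mkP p) :=
      integrable_phase_iff.1 (rihS v f).integrable
    refine h0.bdd_mul (c := 1) ?_ ?_
    · exact (Continuous.mul (by fun_prop) (by fun_prop)).aestronglyMeasurable
    · refine Filter.Eventually.of_forall fun p => ?_
      rw [norm_mul, norm_chi, norm_chi]; norm_num
  rw [SchwartzMap.fourierInv_coe (rihS v f), fourierInv_eq_integral_chi, integral_phase]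
  have hchi : ∀ ξ : Phase d, cexp (((2 * Real.pi * inner ℝ ξ z : ℝ) : ℂ) * I) =
      chi ξ.fst z.fst * chi ξ.snd z.snd := by
    intro ξ
    rw [chi, chi, ← Complex.exp_add, WithLp.prod_inner_apply, WithLp.ofLp_fst, WithLp.ofLp_snd,
      WithLp.ofLp_fst, WithLp.ofLp_snd]
    congr 1; push_cast; ring
  simp_rw [hchi]
  rw [Measure.volume_eq_prod] at hint ⊢
  rw [integral_prod_symm _ hint]
  simp_rw [key, integral_const_mul, integral_conj]
  rw [← integral_neg_eq_self]
  rw [stft]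
  congr 1; ext s
  rw [neg_neg, tfShift, map_mul, conj_chi, SchwartzMap.fourierInv_coe, fourierInv_eq_integral_chi]
  rw [chi_comm (-s), chi_neg_right, ← mul_assoc]
  rfl

end PhaseSpace

/-! ### The short-time Fourier transform on `L²` and Moyal's identity. -/

noncomputable section SquareIntegrable

open Filter Topology

variable {d : ℕ}

/-- Stated without scalars because the maps it is applied to are linear in one argument and
conjugate-linear in the other. -/
theorem continuous_of_biadditive {X Y Z : Type*} [SeminormedAddCommGroup X]
    [SeminormedAddCommGroup Y] [SeminormedAddCommGroup Z] (B : X → Y → Z) {C : ℝ}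
    (h₁ : ∀ x x' y, B (x - x') y = B x y - B x' y) (h₂ : ∀ x y y', B x (y - y') = B x y - B x y')
    (hB : ∀ x y, ‖B x y‖ ≤ C * ‖x‖ * ‖y‖) : Continuous fun p : X × Y => B p.1 p.2 := by
  rw [continuous_iff_continuousAt]
  rintro ⟨x, y⟩
  rw [ContinuousAt, tendsto_iff_norm_sub_tendsto_zero]
  have hlim : Tendsto (fun p : X × Y => C * ‖p.1 - x‖ * ‖p.2‖ + C * ‖x‖ * ‖p.2 - y‖) (𝓝 (x, y))
      (𝓝 0) := by
    have : Continuous fun p : X × Y => C * ‖p.1 - x‖ * ‖p.2‖ + C * ‖x‖ * ‖p.2 - y‖ := by fun_prop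
    simpa using this.tendsto (x, y)
  refine squeeze_zero (fun _ => norm_nonneg _) (fun p => ?_) hlim
  have : B p.1 p.2 - B x y = B (p.1 - x) p.2 + B x (p.2 - y) := by rw [h₁, h₂]; abel
  rw [this]
  exact (norm_add_le _ _).trans (add_le_add (hB _ _) (hB _ _))

/-! ### Bounds for the short-time Fourier transform -/

theorem measurePreserving_sub (x : E d) : MeasurePreserving (fun t : E d => t - x) :=
  measurePreserving_sub_right volume x

theorem aestronglyMeasurable_tfShift {w : E d → ℂ} (hw : AEStronglyMeasurable w) (z : Phase d) :
    AEStronglyMeasurable (tfShift z w) := by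
  refine AEStronglyMeasurable.mul ?_ (hw.comp_measurePreserving (measurePreserving_sub z.fst))
  exact (Continuous.chi continuous_const continuous_id).aestronglyMeasurable

theorem eLpNorm_tfShift {w : E d → ℂ} (hw : AEStronglyMeasurable w) (z : Phase d) (p : ℝ≥0∞) :
    eLpNorm (tfShift z w) p = eLpNorm w p := by
  rw [← eLpNorm_comp_measurePreserving hw (measurePreserving_sub z.fst)]
  exact eLpNorm_congr_norm_ae (Eventually.of_forall fun t => norm_tfShift z w t)

theorem memLp_tfShift {w : E d → ℂ} {p : ℝ≥0∞} (hw : MemLp w p) (z : Phase d) :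
    MemLp (tfShift z w) p :=
  ⟨aestronglyMeasurable_tfShift hw.1 z, by rw [eLpNorm_tfShift hw.1]; exact hw.2⟩

theorem memLp_conj {α : Type*} [MeasurableSpace α] {μ : Measure α} {w : α → ℂ} {p : ℝ≥0∞}
    (hw : MemLp w p μ) : MemLp (fun t => conj (w t)) p μ := hw.star

theorem eLpNorm_conj {α : Type*} [MeasurableSpace α] {μ : Measure α} (w : α → ℂ) (p : ℝ≥0∞) :
    eLpNorm (fun t => conj (w t)) p μ = eLpNorm w p μ :=
  eLpNorm_congr_norm_ae (Eventually.of_forall fun t => by simp)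

theorem lintegral_enorm_mul_le {α : Type*} [MeasurableSpace α] {μ : Measure α} {f g : α → ℂ}
    {p q : ℝ≥0∞} [p.HolderConjugate q] (hf : AEStronglyMeasurable f μ)
    (hg : AEStronglyMeasurable g μ) :
    ∫⁻ x, ‖f x * g x‖ₑ ∂μ ≤ eLpNorm f p μ * eLpNorm g q μ := by
  rw [← eLpNorm_one_eq_lintegral_enorm (f := fun x => f x * g x)]
  have h : eLpNorm (f • g) 1 μ ≤ eLpNorm f p μ * eLpNorm g q μ :=
    eLpNorm_smul_le_mul_eLpNorm (p := p) (q := q) (r := 1) hg hf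
  exact h

theorem enorm_integral_mul_le {α : Type*} [MeasurableSpace α] {μ : Measure α} {f g : α → ℂ}
    {p q : ℝ≥0∞} [p.HolderConjugate q] (hf : AEStronglyMeasurable f μ)
    (hg : AEStronglyMeasurable g μ) :
    ‖∫ x, f x * g x ∂μ‖ₑ ≤ eLpNorm f p μ * eLpNorm g q μ :=
  (enorm_integral_le_lintegral_enorm _).trans (lintegral_enorm_mul_le hf hg)

theorem integrable_stft_integrand {w f : E d → ℂ} {p q : ℝ≥0∞} [p.HolderConjugate q]
    (hw : MemLp w q) (hf : MemLp f p) (z : Phase d) :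
    Integrable fun t => f t * conj (tfShift z w t) :=
  hf.integrable_mul (memLp_conj (memLp_tfShift hw z))

theorem enorm_stft_le {w f : E d → ℂ} {p q : ℝ≥0∞} [p.HolderConjugate q]
    (hw : AEStronglyMeasurable w) (hf : AEStronglyMeasurable f) (z : Phase d) :
    ‖stft w f z‖ₑ ≤ eLpNorm f p * eLpNorm w q := by
  rw [← eLpNorm_tfShift hw z q, ← eLpNorm_conj (tfShift z w)]
  have := aestronglyMeasurable_tfShift hw z
  exact enorm_integral_mul_le hf (Complex.continuous_conj.comp_aestronglyMeasurable this)

theorem tfShift_congr_ae {w w' : E d → ℂ} (h : w =ᵐ[volume] w') (z : Phase d) :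
    tfShift z w =ᵐ[volume] tfShift z w' := by
  have := (measurePreserving_sub z.fst).quasiMeasurePreserving.ae_eq_comp h
  filter_upwards [this] with t ht
  simp only [Function.comp_apply] at ht
  simp [tfShift, ht]

theorem stft_congr_ae {w w' f f' : E d → ℂ} (hw : w =ᵐ[volume] w') (hf : f =ᵐ[volume] f') :
    stft w f = stft w' f' := by
  ext z
  refine integral_congr_ae ?_
  filter_upwards [tfShift_congr_ae hw z, hf] with t h1 h2
  rw [h1, h2]

theorem stft_sub_right {w f f' : E d → ℂ} (hw : MemLp w 2) (hf : MemLp f 2) (hf' : MemLp f' 2)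
    (z : Phase d) : stft w (f - f') z = stft w f z - stft w f' z := by
  rw [stft, stft, stft, ← integral_sub (integrable_stft_integrand (p := 2) (q := 2) hw hf z)
    (integrable_stft_integrand (p := 2) (q := 2) hw hf' z)]
  congr 1; ext t; simp [sub_mul]

theorem stft_sub_left {w w' f : E d → ℂ} (hw : MemLp w 2) (hw' : MemLp w' 2) (hf : MemLp f 2)
    (z : Phase d) : stft (w - w') f z = stft w f z - stft w' f z := by
  rw [stft, stft, stft, ← integral_sub (integrable_stft_integrand (p := 2) (q := 2) hw hf z)
    (integrable_stft_integrand (p := 2) (q := 2) hw' hf z)]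
  congr 1; ext t; simp [tfShift, mul_sub]

/-- The space `L²(ℝᵈ)`. -/
abbrev L2 (d : ℕ) : Type := Lp ℂ 2 (volume : Measure (E d))

/-- The space `L²(ℝ²ᵈ)`. -/
abbrev L2P (d : ℕ) : Type := Lp ℂ 2 (volume : Measure (Phase d))

theorem norm_eq_of_memLp {α : Type*} [MeasurableSpace α] {μ : Measure α} (F : Lp ℂ 2 μ) :
    ENNReal.ofReal ‖F‖ = eLpNorm F 2 μ := by
  rw [Lp.norm_def, ENNReal.ofReal_toReal (Lp.eLpNorm_ne_top F)]

theorem continuous_stft (z : Phase d) : Continuous fun p : L2 d × L2 d => stft p.1 p.2 z := by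
  refine continuous_of_biadditive (fun W F : L2 d => stft W F z) (C := 1) ?_ ?_ ?_
  · intro W W' F
    rw [← stft_sub_left (Lp.memLp W) (Lp.memLp W') (Lp.memLp F)]
    rw [stft_congr_ae (Lp.coeFn_sub W W') (ae_eq_refl _)]
  · intro W F F'
    rw [← stft_sub_right (Lp.memLp W) (Lp.memLp F) (Lp.memLp F')]
    rw [stft_congr_ae (ae_eq_refl _) (Lp.coeFn_sub F F')]
  · intro W F
    have := enorm_stft_le (p := 2) (q := 2) (Lp.aestronglyMeasurable W) (Lp.aestronglyMeasurable F) z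
    rw [← norm_eq_of_memLp, ← norm_eq_of_memLp, ← ENNReal.ofReal_mul (norm_nonneg _),
      ← ofReal_norm, ENNReal.ofReal_le_ofReal_iff (by positivity)] at this
    linarith

/-! ### The functions `rih v f` -/

theorem aestronglyMeasurable_rih {v f : E d → ℂ} (hv : AEStronglyMeasurable v)
    (hf : AEStronglyMeasurable f) : AEStronglyMeasurable (rih v f) := by
  refine AEStronglyMeasurable.mul (Continuous.aestronglyMeasurable (by fun_prop)) ?_
  refine AEStronglyMeasurable.mul ?_ ?_
  · exact Complex.continuous_conj.comp_aestronglyMeasurable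
      (hv.comp_quasiMeasurePreserving quasiMeasurePreserving_fst)
  · exact (hf.comp_measurePreserving (Measure.measurePreserving_neg volume)).comp_quasiMeasurePreserving
      quasiMeasurePreserving_snd

theorem norm_rih (v f : E d → ℂ) (ξ : Phase d) : ‖rih v f ξ‖ = ‖v ξ.fst‖ * ‖f (-ξ.snd)‖ := by
  simp [rih, norm_chi]

theorem enorm_rih (v f : E d → ℂ) (ξ : Phase d) : ‖rih v f ξ‖ₑ = ‖v ξ.fst‖ₑ * ‖f (-ξ.snd)‖ₑ := by
  rw [← ofReal_norm, norm_rih, ENNReal.ofReal_mul (norm_nonneg _), ofReal_norm, ofReal_norm]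

theorem eLpNorm_comp_neg {f : E d → ℂ} (hf : AEStronglyMeasurable f) (p : ℝ≥0∞) :
    eLpNorm (fun t => f (-t)) p = eLpNorm f p :=
  eLpNorm_comp_measurePreserving hf (Measure.measurePreserving_neg volume)

theorem eLpNorm_rih_le {v f : E d → ℂ} (hv : AEStronglyMeasurable v)
    (hf : AEStronglyMeasurable f) (p : ℝ≥0∞) : eLpNorm (rih v f) p ≤ eLpNorm v p * eLpNorm f p := by
  have hf' := hf.comp_measurePreserving (Measure.measurePreserving_neg (volume : Measure (E d)))
  rw [← eLpNorm_comp_neg hf]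
  rcases eq_or_ne p 0 with rfl | hp0
  · simp
  rcases eq_or_ne p ∞ with rfl | hp
  · rw [eLpNorm_exponent_top]
    refine essSup_le_of_ae_le _ ?_
    have h1 := quasiMeasurePreserving_fst.ae (ae_le_eLpNormEssSup (f := v))
    have h2 := quasiMeasurePreserving_snd.ae (ae_le_eLpNormEssSup (f := fun t => f (-t)))
    filter_upwards [h1, h2] with ξ h3 h4
    rw [enorm_rih, eLpNorm_exponent_top, eLpNorm_exponent_top]
    gcongr
  · have hp' := ENNReal.toReal_pos hp0 hp
    rw [eLpNorm_eq_lintegral_rpow_enorm_toReal hp0 hp, eLpNorm_eq_lintegral_rpow_enorm_toReal hp0 hp,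
      eLpNorm_eq_lintegral_rpow_enorm_toReal hp0 hp, ← ENNReal.mul_rpow_of_nonneg _ _ (by positivity),
      lintegral_phase, Measure.volume_eq_prod]
    simp_rw [enorm_rih, ENNReal.mul_rpow_of_nonneg _ _ hp'.le]
    have := lintegral_prod_mul (hv.enorm.pow_const p.toReal) (hf'.enorm.pow_const p.toReal)
    simp only [Function.comp_apply] at this
    rw [← this]
    exact le_rfl

theorem memLp_rih {v f : E d → ℂ} {p : ℝ≥0∞} (hv : MemLp v p) (hf : MemLp f p) :
    MemLp (rih v f) p :=
  ⟨aestronglyMeasurable_rih hv.1 hf.1,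
    (eLpNorm_rih_le hv.1 hf.1 p).trans_lt (ENNReal.mul_lt_top hv.2 hf.2)⟩

theorem rih_congr_ae {v v' f f' : E d → ℂ} (hv : v =ᵐ[volume] v') (hf : f =ᵐ[volume] f') :
    rih v f =ᵐ[volume] rih v' f' := by
  have h1 := quasiMeasurePreserving_fst.ae_eq_comp hv
  have h2 := quasiMeasurePreserving_snd.ae_eq_comp
    ((Measure.measurePreserving_neg (volume : Measure (E d))).quasiMeasurePreserving.ae_eq_comp hf)
  filter_upwards [h1, h2] with ξ h3 h4
  simp only [Function.comp_apply] at h3 h4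
  simp [rih, h3, h4]

/-- `rih` as a map on `L²`. -/
def rihL (V F : L2 d) : L2P d := (memLp_rih (Lp.memLp V) (Lp.memLp F)).toLp

theorem coeFn_rihL (V F : L2 d) : rihL V F =ᵐ[volume] rih V F := MemLp.coeFn_toLp _

theorem continuous_rihL : Continuous fun p : L2 d × L2 d => rihL p.1 p.2 := by
  refine continuous_of_biadditive rihL (C := 1) ?_ ?_ ?_
  · intro V V' F
    apply Lp.ext
    refine (coeFn_rihL _ _).trans ?_
    refine (rih_congr_ae (Lp.coeFn_sub V V') (ae_eq_refl _)).trans ?_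
    filter_upwards [Lp.coeFn_sub (rihL V F) (rihL V' F), coeFn_rihL V F, coeFn_rihL V' F] with ξ h1 h2 h3
    rw [h1, Pi.sub_apply, h2, h3]
    simp [rih]; ring
  · intro V F F'
    apply Lp.ext
    refine (coeFn_rihL _ _).trans ?_
    refine (rih_congr_ae (ae_eq_refl _) (Lp.coeFn_sub F F')).trans ?_
    filter_upwards [Lp.coeFn_sub (rihL V F) (rihL V F'), coeFn_rihL V F, coeFn_rihL V F'] with ξ h1 h2 h3
    rw [h1, Pi.sub_apply, h2, h3]
    simp [rih]; ring
  · intro V F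
    have := eLpNorm_rih_le (Lp.aestronglyMeasurable V) (Lp.aestronglyMeasurable F) 2
    rw [← eLpNorm_congr_ae (coeFn_rihL V F), ← norm_eq_of_memLp, ← norm_eq_of_memLp,
      ← norm_eq_of_memLp, ← ENNReal.ofReal_mul (norm_nonneg _),
      ENNReal.ofReal_le_ofReal_iff (by positivity)] at this
    linarith

theorem exists_seq_schwartz_tendsto {V : Type*} [NormedAddCommGroup V] [InnerProductSpace ℝ V]
    [MeasurableSpace V] [BorelSpace V] [FiniteDimensional ℝ V] (F : Lp ℂ 2 (volume : Measure V)) :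
    ∃ f : ℕ → 𝓢(V, ℂ), Tendsto (fun n => (f n).toLp 2 volume) atTop (𝓝 F) := by
  have hd := SchwartzMap.denseRange_toLpCLM (E := V) (F := ℂ) (p := 2) (μ := volume)
    ENNReal.ofNat_ne_top
  obtain ⟨u, hu, hlim⟩ := mem_closure_iff_seq_limit.1 (hd F)
  choose f hf using hu
  exact ⟨f, by convert hlim using 2 with n; exact hf n⟩

/-- The short-time Fourier transform is the inverse Fourier transform of `rih`. -/
theorem stft_ae_eq (W F : L2 d) : stft W F =ᵐ[volume] (𝓕⁻ (rihL (𝓕 W) F) : L2P d) := by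
  obtain ⟨f, hf⟩ := exists_seq_schwartz_tendsto F
  obtain ⟨v, hv⟩ := exists_seq_schwartz_tendsto (𝓕 W : L2 d)
  have hw : Tendsto (fun n => (𝓕⁻ (v n)).toLp 2 volume) atTop (𝓝 W) := by
    have := ((ContinuousFourierInv.continuous_fourierInv : Continuous (𝓕⁻ : L2 d → L2 d)).tendsto (𝓕 W)).comp hv
    rw [FourierTransform.fourierInv_fourier_eq] at this
    refine this.congr fun n => ?_
    exact SchwartzMap.toLp_fourierInv_eq (v n)
  -- Both sides are limits along Schwartz approximations, the left pointwise and the right in `L²`.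
  -- A subsequence converging almost everywhere identifies them.
  have hpt : ∀ z, Tendsto (fun n => (𝓕⁻ (rihS (v n) (f n)) : 𝓢(Phase d, ℂ)) z) atTop
      (𝓝 (stft W F z)) := by
    intro z
    have := ((continuous_stft z).tendsto (W, F)).comp (hw.prodMk_nhds hf)
    refine this.congr fun n => ?_
    rw [← stft_fourierInv_eq]
    exact congrFun (stft_congr_ae (SchwartzMap.coeFn_toLp _ 2 _) (SchwartzMap.coeFn_toLp _ 2 _)) z
  have hL : Tendsto (fun n => (𝓕⁻ (rihS (v n) (f n))).toLp 2 volume) atTop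
      (𝓝 (𝓕⁻ (rihL (𝓕 W) F) : L2P d)) := by
    have h1 := (continuous_rihL.tendsto ((𝓕 W : L2 d), F)).comp (hv.prodMk_nhds hf)
    have := ((ContinuousFourierInv.continuous_fourierInv : Continuous (𝓕⁻ : L2P d → L2P d)).tendsto _).comp h1
    refine this.congr fun n => ?_
    rw [← SchwartzMap.toLp_fourierInv_eq]
    simp only [Function.comp_apply]
    congr 1
    apply Lp.ext
    refine (coeFn_rihL _ _).trans ((rih_congr_ae (SchwartzMap.coeFn_toLp _ 2 _)
      (SchwartzMap.coeFn_toLp _ 2 _)).trans ?_)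
    filter_upwards [SchwartzMap.coeFn_toLp (rihS (v n) (f n)) 2 volume] with ξ hξ
    rw [hξ, rihS_apply]
  obtain ⟨ns, hmono, hns⟩ := (tendstoInMeasure_of_tendsto_Lp hL).exists_seq_tendsto_ae
  have hae : ∀ᵐ z : Phase d, ∀ n, (𝓕⁻ (rihS (v n) (f n))).toLp 2 volume z =
      (𝓕⁻ (rihS (v n) (f n)) : 𝓢(Phase d, ℂ)) z :=
    ae_all_iff.2 fun n => SchwartzMap.coeFn_toLp _ 2 _
  filter_upwards [hns, hae] with z h1 h2
  simp_rw [h2] at h1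
  refine tendsto_nhds_unique ?_ h1
  exact (hpt z).comp hmono.tendsto_atTop

theorem stft_toLp {w f : E d → ℂ} (hw : MemLp w 2) (hf : MemLp f 2) :
    stft (hw.toLp w) (hf.toLp f) = stft w f :=
  stft_congr_ae hw.coeFn_toLp hf.coeFn_toLp

theorem stft_ae_eq_of_memLp {w f : E d → ℂ} (hw : MemLp w 2) (hf : MemLp f 2) :
    stft w f =ᵐ[volume] (𝓕⁻ (rihL (𝓕 (hw.toLp w)) (hf.toLp f)) : L2P d) := by
  rw [← stft_toLp hw hf]
  exact stft_ae_eq _ _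

theorem memLp_stft {w f : E d → ℂ} (hw : MemLp w 2) (hf : MemLp f 2) : MemLp (stft w f) 2 :=
  (memLp_congr_ae (stft_ae_eq_of_memLp hw hf)).2 (Lp.memLp _)

theorem norm_fourierInv_L2P (R : L2P d) : ‖(𝓕⁻ R : L2P d)‖ = ‖R‖ := by
  rw [← Lp.norm_fourier_eq (𝓕⁻ R : L2P d), FourierTransform.fourier_fourierInv_eq]

theorem inner_fourierInv_L2P (R S : L2P d) :
    inner ℂ (𝓕⁻ R : L2P d) (𝓕⁻ S : L2P d) = inner ℂ R S := by
  rw [← Lp.inner_fourier_eq (𝓕⁻ R : L2P d), FourierTransform.fourier_fourierInv_eq,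
    FourierTransform.fourier_fourierInv_eq]

theorem eLpNorm_stft_le {w f : E d → ℂ} (hw : MemLp w 2) (hf : MemLp f 2) :
    eLpNorm (stft w f) 2 ≤ eLpNorm w 2 * eLpNorm f 2 := by
  rw [eLpNorm_congr_ae (stft_ae_eq_of_memLp hw hf), ← norm_eq_of_memLp, norm_fourierInv_L2P,
    norm_eq_of_memLp, eLpNorm_congr_ae (coeFn_rihL _ _)]
  refine (eLpNorm_rih_le (Lp.aestronglyMeasurable _) (Lp.aestronglyMeasurable _) 2).trans_eq ?_
  rw [← norm_eq_of_memLp, Lp.norm_fourier_eq, norm_eq_of_memLp, eLpNorm_congr_ae hw.coeFn_toLp,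
    eLpNorm_congr_ae hf.coeFn_toLp]

theorem inner_eq_integral {α : Type*} [MeasurableSpace α] {μ : Measure α} {F G : Lp ℂ 2 μ}
    {f g : α → ℂ} (hF : F =ᵐ[μ] f) (hG : G =ᵐ[μ] g) :
    inner ℂ F G = ∫ x, g x * conj (f x) ∂μ := by
  rw [L2.inner_def]
  refine integral_congr_ae ?_
  filter_upwards [hF, hG] with x h1 h2
  rw [h1, h2]
  rfl

/-- Moyal's identity. -/
theorem integral_stft_mul_conj_stft {w w' f f' : E d → ℂ} (hw : MemLp w 2) (hw' : MemLp w' 2)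
    (hf : MemLp f 2) (hf' : MemLp f' 2) :
    ∫ z, stft w f z * conj (stft w' f' z) =
      (∫ t, f t * conj (f' t)) * ∫ t, w' t * conj (w t) := by
  rw [← inner_eq_integral (stft_ae_eq_of_memLp hw' hf').symm (stft_ae_eq_of_memLp hw hf).symm,
    inner_fourierInv_L2P, inner_eq_integral (coeFn_rihL _ _) (coeFn_rihL _ _),
    ← inner_eq_integral hf'.coeFn_toLp hf.coeFn_toLp,
    ← inner_eq_integral hw.coeFn_toLp hw'.coeFn_toLp, ← Lp.inner_fourier_eq (hw.toLp w)]
  set V : L2 d := 𝓕 (hw.toLp w)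
  set V' : L2 d := 𝓕 (hw'.toLp w')
  set F := hf.toLp f
  set F' := hf'.toLp f'
  have hmul : ∀ ξ : Phase d, rih V F ξ * conj (rih V' F' ξ) =
      (V' ξ.fst * conj (V ξ.fst)) * (F (-ξ.snd) * conj (F' (-ξ.snd))) := by
    intro ξ
    simp only [rih, map_mul, Complex.conj_conj]
    -- The chirp has modulus one and cancels, so the phase-space integral factors.
    linear_combination ((V' ξ.fst * conj (V ξ.fst)) * (F (-ξ.snd) * conj (F' (-ξ.snd)))) *
      chi_mul_conj ξ.fst ξ.snd
  simp_rw [hmul]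
  rw [integral_phase, Measure.volume_eq_prod]
  have := integral_prod_mul (μ := (volume : Measure (E d))) (ν := (volume : Measure (E d)))
    (fun x => V' x * conj (V x)) (fun y => F (-y) * conj (F' (-y)))
  simp only [WithLp.toLp_fst, WithLp.toLp_snd]
  rw [this, integral_neg_eq_self (fun y => F y * conj (F' y)),
    inner_eq_integral (ae_eq_refl _) (ae_eq_refl _), inner_eq_integral (ae_eq_refl _) (ae_eq_refl _),
    mul_comm]

end SquareIntegrable

/-! ### Weak approximation of tempered distributions by Schwartz functions. -/

noncomputable section WeakDensity

open Filter Topology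
open scoped LineDeriv

variable {d : ℕ}

/-- A continuous seminorm on Schwartz space is bounded by finitely many Schwartz seminorms. -/
theorem exists_le_schwartzSeminorm {P : Seminorm ℂ 𝓢(E d, ℂ)} (hP : Continuous P) :
    ∃ (s : Finset (ℕ × ℕ)) (C : ℝ), 0 ≤ C ∧
      ∀ h, P h ≤ C * s.sup (schwartzSeminormFamily ℂ (E d) ℂ) h := by
  obtain ⟨s, C, -, h⟩ := Seminorm.bound_of_continuous (schwartz_withSeminorms ℂ (E d) ℂ) P hP
  exact ⟨s, C, C.2, fun f => h f⟩

/-! ### A Sobolev bound -/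

/-- The weight `(1 + |x|²)^N`. -/
def weight (N : ℕ) (x : E d) : ℂ := (((1 + ‖x‖ ^ 2) ^ N : ℝ) : ℂ)

theorem weight_hasTemperateGrowth (N : ℕ) : (weight N : E d → ℂ).HasTemperateGrowth := by
  unfold weight; fun_prop

theorem norm_weight (N : ℕ) (x : E d) : ‖weight N x‖ = (1 + ‖x‖ ^ 2) ^ N := by
  rw [weight, Complex.norm_real, Real.norm_of_nonneg (by positivity)]

theorem memLp_inv_weight : MemLp (fun x : E d => (weight (d + 1) x)⁻¹) 2 := by
  have hm : AEStronglyMeasurable fun x : E d => (weight (d + 1) x)⁻¹ :=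
    (weight_hasTemperateGrowth (d + 1)).1.continuous.measurable.inv.aestronglyMeasurable
  rw [memLp_two_iff_integrable_sq_norm hm]
  have hd : (Module.finrank ℝ (E d) : ℝ) < 4 * (d + 1) := by
    rw [finrank_euclideanSpace_fin]; linarith
  refine (integrable_rpow_neg_one_add_norm_sq (μ := (volume : Measure (E d))) hd).congr ?_
  refine Eventually.of_forall fun x => ?_
  have : (0 : ℝ) ≤ 1 + ‖x‖ ^ 2 := by positivity
  simp only [norm_inv, norm_weight]
  rw [show -(4 * ((d : ℝ) + 1)) / 2 = -((2 * (d + 1) : ℕ) : ℝ) by push_cast; ring,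
    Real.rpow_neg this, Real.rpow_natCast, inv_pow, ← pow_mul, mul_comm 2]

/-- The Fourier transform followed by multiplication with a weight. -/
def sobolevOp (d : ℕ) : 𝓢(E d, ℂ) →L[ℂ] 𝓢(E d, ℂ) :=
  SchwartzMap.smulLeftCLM ℂ (weight (d + 1)) ∘L FourierTransform.fourierCLM ℂ 𝓢(E d, ℂ)

theorem sobolevOp_apply (u : 𝓢(E d, ℂ)) (x : E d) :
    sobolevOp d u x = weight (d + 1) x * 𝓕 u x := by
  simp [sobolevOp, SchwartzMap.smulLeftCLM_apply_apply (weight_hasTemperateGrowth (d + 1))]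

/-- Fourier inversion and Cauchy–Schwarz against the inverse weight, whose square decays like `‖x‖ ^
(-4(d+1))` and is integrable. Schwartz seminorms, which are suprema, can thus be replaced by Hilbert
space norms. -/
theorem exists_norm_le_sobolevOp (d : ℕ) : ∃ C : ℝ, 0 ≤ C ∧ ∀ (u : 𝓢(E d, ℂ)) (x : E d),
    ‖u x‖ ≤ C * ‖(sobolevOp d u).toLp 2 volume‖ := by
  refine ⟨‖(memLp_inv_weight (d := d)).toLp‖, norm_nonneg _, fun u x => ?_⟩
  have h1 : u x = ∫ ξ, cexp (((2 * Real.pi * inner ℝ ξ x : ℝ) : ℂ) * I) * 𝓕 u ξ := by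
    conv_lhs => rw [← FourierTransform.fourierInv_fourier_eq (F := 𝓢(E d, ℂ)) u]
    rw [SchwartzMap.fourierInv_coe, fourierInv_eq_integral_chi]
  have h2 : ‖u x‖ₑ ≤ ∫⁻ ξ, ‖(weight (d + 1) ξ)⁻¹ * sobolevOp d u ξ‖ₑ := by
    rw [h1]
    refine (enorm_integral_le_lintegral_enorm _).trans (lintegral_mono fun ξ => ?_)
    have hw : weight (d + 1) ξ ≠ 0 := by
      rw [← norm_pos_iff, norm_weight]; positivity
    rw [sobolevOp_apply, inv_mul_cancel_left₀ hw, enorm_mul]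
    rw [← ofReal_norm (cexp _), Complex.norm_exp_ofReal_mul_I]
    simp
  have h3 : ∫⁻ ξ, ‖(weight (d + 1) ξ)⁻¹ * sobolevOp d u ξ‖ₑ ≤
      eLpNorm (fun x : E d => (weight (d + 1) x)⁻¹) 2 * eLpNorm (sobolevOp d u) 2 :=
    lintegral_enorm_mul_le memLp_inv_weight.1 ((sobolevOp d u).memLp 2).1
  have h4 := h2.trans h3
  rw [← eLpNorm_congr_ae (memLp_inv_weight (d := d)).coeFn_toLp, ← norm_eq_of_memLp,
    ← eLpNorm_congr_ae (SchwartzMap.coeFn_toLp (sobolevOp d u) 2 volume), ← norm_eq_of_memLp,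
    ← ENNReal.ofReal_mul (norm_nonneg _), ← ofReal_norm,
    ENNReal.ofReal_le_ofReal_iff (by positivity)] at h4
  exact h4

/-! ### Operators with a formal transpose -/

/-- The operator `A` on Schwartz functions has a formal transpose. -/
def HasTranspose (A : 𝓢(E d, ℂ) → 𝓢(E d, ℂ)) : Prop :=
  ∃ B : 𝓢(E d, ℂ) → 𝓢(E d, ℂ), ∀ h k, ∫ x, A h x * k x = ∫ x, h x * B k x

theorem HasTranspose.comp {A A' : 𝓢(E d, ℂ) → 𝓢(E d, ℂ)} (hA : HasTranspose A)
    (hA' : HasTranspose A') : HasTranspose (fun h => A (A' h)) := by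
  obtain ⟨B, hB⟩ := hA
  obtain ⟨B', hB'⟩ := hA'
  exact ⟨fun k => B' (B k), fun h k => by rw [hB, hB']⟩

theorem hasTranspose_fourier : HasTranspose (fun h : 𝓢(E d, ℂ) => 𝓕 h) :=
  ⟨fun k => 𝓕 k, fun h k => SchwartzMap.integral_fourier_mul_eq h k⟩

theorem hasTranspose_smulLeft {a : E d → ℂ} (ha : a.HasTemperateGrowth) :
    HasTranspose (SchwartzMap.smulLeftCLM ℂ a : 𝓢(E d, ℂ) → 𝓢(E d, ℂ)) := by
  refine ⟨SchwartzMap.smulLeftCLM ℂ a, fun h k => ?_⟩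
  congr 1; ext x
  rw [SchwartzMap.smulLeftCLM_apply_apply ha, SchwartzMap.smulLeftCLM_apply_apply ha]
  simp only [smul_eq_mul]; ring

theorem hasTranspose_lineDeriv (m : E d) : HasTranspose (fun h : 𝓢(E d, ℂ) => ∂_{m} h) := by
  refine ⟨fun k => - ∂_{m} k, fun h k => ?_⟩
  have := SchwartzMap.integral_mul_lineDerivOp_right_eq_neg_left (μ := volume) h k m
  simp only [neg_apply, mul_neg]
  rw [integral_neg, this, neg_neg]

theorem hasTranspose_iteratedLineDeriv {n : ℕ} (m : Fin n → E d) :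
    HasTranspose (fun h : 𝓢(E d, ℂ) => ∂^{m} h) := by
  induction n with
  | zero => exact ⟨id, fun h k => by simp⟩
  | succ n ih =>
    simp_rw [LineDeriv.iteratedLineDerivOp_succ_left]
    exact (hasTranspose_lineDeriv _).comp (ih _)

theorem hasTranspose_sobolevOp : HasTranspose (sobolevOp d) :=
  (hasTranspose_smulLeft (weight_hasTemperateGrowth (d + 1))).comp hasTranspose_fourier

/-- The operators whose `L²` norms control a Schwartz seminorm. -/
def ctrlOp (k : ℕ) {n : ℕ} (r : Fin n → Fin d) : 𝓢(E d, ℂ) →L[ℂ] 𝓢(E d, ℂ) :=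
  sobolevOp d ∘L SchwartzMap.smulLeftCLM ℂ (weight k) ∘L
    LineDeriv.iteratedLineDerivOpCLM ℂ 𝓢(E d, ℂ) fun i => EuclideanSpace.single (r i) (1 : ℝ)

theorem hasTranspose_ctrlOp (k : ℕ) {n : ℕ} (r : Fin n → Fin d) : HasTranspose (ctrlOp k r) :=
  hasTranspose_sobolevOp.comp ((hasTranspose_smulLeft (weight_hasTemperateGrowth k)).comp
    (hasTranspose_iteratedLineDeriv _))

theorem norm_multilinear_le {n : ℕ} (f : (E d) [×n]→L[ℝ] ℂ) :
    ‖f‖ ≤ ∑ r : Fin n → Fin d, ‖f fun i => EuclideanSpace.single (r i) (1 : ℝ)‖ := by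
  refine ContinuousMultilinearMap.opNorm_le_bound (by positivity) fun m => ?_
  have hm : m = fun i => ∑ j, m i j • EuclideanSpace.single j (1 : ℝ) := by
    ext i j
    simp [Pi.single_apply, Finset.sum_apply, WithLp.ofLp_sum]
  conv_lhs => rw [hm]
  rw [ContinuousMultilinearMap.map_sum, Finset.sum_mul]
  refine (norm_sum_le _ _).trans (Finset.sum_le_sum fun r _ => ?_)
  rw [ContinuousMultilinearMap.map_smul_univ, norm_smul, mul_comm]
  gcongr
  rw [norm_prod]
  refine Finset.prod_le_prod (fun _ _ => norm_nonneg _) fun i _ => ?_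
  exact PiLp.norm_apply_le (m i) (r i)

/-- The `n`-th derivative is controlled by its values on basis vectors, and `‖x‖ ^ k ≤ (1 + ‖x‖ ^ 2)
^ k` replaces the power by a smooth weight; the Sobolev bound is applied to each resulting Schwartz
function. -/
theorem exists_schwartzSeminorm_le (k n : ℕ) : ∃ C : ℝ, 0 ≤ C ∧ ∀ h : 𝓢(E d, ℂ),
    SchwartzMap.seminorm ℂ k n h ≤
      C * ∑ r : Fin n → Fin d, ‖(ctrlOp k r h).toLp 2 volume‖ := by
  obtain ⟨C, hC, hb⟩ := exists_norm_le_sobolevOp d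
  refine ⟨C, hC, fun h => SchwartzMap.seminorm_le_bound ℂ k n h (by positivity) fun x => ?_⟩
  rw [Finset.mul_sum]
  calc _ ≤ (1 + ‖x‖ ^ 2) ^ k * ∑ r : Fin n → Fin d,
        ‖iteratedFDeriv ℝ n h x fun i => EuclideanSpace.single (r i) (1 : ℝ)‖ := by
        gcongr
        · nlinarith [sq_nonneg (‖x‖ - 1), norm_nonneg x]
        · exact norm_multilinear_le _
    _ ≤ _ := by
        rw [Finset.mul_sum]
        refine Finset.sum_le_sum fun r _ => ?_
        refine le_trans (le_of_eq ?_) (hb (SchwartzMap.smulLeftCLM ℂ (weight k)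
          (∂^{fun i => EuclideanSpace.single (r i) (1 : ℝ)} h)) x)
        rw [SchwartzMap.smulLeftCLM_apply_apply (weight_hasTemperateGrowth k), norm_smul,
          norm_weight, SchwartzMap.iteratedLineDerivOp_eq_iteratedFDeriv]

theorem seminorm_sup_le_sum (s : Finset (ℕ × ℕ)) (h : 𝓢(E d, ℂ)) :
    s.sup (schwartzSeminormFamily ℂ (E d) ℂ) h ≤ ∑ i ∈ s, SchwartzMap.seminorm ℂ i.1 i.2 h := by
  refine (Seminorm.finset_sup_le_sum (schwartzSeminormFamily ℂ (E d) ℂ) s h).trans_eq ?_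
  rw [sum_apply]
  rfl

/-- A tempered distribution is bounded by the `L²` norms of finitely many operators that have
formal transposes. -/
theorem exists_norm_le_sum_ctrl (T : 𝓢'(E d, ℂ)) : ∃ (ι : Type) (_ : Fintype ι)
    (A : ι → 𝓢(E d, ℂ) →L[ℂ] 𝓢(E d, ℂ)) (C : ℝ), 0 ≤ C ∧ (∀ i, HasTranspose (A i)) ∧
      ∀ h, ‖T h‖ ≤ C * ∑ i, ‖(A i h).toLp 2 volume‖ := by
  obtain ⟨s, C, hC, hT⟩ := exists_le_schwartzSeminorm
    (P := (normSeminorm ℂ ℂ).comp (T : 𝓢(E d, ℂ) →L[ℂ] ℂ).toLinearMap)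
    (continuous_norm.comp (map_continuous T))
  choose D hD hDb using exists_schwartzSeminorm_le (d := d)
  refine ⟨Σ i : s, (Fin i.1.2 → Fin d), inferInstance, fun i => ctrlOp i.1.1.1 i.2,
    C * ∑ i ∈ s, D i.1 i.2, mul_nonneg hC (Finset.sum_nonneg fun i _ => hD _ _),
    fun i => hasTranspose_ctrlOp _ _, fun h => ?_⟩
  refine (hT h).trans ?_
  rw [mul_assoc]
  gcongr
  refine (seminorm_sup_le_sum s h).trans ?_
  rw [Finset.sum_mul]
  refine Finset.sum_le_sum fun i hi => (hDb i.1 i.2 h).trans ?_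
  gcongr
  · exact hD _ _
  rw [Fintype.sum_sigma]
  exact Finset.single_le_sum (f := fun j : s => ∑ r : Fin j.1.2 → Fin d,
    ‖(ctrlOp j.1.1 r h).toLp 2 volume‖) (fun j _ => by positivity) (Finset.mem_univ (⟨i, hi⟩ : s))

/-- Representation of a functional that is bounded by a Hilbert space norm. -/
theorem exists_inner_representation {X H : Type*} [AddCommGroup X] [Module ℂ X]
    [NormedAddCommGroup H] [InnerProductSpace ℂ H] [CompleteSpace H] (Φ : X →ₗ[ℂ] H)
    (T : X →ₗ[ℂ] ℂ) {C : ℝ} (hT : ∀ h, ‖T h‖ ≤ C * ‖Φ h‖) : ∃ b : H, ∀ h, T h = inner ℂ b (Φ h) := by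
  have hker : LinearMap.ker Φ ≤ LinearMap.ker T := by
    intro h hh
    rw [LinearMap.mem_ker] at hh ⊢
    have := hT h
    rw [hh, norm_zero, mul_zero] at this
    exact norm_le_zero_iff.1 this
  -- The bound makes `T` factor through the range of `Φ`; Hahn–Banach extends the factor to `H` and
  -- Riesz represents it.
  set l : LinearMap.range Φ →ₗ[ℂ] ℂ :=
    (LinearMap.ker Φ).liftQ T hker ∘ₗ Φ.quotKerEquivRange.symm.toLinearMap with hl
  have hlΦ : ∀ h, l ⟨Φ h, LinearMap.mem_range_self Φ h⟩ = T h := by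
    intro h
    have : Φ.quotKerEquivRange.symm ⟨Φ h, LinearMap.mem_range_self Φ h⟩ =
        (LinearMap.ker Φ).mkQ h := by
      rw [LinearEquiv.symm_apply_eq]; rfl
    simp only [hl, LinearMap.comp_apply, LinearEquiv.coe_coe, this]
    simp
  set L : LinearMap.range Φ →L[ℂ] ℂ := l.mkContinuous C (by
    rintro ⟨_, h, rfl⟩
    rw [hlΦ]
    exact hT h)
  obtain ⟨g, hg, -⟩ := exists_extension_norm_eq (LinearMap.range Φ) L
  refine ⟨(InnerProductSpace.toDual ℂ H).symm g, fun h => ?_⟩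
  rw [InnerProductSpace.toDual_symm_apply, ← hlΦ h]
  exact (hg ⟨Φ h, LinearMap.mem_range_self Φ h⟩).symm

theorem inner_toLp_eq (k h : 𝓢(E d, ℂ)) :
    inner ℂ (k.toLp 2 volume) (h.toLp 2 volume) = ∫ t, h t * conjS k t := by
  rw [inner_eq_integral (SchwartzMap.coeFn_toLp k 2 volume) (SchwartzMap.coeFn_toLp h 2 volume)]
  rfl

/-- A tempered distribution is the weak limit of a sequence of Schwartz functions that is bounded
by a continuous seminorm. -/
theorem exists_seq_schwartz_tendsto_distribution (T : 𝓢'(E d, ℂ)) :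
    ∃ (k : ℕ → 𝓢(E d, ℂ)) (s : Finset (ℕ × ℕ)) (C : ℝ), 0 ≤ C ∧
      (∀ n h, ‖∫ t, h t * k n t‖ ≤ C * s.sup (schwartzSeminormFamily ℂ (E d) ℂ) h) ∧
      ∀ h, Tendsto (fun n => ∫ t, h t * k n t) atTop (𝓝 (T h)) := by
  obtain ⟨ι, _, A, C, hC, hA, hT⟩ := exists_norm_le_sum_ctrl T
  choose B hB using hA
  set Φ : 𝓢(E d, ℂ) →ₗ[ℂ] PiLp 2 (fun _ : ι => L2 d) :=
    { toFun := fun h => WithLp.toLp 2 fun i => (A i h).toLp 2 volume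
      map_add' := fun f g => by
        ext1 i
        exact ((SchwartzMap.toLpCLM ℂ ℂ 2 volume) ∘L A i).map_add f g
      map_smul' := fun c f => by
        ext1 i
        exact ((SchwartzMap.toLpCLM ℂ ℂ 2 volume) ∘L A i).map_smul c f }
  obtain ⟨b, hb⟩ := exists_inner_representation Φ (T : 𝓢(E d, ℂ) →L[ℂ] ℂ).toLinearMap
    (C := C * Fintype.card ι) (fun h => by
      refine (hT h).trans ?_
      rw [mul_assoc]
      gcongr
      calc _ ≤ ∑ _i : ι, ‖Φ h‖ := Finset.sum_le_sum fun i _ => PiLp.norm_apply_le (Φ h) i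
        _ = _ := by simp)
  have hTb : ∀ h, T h = ∑ i, inner ℂ (b i) ((A i h).toLp 2 volume) := by
    intro h
    have := hb h
    rw [PiLp.inner_apply] at this
    exact this
  -- Now `T h = ∑ ⟨b i, A i h⟩` with `b i ∈ L²`. Replacing `b i` by Schwartz functions and moving `A
  -- i` to the other side by its transpose makes each approximating functional integration against a
  -- Schwartz function.
  choose f hf using fun i => exists_seq_schwartz_tendsto (b i)
  have hbd : ∀ i, ∃ M : ℝ, ∀ n, ‖(f i n).toLp 2 volume‖ ≤ M := by
    intro i
    obtain ⟨M, hM⟩ := (hf i).norm.bddAbove_range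
    exact ⟨M, fun n => hM ⟨n, rfl⟩⟩
  choose M hM using hbd
  have hM0 : ∀ i, 0 ≤ M i := fun i => (norm_nonneg _).trans (hM i 0)
  have hk : ∀ n h, ∫ t, h t * (∑ i, B i (conjS (f i n))) t =
      ∑ i, inner ℂ ((f i n).toLp 2 volume) ((A i h).toLp 2 volume) := by
    intro n h
    simp_rw [inner_toLp_eq, hB]
    rw [← integral_finsetSum]
    · congr 1; ext t
      rw [sum_apply, Finset.mul_sum]
    · intro i _
      exact (h.memLp 2).integrable_mul ((B i (conjS (f i n))).memLp 2)
  -- Convergent sequences in `L²` are bounded, so one continuous seminorm dominates all the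
  -- approximants.
  set P : Seminorm ℂ 𝓢(E d, ℂ) := ∑ i, (M i).toNNReal • (normSeminorm ℂ (L2 d)).comp
    ((SchwartzMap.toLpCLM ℂ ℂ 2 volume) ∘L A i).toLinearMap with hP
  have hPa : ∀ h, P h = ∑ i, M i * ‖(A i h).toLp 2 volume‖ := by
    intro h
    rw [hP, sum_apply]
    refine Finset.sum_congr rfl fun i _ => ?_
    change ((M i).toNNReal : ℝ) * _ = _
    rw [Real.coe_toNNReal _ (hM0 i)]
    rfl
  have hPc : Continuous P := by
    have : (P : 𝓢(E d, ℂ) → ℝ) = fun h => ∑ i, M i * ‖(A i h).toLp 2 volume‖ := funext hPa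
    rw [this]
    refine continuous_finsetSum _ fun i _ => continuous_const.mul (continuous_norm.comp ?_)
    exact ((SchwartzMap.toLpCLM ℂ ℂ 2 volume) ∘L A i).continuous
  obtain ⟨s, C', hC', hPs⟩ := exists_le_schwartzSeminorm hPc
  refine ⟨fun n => ∑ i, B i (conjS (f i n)), s, C', hC', fun n h => ?_, fun h => ?_⟩
  · refine le_trans ?_ (hPs h)
    rw [hk, hPa]
    refine (norm_sum_le _ _).trans (Finset.sum_le_sum fun i _ => ?_)
    refine (norm_inner_le_norm _ _).trans ?_
    gcongr
    exact hM i n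
  · simp_rw [hk, hTb]
    exact tendsto_finsetSum _ fun i _ => (hf i).inner tendsto_const_nhds

end WeakDensity

/-! ### Polynomial growth under time-frequency shifts and the reproducing formula. -/

noncomputable section Inversion

open Filter Topology

variable {d : ℕ}

/-! ### Growth of Schwartz seminorms under time-frequency shifts -/

theorem schwartzSeminorm_translate_le (k n : ℕ) (x : E d) (u : 𝓢(E d, ℂ)) :
    SchwartzMap.seminorm ℂ k n (SchwartzMap.compSubConstCLM ℂ x u) ≤ (1 + ‖x‖) ^ k *
      (2 ^ (k - 1) * (SchwartzMap.seminorm ℂ k n u + SchwartzMap.seminorm ℂ 0 n u)) := by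
  refine SchwartzMap.seminorm_le_bound ℂ k n _ (by positivity) fun y => ?_
  have h0 : (SchwartzMap.compSubConstCLM ℂ x u : E d → ℂ) = fun y => u (y - x) := by
    ext y; simp
  rw [h0, iteratedFDeriv_comp_sub]
  have h1 := SchwartzMap.le_seminorm ℂ k n u (y - x)
  have h2 := SchwartzMap.le_seminorm ℂ 0 n u (y - x)
  rw [pow_zero, one_mul] at h2
  have h3 : ‖y‖ ^ k ≤ 2 ^ (k - 1) * (‖y - x‖ ^ k + ‖x‖ ^ k) := by
    refine (pow_le_pow_left₀ (norm_nonneg _) ?_ k).trans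
      (add_pow_le (norm_nonneg _) (norm_nonneg _) k)
    simpa using norm_add_le (y - x) x
  have h4 : ‖x‖ ^ k ≤ (1 + ‖x‖) ^ k := pow_le_pow_left₀ (norm_nonneg _) (by linarith) k
  have h5 : (1 : ℝ) ≤ (1 + ‖x‖) ^ k := one_le_pow₀ (by linarith [norm_nonneg x])
  set a := ‖iteratedFDeriv ℝ n u (y - x)‖
  have ha : 0 ≤ a := norm_nonneg _
  calc _ ≤ 2 ^ (k - 1) * (‖y - x‖ ^ k + ‖x‖ ^ k) * a := by gcongr
    _ = 2 ^ (k - 1) * (‖y - x‖ ^ k * a + ‖x‖ ^ k * a) := by ring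
    _ ≤ 2 ^ (k - 1) * ((1 + ‖x‖) ^ k * SchwartzMap.seminorm ℂ k n u +
        (1 + ‖x‖) ^ k * SchwartzMap.seminorm ℂ 0 n u) := by
        refine mul_le_mul_of_nonneg_left (add_le_add ?_ ?_) (by positivity)
        · exact h1.trans (le_mul_of_one_le_left (apply_nonneg _ _) h5)
        · exact mul_le_mul h4 h2 ha (by positivity)
    _ = _ := by ring

theorem continuous_schwartzSeminorm (k n : ℕ) :
    Continuous (SchwartzMap.seminorm ℂ k n : Seminorm ℂ 𝓢(E d, ℂ)) :=
  (schwartz_withSeminorms ℂ (E d) ℂ).continuous_seminorm (k, n)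

theorem exists_translate_le {P : Seminorm ℂ 𝓢(E d, ℂ)} (hP : Continuous P) :
    ∃ (K : ℕ) (Q : Seminorm ℂ 𝓢(E d, ℂ)), Continuous Q ∧ ∀ x u,
      P (SchwartzMap.compSubConstCLM ℂ x u) ≤ (1 + ‖x‖) ^ K * Q u := by
  obtain ⟨s, C, hC, hs⟩ := exists_le_schwartzSeminorm hP
  set Q : Seminorm ℂ 𝓢(E d, ℂ) := ∑ i ∈ s, (C * 2 ^ (i.1 - 1)).toNNReal •
    (SchwartzMap.seminorm ℂ i.1 i.2 + SchwartzMap.seminorm ℂ 0 i.2) with hQ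
  have hQa : ∀ u, Q u = ∑ i ∈ s, C * 2 ^ (i.1 - 1) *
      (SchwartzMap.seminorm ℂ i.1 i.2 u + SchwartzMap.seminorm ℂ 0 i.2 u) := by
    intro u
    rw [hQ, sum_apply]
    refine Finset.sum_congr rfl fun i _ => ?_
    change ((C * 2 ^ (i.1 - 1)).toNNReal : ℝ) * _ = _
    rw [Real.coe_toNNReal _ (by positivity)]
    rfl
  -- Since `1 + ‖x‖ ≥ 1`, the sum of the orders is an exponent that serves every seminorm in `s`.
  refine ⟨∑ i ∈ s, i.1, Q, ?_, fun x u => ?_⟩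
  · rw [show (Q : 𝓢(E d, ℂ) → ℝ) = _ from funext hQa]
    refine continuous_finsetSum _ fun i _ => continuous_const.mul ?_
    exact (continuous_schwartzSeminorm _ _).add (continuous_schwartzSeminorm _ _)
  · refine (hs _).trans ?_
    rw [hQa, Finset.mul_sum]
    refine (mul_le_mul_of_nonneg_left (seminorm_sup_le_sum s _) hC).trans ?_
    rw [Finset.mul_sum]
    refine Finset.sum_le_sum fun i hi => ?_
    refine (mul_le_mul_of_nonneg_left (schwartzSeminorm_translate_le i.1 i.2 x u) hC).trans ?_
    have h1 : (1 + ‖x‖) ^ i.1 ≤ (1 + ‖x‖) ^ (∑ i ∈ s, i.1) :=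
      pow_le_pow_right₀ (by linarith [norm_nonneg x])
        (Finset.single_le_sum (f := fun i : ℕ × ℕ => i.1) (fun _ _ => Nat.zero_le _) hi)
    calc _ = (1 + ‖x‖) ^ i.1 * (C * 2 ^ (i.1 - 1) *
          (SchwartzMap.seminorm ℂ i.1 i.2 u + SchwartzMap.seminorm ℂ 0 i.2 u)) := by ring
      _ ≤ _ := by gcongr

/-- Modulation of a Schwartz function. -/
abbrev modulate (ω : E d) : 𝓢(E d, ℂ) →L[ℂ] 𝓢(E d, ℂ) := SchwartzMap.smulLeftCLM ℂ (chi ω)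

theorem modulate_apply (ω : E d) (u : 𝓢(E d, ℂ)) (t : E d) : modulate ω u t = chi ω t * u t := by
  rw [SchwartzMap.smulLeftCLM_apply_apply (chi_hasTemperateGrowth ω), smul_eq_mul]

theorem fourier_eq_integral_chi (f : E d → ℂ) (ξ : E d) :
    𝓕 f ξ = ∫ t, chi (-ξ) t * f t := by
  rw [Real.fourier_eq']
  congr 1; ext t
  rw [smul_eq_mul, chi, inner_neg_left, real_inner_comm]
  congr 3; ring_nf

theorem fourier_modulate (ω : E d) (u : 𝓢(E d, ℂ)) :
    𝓕 (modulate ω u) = SchwartzMap.compSubConstCLM ℂ ω (𝓕 u) := by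
  ext ξ
  rw [SchwartzMap.compSubConstCLM_apply, SchwartzMap.fourier_coe, SchwartzMap.fourier_coe,
    fourier_eq_integral_chi, fourier_eq_integral_chi]
  congr 1; ext t
  rw [modulate_apply, ← mul_assoc, ← chi_add_left]
  congr 2; abel

/-- On the Fourier side modulation is translation, so the translation bound is conjugated with the
Fourier transform. -/
theorem exists_modulate_le {P : Seminorm ℂ 𝓢(E d, ℂ)} (hP : Continuous P) :
    ∃ (K : ℕ) (Q : Seminorm ℂ 𝓢(E d, ℂ)), Continuous Q ∧ ∀ ω u,
      P (modulate ω u) ≤ (1 + ‖ω‖) ^ K * Q u := by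
  set Fi : 𝓢(E d, ℂ) →L[ℂ] 𝓢(E d, ℂ) := FourierTransform.fourierInvCLM ℂ 𝓢(E d, ℂ)
  set F : 𝓢(E d, ℂ) →L[ℂ] 𝓢(E d, ℂ) := FourierTransform.fourierCLM ℂ 𝓢(E d, ℂ)
  obtain ⟨K, Q, hQ, h⟩ := exists_translate_le (P := P.comp Fi.toLinearMap)
    (hP.comp Fi.continuous)
  refine ⟨K, Q.comp F.toLinearMap, hQ.comp F.continuous, fun ω u => ?_⟩
  have h1 := h ω (𝓕 u)
  rw [← fourier_modulate] at h1
  change P (𝓕⁻ (𝓕 (modulate ω u))) ≤ _ at h1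
  rw [FourierTransform.fourierInv_fourier_eq] at h1
  exact h1

/-- The conjugate of a time-frequency shift of a Schwartz function. -/
theorem conjS_tfShiftS (z : Phase d) (g : 𝓢(E d, ℂ)) : conjS (tfShiftS z g) =
    modulate (-z.snd) (SchwartzMap.compSubConstCLM ℂ z.fst (conjS g)) := by
  ext t
  rw [conjS_apply, tfShiftS_apply, modulate_apply, tfShift, map_mul, conj_chi]
  simp

/-- Supplies the polynomial majorant, uniform along the approximating sequence, in the dominated
convergence argument for the reproducing formula. -/
theorem exists_seminorm_tfShift_le {P : Seminorm ℂ 𝓢(E d, ℂ)} (hP : Continuous P) :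
    ∃ (K : ℕ) (Q : Seminorm ℂ 𝓢(E d, ℂ)), Continuous Q ∧ ∀ z g,
      P (conjS (tfShiftS z g)) ≤ (1 + ‖z‖) ^ K * Q (conjS g) := by
  obtain ⟨K₁, Q₁, hQ₁, h₁⟩ := exists_modulate_le hP
  obtain ⟨K₂, Q₂, hQ₂, h₂⟩ := exists_translate_le hQ₁
  refine ⟨K₁ + K₂, Q₂, hQ₂, fun z g => ?_⟩
  rw [conjS_tfShiftS]
  refine (h₁ _ _).trans ?_
  refine (mul_le_mul_of_nonneg_left (h₂ _ _) (by positivity)).trans ?_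
  rw [norm_neg, pow_add, mul_assoc]
  gcongr
  · exact norm_snd_le z
  · exact norm_fst_le z

/-! ### The short-time Fourier transform of Schwartz functions and distributions -/

/-- The short-time Fourier transform of a Schwartz function is a Schwartz function. -/
def stftS (g f : 𝓢(E d, ℂ)) : 𝓢(Phase d, ℂ) := 𝓕⁻ (rihS (𝓕 g) f)

theorem stftS_apply (g f : 𝓢(E d, ℂ)) (z : Phase d) : stftS g f z = stft g f z := by
  rw [stftS, ← stft_fourierInv_eq, FourierTransform.fourierInv_fourier_eq]

theorem stft_eq_integral (g k : 𝓢(E d, ℂ)) (z : Phase d) :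
    stft g k z = ∫ t, conjS (tfShiftS z g) t * k t := by
  rw [stft]
  congr 1; ext t
  rw [conjS_apply, tfShiftS_apply, mul_comm]

/-- The reproducing formula for tempered distributions. -/
theorem stftD_spec (g : 𝓢(E d, ℂ)) (T : 𝓢'(E d, ℂ)) :
    AEStronglyMeasurable (stftD g T) ∧ ∀ h : 𝓢(E d, ℂ),
      ∫ z, stftD g T z * conj (stft g (conjS h) z) = T h * ∫ t, g t * conj (g t) := by
  obtain ⟨k, s, C, hC, hk, hlim⟩ := exists_seq_schwartz_tendsto_distribution T
  have hpt : ∀ z, Tendsto (fun n => stftS g (k n) z) atTop (𝓝 (stftD g T z)) := by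
    intro z
    refine (hlim (conjS (tfShiftS z g))).congr fun n => ?_
    rw [stftS_apply, stft_eq_integral]
  have hPc : Continuous (s.sup (schwartzSeminormFamily ℂ (E d) ℂ) : Seminorm ℂ 𝓢(E d, ℂ)) := by
    have := Seminorm.continuous_of_le (p := s.sup (schwartzSeminormFamily ℂ (E d) ℂ))
      (q := ∑ i ∈ s, schwartzSeminormFamily ℂ (E d) ℂ i) ?_ (Seminorm.finset_sup_le_sum _ _)
    · exact this
    · have h1 : ((∑ i ∈ s, schwartzSeminormFamily ℂ (E d) ℂ i : Seminorm ℂ 𝓢(E d, ℂ)) :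
          𝓢(E d, ℂ) → ℝ) = fun h => ∑ i ∈ s, schwartzSeminormFamily ℂ (E d) ℂ i h := by
        ext h; rw [sum_apply]
      rw [h1]
      exact continuous_finsetSum _ fun i _ =>
        (schwartz_withSeminorms ℂ (E d) ℂ).continuous_seminorm i
  obtain ⟨K, Q, -, hQ⟩ := exists_seminorm_tfShift_le hPc
  have hb : ∀ n z, ‖stftS g (k n) z‖ ≤ C * ((1 + ‖z‖) ^ K * Q (conjS g)) := by
    intro n z
    rw [stftS_apply, stft_eq_integral]
    exact (hk n _).trans (mul_le_mul_of_nonneg_left (hQ z g) hC)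
  refine ⟨aestronglyMeasurable_of_tendsto_ae atTop
    (fun n => (stftS g (k n)).continuous.aestronglyMeasurable) (Eventually.of_forall hpt),
    fun h => ?_⟩
  -- Moyal's identity is the reproducing formula for the approximants. In the limit, the polynomial
  -- growth of `V_g (k n)` is absorbed by the Schwartz function `V_g (conjS h)`. The conjugate of
  -- `h` appears because `T` is linear, not conjugate-linear, in its argument.
  have hmoyal : ∀ n, ∫ z, stftS g (k n) z * conj (stftS g (conjS h) z) =
      (∫ t, h t * k n t) * ∫ t, g t * conj (g t) := by
    intro n
    simp_rw [stftS_apply]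
    rw [integral_stft_mul_conj_stft (g.memLp 2) (g.memLp 2) ((k n).memLp 2) ((conjS h).memLp 2)]
    congr 2; ext t
    rw [conjS_apply, Complex.conj_conj, mul_comm]
  have hdct : Tendsto (fun n => ∫ z, stftS g (k n) z * conj (stftS g (conjS h) z)) atTop
      (𝓝 (∫ z, stftD g T z * conj (stftS g (conjS h) z))) := by
    refine tendsto_integral_of_dominated_convergence
      (fun z => C * ((1 + ‖z‖) ^ K * Q (conjS g)) * ‖stftS g (conjS h) z‖) ?_ ?_ ?_ ?_
    · intro n
      exact ((stftS g (k n)).continuous.mul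
        (Complex.continuous_conj.comp (stftS g (conjS h)).continuous)).aestronglyMeasurable
    · have h0 : Integrable fun z : Phase d => (1 + ‖z‖) ^ K * ‖stftS g (conjS h) z‖ := by
        have h1 := ((stftS g (conjS h)).integrable (μ := volume)).norm
        have h2 := (stftS g (conjS h)).integrable_pow_mul volume K
        refine ((h1.add h2).const_mul (2 ^ (K - 1))).mono' (by fun_prop)
          (Eventually.of_forall fun z => ?_)
        rw [Real.norm_of_nonneg (by positivity)]
        have := add_pow_le (zero_le_one (α := ℝ)) (norm_nonneg z) K
        rw [one_pow] at this
        calc _ ≤ (2 ^ (K - 1) * (1 + ‖z‖ ^ K)) * ‖stftS g (conjS h) z‖ := by gcongr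
          _ = _ := by simp only [Pi.add_apply]; ring
      refine (h0.const_mul (C * Q (conjS g))).congr (Eventually.of_forall fun z => ?_)
      simp only; ring
    · intro n
      refine Eventually.of_forall fun z => ?_
      rw [norm_mul, RCLike.norm_conj]
      gcongr
      exact hb n z
    · exact Eventually.of_forall fun z => (hpt z).mul tendsto_const_nhds
  simp_rw [hmoyal] at hdct
  have := tendsto_nhds_unique hdct ((hlim h).mul_const _)
  simp_rw [stftS_apply] at this
  exact this

end Inversion

/-! ### Existence and uniqueness of functions representing tempered distributions. -/

noncomputable section Representation

open Filter Topology

/-! ### Functions representing tempered distributions -/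

section General

variable {V : Type*} [NormedAddCommGroup V] [InnerProductSpace ℝ V]

theorem Represents.congr_ae [MeasureSpace V] {G G' : V → ℂ} {T : 𝓢'(V, ℂ)}
    (h : Represents G T) (hG : G =ᵐ[volume] G') : Represents G' T := by
  intro k
  have e : (fun x => G x * k x) =ᵐ[volume] fun x => G' x * k x := by
    filter_upwards [hG] with x hx
    rw [hx]
  exact ⟨(h k).1.congr e, (h k).2.trans (integral_congr_ae e)⟩

theorem Represents.eq [MeasureSpace V] {G : V → ℂ} {T T' : 𝓢'(V, ℂ)} (h : Represents G T)
    (h' : Represents G T') : T = T' := by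
  ext k
  rw [(h k).2, (h' k).2]

theorem exists_represents [MeasureSpace V] [BorelSpace V] [(volume : Measure V).HasTemperateGrowth]
    {G : V → ℂ} {p : ℝ≥0∞} (hp : 1 ≤ p) (hG : MemLp G p) : ∃ T : 𝓢'(V, ℂ), Represents G T := by
  have : Fact (1 ≤ p) := ⟨hp⟩
  have := ENNReal.HolderConjugate.inv_one_sub_inv' hp
  refine ⟨Lp.toTemperedDistribution (hG.toLp G), fun h =>
    ⟨hG.integrable_mul (h.memLp (1 - p⁻¹)⁻¹), ?_⟩⟩
  rw [Lp.toTemperedDistribution_apply]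
  refine integral_congr_ae ?_
  filter_upwards [hG.coeFn_toLp] with x hx
  rw [hx, smul_eq_mul, mul_comm]

theorem represents_toTemperedDistribution [MeasureSpace V] [BorelSpace V]
    [(volume : Measure V).HasTemperateGrowth] (F : Lp ℂ 2 (volume : Measure V)) :
    Represents F (Lp.toTemperedDistribution F) := by
  intro h
  refine ⟨(Lp.memLp F).integrable_mul (h.memLp 2), ?_⟩
  rw [Lp.toTemperedDistribution_apply]
  simp_rw [smul_eq_mul, mul_comm]

variable [FiniteDimensional ℝ V]

theorem Represents.locallyIntegrable [MeasureSpace V] [BorelSpace V] {G : V → ℂ} {T : 𝓢'(V, ℂ)}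
    (h : Represents G T) : LocallyIntegrable G := by
  intro x
  let b : ContDiffBump x := default
  have h1 : HasCompactSupport fun y => ((b y : ℝ) : ℂ) :=
    b.hasCompactSupport.comp_left (g := fun r : ℝ => (r : ℂ)) (by simp)
  have h2 : ContDiff ℝ (⊤ : ℕ∞) fun y => ((b y : ℝ) : ℂ) :=
    Complex.ofRealCLM.contDiff.comp b.contDiff
  refine ⟨Metric.closedBall x b.rIn, Metric.closedBall_mem_nhds x b.rIn_pos, ?_⟩
  refine ((h (h1.toSchwartzMap h2)).1.integrableOn
    (s := Metric.closedBall x b.rIn)).congr_fun_ae ?_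
  refine (ae_restrict_iff' Metric.isClosed_closedBall.measurableSet).2 (Eventually.of_forall ?_)
  intro y hy
  have : b y = 1 := b.one_of_mem_closedBall hy
  simp [this]

theorem Represents.ae_eq [MeasureSpace V] [BorelSpace V] {G G' : V → ℂ} {T : 𝓢'(V, ℂ)}
    (h : Represents G T) (h' : Represents G' T) : G =ᵐ[volume] G' := by
  have := ae_eq_zero_of_integral_contDiff_smul_eq_zero (f := fun x => G x - G' x)
    (h.locallyIntegrable.sub h'.locallyIntegrable) fun b hb hbs => ?_
  · filter_upwards [this] with x hx using sub_eq_zero.1 hx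
  · have h1 : HasCompactSupport fun y => ((b y : ℝ) : ℂ) :=
      hbs.comp_left (g := fun r : ℝ => (r : ℂ)) (by simp)
    have h2 : ContDiff ℝ (⊤ : ℕ∞) fun y => ((b y : ℝ) : ℂ) := Complex.ofRealCLM.contDiff.comp hb
    have e : ∀ x, b x • (G x - G' x) = G x * h1.toSchwartzMap h2 x - G' x * h1.toSchwartzMap h2 x := by
      intro x
      simp [Complex.real_smul]; ring
    simp_rw [e]
    rw [integral_sub (h _).1 (h' _).1, ← (h _).2, ← (h' _).2, sub_self]

end General

end Representation

/-! ### Modulation spaces and their relation to Lebesgue spaces. -/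

noncomputable section Modulation

open Filter Topology

variable {d : ℕ}

/-! ### The short-time Fourier transform on Lebesgue spaces -/

theorem norm_stft_tfShift (w f : E d → ℂ) (z z' : Phase d) :
    ‖stft w (tfShift z' f) z‖ = ‖stft w f (z - z')‖ := by
  have h1 : stft w (tfShift z' f) z = chi (z'.snd - z.snd) z'.fst * stft w f (z - z') := by
    rw [stft, stft, ← integral_const_mul, ← integral_add_right_eq_self _ z'.fst]
    congr 1; ext t
    simp only [tfShift, map_mul, conj_chi, WithLp.sub_fst, WithLp.sub_snd, add_sub_cancel_right]
    have e : chi z'.snd (t + z'.fst) * chi (-z.snd) (t + z'.fst) =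
        chi (z'.snd - z.snd) z'.fst * chi (-(z.snd - z'.snd)) t := by
      rw [← chi_add_left, chi_add_right, mul_comm, neg_sub, sub_eq_add_neg]
    have e2 : t + z'.fst - z.fst = t - (z.fst - z'.fst) := by abel
    rw [e2]
    linear_combination (f t * conj (w (t - (z.fst - z'.fst)))) * e
  rw [h1, norm_mul, norm_chi, one_mul]

theorem stft_swap (w f : E d → ℂ) (z : Phase d) : ‖stft w f z‖ = ‖stft f w (-z)‖ := by
  have h1 : stft w f z = conj (stft f (tfShift z w) 0) := by
    rw [stft, stft, ← integral_conj]
    congr 1; ext t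
    simp [tfShift, chi, mul_comm]
  rw [h1, RCLike.norm_conj, norm_stft_tfShift, zero_sub]

theorem aestronglyMeasurable_stft (g : 𝓢(E d, ℂ)) {F : E d → ℂ} (hF : AEStronglyMeasurable F) :
    AEStronglyMeasurable (stft g F) := by
  rw [stft_congr_ae (ae_eq_refl _) hF.ae_eq_mk]
  have h1 : StronglyMeasurable fun p : Phase d × E d =>
      hF.mk F p.2 * conj (tfShift p.1 g p.2) := by
    refine (hF.stronglyMeasurable_mk.comp_measurable _root_.measurable_snd).mul ?_
    refine Continuous.stronglyMeasurable ?_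
    unfold tfShift
    have hs := (continuous_snd' (d := d)).comp (continuous_fst (X := Phase d) (Y := E d))
    have hf := (continuous_fst' (d := d)).comp (continuous_fst (X := Phase d) (Y := E d))
    refine Complex.continuous_conj.comp (Continuous.mul (Continuous.chi hs continuous_snd) ?_)
    exact g.continuous.comp (continuous_snd.sub hf)
  exact h1.integral_prod_right'.aestronglyMeasurable

/-- The `L¹` endpoint is Hölder with the bounded window, the `L²` endpoint is Moyal's identity in
norm form. -/
theorem boundedOneTwo_stft (g : 𝓢(E d, ℂ)) :
    BoundedOneTwo (stft g) (volume : Measure (E d)) (volume : Measure (Phase d))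
      (eLpNorm g ∞).toNNReal (eLpNorm g 2).toNNReal where
  congr F G h := stft_congr_ae (ae_eq_refl _) h
  smul c F z := by
    rw [stft, stft, ← integral_const_mul]
    congr 1; ext t; simp [mul_assoc]
  add F G hF hG z := by
    rw [stft, stft, stft, ← integral_add (integrable_stft_integrand (p := 1) (q := ∞)
      (g.memLp ∞) hF z) (integrable_stft_integrand (p := 2) (q := 2) (g.memLp 2) hG z)]
    congr 1; ext t; simp [add_mul]
  meas F hF := aestronglyMeasurable_stft g hF
  one F hF z := by
    rw [ENNReal.coe_toNNReal (g.memLp ∞ volume).2.ne, mul_comm]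
    exact enorm_stft_le g.continuous.aestronglyMeasurable hF.1 z
  two F hF := by
    rw [ENNReal.coe_toNNReal (g.memLp 2 volume).2.ne]
    exact eLpNorm_stft_le (g.memLp 2) hF

theorem exists_eLpNorm_stft_le (g : 𝓢(E d, ℂ)) {q q' : ℝ≥0∞} (hq : 1 ≤ q) (hq2 : q ≤ 2)
    (hqq : q⁻¹ + q'⁻¹ = 1) :
    ∃ C : ℝ≥0, ∀ F : E d → ℂ, MemLp F q → eLpNorm (stft g F) q' ≤ C * eLpNorm F q :=
  (boundedOneTwo_stft g).exists_eLpNorm_le hq hq2 hqq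

theorem integral_mul_conj_eq (g : 𝓢(E d, ℂ)) :
    ∫ t, g t * conj (g t) = ((∫ t, ‖g t‖ ^ 2 : ℝ) : ℂ) := by
  rw [← integral_complex_ofReal]
  congr 1; ext t
  rw [Complex.mul_conj, Complex.normSq_eq_norm_sq]

theorem integral_mul_conj_ne_zero {g : 𝓢(E d, ℂ)} (hg : g ≠ 0) : ∫ t, g t * conj (g t) ≠ 0 := by
  rw [integral_mul_conj_eq, Complex.ofReal_ne_zero]
  intro h
  have hc : Continuous fun t => ‖g t‖ ^ 2 := g.continuous.norm.pow 2
  have h2 : Integrable fun t => ‖g t‖ ^ 2 := (g.memLp 2).integrable_norm_pow two_ne_zero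
  rw [integral_eq_zero_iff_of_nonneg (fun t => by positivity) h2] at h
  replace h := (Continuous.ae_eq_iff_eq volume hc continuous_zero).1 h
  refine hg (SchwartzMap.ext fun t => ?_)
  simpa using congrFun h t

/-! ### Modulation spaces between `M¹` and `M²` -/

theorem Represents.stftD_eq {f : E d → ℂ} {T : 𝓢'(E d, ℂ)} (h : Represents f T)
    (g : 𝓢(E d, ℂ)) : stftD g T = stft g f := by
  ext z
  rw [stftD, (h _).2, stft]
  congr 1; ext t
  rw [conjS_apply, tfShiftS_apply]

theorem memLp_of_memLp_top {α : Type*} [MeasurableSpace α] {μ : Measure α} {f : α → ℂ}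
    {p q : ℝ≥0∞} (hf : MemLp f p μ) (hf' : MemLp f ∞ μ) (hp : 1 ≤ p) (hpq : p ≤ q) :
    MemLp f q μ := by
  rcases eq_or_ne q ∞ with rfl | hq
  · exact hf'
  have hp0 : p ≠ 0 := (zero_lt_one.trans_le hp).ne'
  have hpt : p ≠ ∞ := (hpq.trans_lt hq.lt_top).ne
  have hq0 : q ≠ 0 := (zero_lt_one.trans_le (hp.trans hpq)).ne'
  have hpq' : p.toReal ≤ q.toReal := ENNReal.toReal_mono hq hpq
  have h1 := (eLpNorm_lt_top_iff_lintegral_rpow_enorm_lt_top hp0 hpt).1 hf.2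
  refine ⟨hf.1, (eLpNorm_lt_top_iff_lintegral_rpow_enorm_lt_top hq0 hq).2 ?_⟩
  refine (lintegral_mono_ae (g := fun x => eLpNorm f ∞ μ ^ (q.toReal - p.toReal) *
    ‖f x‖ₑ ^ p.toReal) ?_).trans_lt ?_
  · filter_upwards [ae_le_eLpNormEssSup (f := f) (μ := μ)] with x hx
    calc ‖f x‖ₑ ^ q.toReal = ‖f x‖ₑ ^ (q.toReal - p.toReal) * ‖f x‖ₑ ^ p.toReal := by
          rw [← ENNReal.rpow_add_of_nonneg _ _ (sub_nonneg.2 hpq') ENNReal.toReal_nonneg,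
            sub_add_cancel]
      _ ≤ _ := by
          rw [eLpNorm_exponent_top]
          gcongr
  · rw [lintegral_const_mul' _ _ (ENNReal.rpow_lt_top_of_nonneg (sub_nonneg.2 hpq')
      hf'.2.ne).ne]
    exact ENNReal.mul_lt_top (ENNReal.rpow_lt_top_of_nonneg (sub_nonneg.2 hpq') hf'.2.ne) h1

/-- Take `conj (π(z) g)` as the test function in the reproducing formula and apply Hölder. In
modulus `V_g (π(z) g)` is a translate of `V_g g`, so the bound does not depend on `z`. -/
theorem memLp_stftD_top {g : 𝓢(E d, ℂ)} (hg : g ≠ 0) {q q' : ℝ≥0∞} [q.HolderConjugate q']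
    {T : 𝓢'(E d, ℂ)} (hT : MemMod g q T) : MemLp (stftD g T) ∞ := by
  obtain ⟨hm, hspec⟩ := stftD_spec g T
  have hg0 := integral_mul_conj_ne_zero hg
  generalize ∫ t, g t * conj (g t) = c at hspec hg0
  have hS : eLpNorm (stftS g g) q' < ∞ := ((stftS g g).memLp q' volume).2
  have hK : modNorm g q T * eLpNorm (stftS g g) q' < ∞ := ENNReal.mul_lt_top hT hS
  have hb : ∀ z, ‖stftD g T z‖ₑ ≤ modNorm g q T * eLpNorm (stftS g g) q' / ‖c‖ₑ := by
    intro z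
    have hA : ∀ z', stft g (conjS (conjS (tfShiftS z g))) z' = stftS g (tfShiftS z g) z' := by
      intro z'
      have : conjS (conjS (tfShiftS z g)) = tfShiftS z g := by
        ext t; rw [conjS_apply, conjS_apply, Complex.conj_conj]
      rw [stftS_apply, this]
    have hs := hspec (conjS (tfShiftS z g))
    simp_rw [hA] at hs
    rw [ENNReal.le_div_iff_mul_le (Or.inl (enorm_ne_zero.2 hg0)) (Or.inl enorm_ne_top), stftD,
      ← enorm_mul, ← hs]
    have hm2 : AEStronglyMeasurable fun z' => conj (stftS g (tfShiftS z g) z') :=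
      (Complex.continuous_conj.comp (stftS g (tfShiftS z g)).continuous).aestronglyMeasurable
    refine (enorm_integral_mul_le (p := q) (q := q') hm hm2).trans ?_
    rw [eLpNorm_conj]
    refine mul_le_mul_right (le_of_eq ?_) _
    rw [← eLpNorm_comp_measurePreserving (g := stftS g g) (f := fun z' => z' - z)
      (stftS g g).continuous.aestronglyMeasurable (measurePreserving_sub_right volume z)]
    refine eLpNorm_congr_norm_ae (Eventually.of_forall fun z' => ?_)
    simp only [Function.comp_apply]
    rw [stftS_apply, stftS_apply, ← norm_stft_tfShift]
    congr 2; ext t; rw [tfShiftS_apply]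
  exact ⟨hm, (eLpNormEssSup_le_of_ae_enorm_bound (Eventually.of_forall hb)).trans_lt
    (ENNReal.div_lt_top hK.ne (enorm_ne_zero.2 hg0))⟩

/-- `V_g T` is in `L^q ∩ L^∞`, hence in `L²`. The reproducing formula and Cauchy–Schwarz then bound
`T` by the `L²` norm of the test function, and Riesz produces the representing function. -/
theorem exists_represents_of_memMod {g : 𝓢(E d, ℂ)} (hg : g ≠ 0) {q q' : ℝ≥0∞} (hq : 1 ≤ q)
    (hq2 : q ≤ 2) [q.HolderConjugate q'] {T : 𝓢'(E d, ℂ)} (hT : MemMod g q T) :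
    ∃ f : E d → ℂ, MemLp f 2 ∧ Represents f T := by
  have hD : MemLp (stftD g T) 2 :=
    memLp_of_memLp_top ⟨(stftD_spec g T).1, hT⟩ (memLp_stftD_top hg (q' := q') hT) hq hq2
  obtain ⟨-, hspec⟩ := stftD_spec g T
  have hg0 := integral_mul_conj_ne_zero hg
  generalize ∫ t, g t * conj (g t) = c at hspec hg0
  have hD' : eLpNorm (stftD g T) 2 ≠ ∞ := hD.2.ne
  have hgn : eLpNorm g 2 ≠ ∞ := (g.memLp 2 volume).2.ne
  have hb : ∀ h : 𝓢(E d, ℂ), ‖T h‖ ≤ ((eLpNorm (stftD g T) 2).toReal * (eLpNorm g 2).toReal / ‖c‖) *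
      ‖h.toLp 2 (volume : Measure (E d))‖ := by
    intro h
    rw [div_mul_eq_mul_div, le_div_iff₀ (norm_pos_iff.2 hg0), ← norm_mul, ← hspec, SchwartzMap.norm_toLp,
      ← ENNReal.toReal_mul, ← ENNReal.toReal_mul, ← toReal_enorm]
    have hh : eLpNorm (conjS h) 2 = eLpNorm h 2 := eLpNorm_conj h 2
    refine ENNReal.toReal_mono (ENNReal.mul_ne_top (ENNReal.mul_ne_top hD' hgn)
      (h.memLp 2 volume).2.ne) ?_
    have hV := memLp_stft (g.memLp 2 volume) ((conjS h).memLp 2 volume)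
    refine (enorm_integral_mul_le (p := 2) (q := 2) hD.1 (memLp_conj hV).1).trans ?_
    rw [eLpNorm_conj, mul_assoc]
    refine mul_le_mul_right ?_ _
    rw [← hh]
    exact eLpNorm_stft_le (g.memLp 2) ((conjS h).memLp 2)
  obtain ⟨b, hb⟩ := exists_inner_representation
    (SchwartzMap.toLpCLM ℂ ℂ 2 (volume : Measure (E d))).toLinearMap
    (T : 𝓢(E d, ℂ) →L[ℂ] ℂ).toLinearMap hb
  refine ⟨fun t => conj (b t), memLp_conj (Lp.memLp b), fun h =>
    ⟨(memLp_conj (Lp.memLp b)).integrable_mul (h.memLp 2), ?_⟩⟩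
  refine (hb h).trans ((inner_eq_integral (ae_eq_refl _) (h.coeFn_toLp 2 volume)).trans ?_)
  simp_rw [mul_comm]

/-- An upper bound for the `L^{q'}` norm by the `L^q` norm of the short-time Fourier transform. -/
theorem exists_eLpNorm_le_stft {g : 𝓢(E d, ℂ)} (hg : g ≠ 0) {q q' : ℝ≥0∞} (hq : 1 ≤ q)
    (hq2 : q ≤ 2) (hqq : q⁻¹ + q'⁻¹ = 1) :
    ∃ C : ℝ≥0, ∀ f : E d → ℂ, MemLp f 2 → eLpNorm f q' ≤ C * eLpNorm (stft g f) q := by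
  have : q.HolderConjugate q' := ENNReal.holderConjugate_iff.2 hqq
  have hg0 := integral_mul_conj_ne_zero hg
  obtain ⟨C, hC⟩ := exists_eLpNorm_stft_le g hq hq2 hqq
  refine ⟨C / ‖∫ t, g t * conj (g t)‖₊, fun f hf => ?_⟩
  refine eLpNorm_le_of_integral_le hf hq hq2 hqq fun k hk hk2 => ?_
  have hk' := memLp_conj hk
  have hk2' := memLp_conj hk2
  -- Moyal moves the pairing of `f` and `k` to phase space, where Hölder meets the bound `L^q →
  -- L^{q'}` for the transform of `conj k`.
  have h1 := integral_stft_mul_conj_stft (g.memLp 2) (g.memLp 2) hf hk2'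
  simp only [Complex.conj_conj] at h1
  have h2 : ‖(∫ t, f t * k t) * ∫ t, g t * conj (g t)‖ₑ ≤
      eLpNorm (stft g f) q * (C * eLpNorm k q) := by
    rw [← h1]
    refine (enorm_integral_mul_le (p := q) (q := q') (memLp_stft (g.memLp 2) hf).1
      (memLp_conj (memLp_stft (g.memLp 2) hk2')).1).trans ?_
    rw [eLpNorm_conj (stft g _)]
    refine mul_le_mul_right ((hC _ hk').trans_eq ?_) _
    rw [eLpNorm_conj]
  generalize ∫ t, g t * conj (g t) = c at hg0 h2
  rw [enorm_mul, ← ENNReal.le_div_iff_mul_le (Or.inl (enorm_ne_zero.2 hg0)) (Or.inl enorm_ne_top)] at h2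
  refine h2.trans_eq ?_
  rw [ENNReal.coe_div (nnnorm_ne_zero_iff.2 hg0), ← enorm_eq_nnnorm]
  simp only [div_eq_mul_inv]
  ring

/-! ### Windows in `M¹` -/

theorem integral_fourier_mul_eq_of_memLp (W K : L2 d) :
    ∫ t, (𝓕 W : L2 d) t * K t = ∫ t, W t * (𝓕 K : L2 d) t := by
  have hc : ∀ A : L2 d, Continuous fun B : L2 d => ∫ t, A t * B t := by
    intro A
    have : (fun B : L2 d => ∫ t, A t * B t) =
        fun B => inner ℂ ((memLp_conj (Lp.memLp A)).toLp : L2 d) B := by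
      ext B
      rw [inner_eq_integral (MemLp.coeFn_toLp _) (ae_eq_refl _)]
      simp_rw [Complex.conj_conj, mul_comm]
    rw [this]
    exact continuous_const.inner continuous_id
  obtain ⟨k, hk⟩ := exists_seq_schwartz_tendsto K
  have h1 := ((hc (𝓕 W)).tendsto K).comp hk
  have h2 := (((hc W).comp (ContinuousFourier.continuous_fourier :
    Continuous (𝓕 : L2 d → L2 d))).tendsto K).comp hk
  refine tendsto_nhds_unique h1 (h2.congr fun n => ?_)
  simp only [Function.comp_apply]
  rw [SchwartzMap.toLp_fourier_eq]
  have e1 := Lp.toTemperedDistribution_apply (𝓕 W : L2 d) (k n)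
  rw [← Lp.fourier_toTemperedDistribution_eq, TemperedDistribution.fourier_apply,
    Lp.toTemperedDistribution_apply] at e1
  refine (integral_congr_ae ?_).trans (e1.trans (integral_congr_ae ?_))
  · filter_upwards [(𝓕 (k n)).coeFn_toLp 2 volume] with t ht
    rw [ht, smul_eq_mul, mul_comm]
  · filter_upwards [(k n).coeFn_toLp 2 volume] with t ht
    rw [ht, smul_eq_mul, mul_comm]

/-- Moving the Fourier transform onto `h` leaves `∫ K * 𝓕 h` with `‖𝓕 h‖_∞ ≤ ‖h‖₁`. The right side
may be infinite, since `K` is only known to be in `L²`. -/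
theorem enorm_integral_fourier_mul_le (K : L2 d) (h : 𝓢(E d, ℂ)) :
    ‖∫ t, (𝓕 K : L2 d) t * h t‖ₑ ≤ eLpNorm K 1 * eLpNorm h 1 := by
  have e1 := Lp.toTemperedDistribution_apply (𝓕 K : L2 d) h
  rw [← Lp.fourier_toTemperedDistribution_eq, TemperedDistribution.fourier_apply,
    Lp.toTemperedDistribution_apply] at e1
  simp_rw [smul_eq_mul] at e1
  simp_rw [mul_comm _ (h _), ← e1, mul_comm _ (K _)]
  refine (enorm_integral_mul_le (p := 1) (q := ∞) (Lp.aestronglyMeasurable K)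
    (𝓕 h).continuous.aestronglyMeasurable).trans (mul_le_mul_right ?_ _)
  rw [eLpNorm_exponent_top]
  refine eLpNormEssSup_le_of_ae_enorm_bound (Eventually.of_forall fun ξ => ?_)
  rw [SchwartzMap.fourier_coe, fourier_eq_integral_chi, eLpNorm_one_eq_lintegral_enorm]
  refine (enorm_integral_le_lintegral_enorm _).trans_eq (lintegral_congr fun t => ?_)
  rw [enorm_mul, ← ofReal_norm (chi _ _), norm_chi, ENNReal.ofReal_one, one_mul]

/-- Duality against `k ∈ L¹ ∩ L²`: the Fourier transform passes to `k`, Moyal moves the pairing to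
phase space, `V_g W` is integrable there, and the transform of `conj (𝓕 k)` is bounded by `‖k‖₁
‖g‖₁`. -/
theorem memLp_top_fourier {g : 𝓢(E d, ℂ)} (hg : g ≠ 0) (W : L2 d)
    (hW : MemLp (stft g W) 1) : MemLp (𝓕 W : L2 d) ∞ := by
  have hg0 := integral_mul_conj_ne_zero hg
  refine ⟨Lp.aestronglyMeasurable (𝓕 W : L2 d), ?_⟩
  have hg1 : eLpNorm g 1 < ∞ := by
    have := g.memLp 1 (volume : Measure (E d))
    exact this.2
  have hmoyal := fun {F : E d → ℂ} (hF : MemLp F 2 volume) =>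
    integral_stft_mul_conj_stft (d := d) (w := g) (w' := g) (g.memLp 2) (g.memLp 2) (Lp.memLp W) hF
  generalize ∫ t, g t * conj (g t) = c at hg0 hmoyal
  have hK : eLpNorm (stft g W) 1 * eLpNorm g 1 / ‖c‖ₑ < ∞ :=
    ENNReal.div_lt_top (ENNReal.mul_lt_top hW.2 hg1).ne (enorm_ne_zero.2 hg0)
  refine lt_of_le_of_lt ?_ hK
  refine eLpNorm_le_of_integral_le (q := 1) (q' := ∞) (Lp.memLp (𝓕 W : L2 d)) le_rfl
    one_le_two (by simp) fun k hk hk2 => ?_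
  have e1 : ∫ t, (𝓕 W : L2 d) t * k t = ∫ t, W t * (𝓕 (hk2.toLp k) : L2 d) t := by
    rw [← integral_fourier_mul_eq_of_memLp]
    refine integral_congr_ae ?_
    filter_upwards [hk2.coeFn_toLp] with t ht
    rw [ht]
  have hF : MemLp (fun t => conj ((𝓕 (hk2.toLp k) : L2 d) t)) 2 := memLp_conj (Lp.memLp _)
  have h1 := hmoyal hF
  simp only [Complex.conj_conj] at h1
  rw [← e1] at h1
  have h2 : eLpNorm (stft g fun t => conj ((𝓕 (hk2.toLp k) : L2 d) t)) ∞ ≤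
      eLpNorm k 1 * eLpNorm g 1 := by
    rw [eLpNorm_exponent_top]
    refine eLpNormEssSup_le_of_ae_enorm_bound (Eventually.of_forall fun z => ?_)
    have e2 : stft g (fun t => conj ((𝓕 (hk2.toLp k) : L2 d) t)) z =
        conj (∫ t, (𝓕 (hk2.toLp k) : L2 d) t * tfShiftS z g t) := by
      rw [stft, ← integral_conj]
      congr 1; ext t
      rw [map_mul, tfShiftS_apply]
    have e3 : (tfShiftS z g : E d → ℂ) = tfShift z g := funext (tfShiftS_apply z g)
    rw [e2, RCLike.enorm_conj]
    refine (enorm_integral_fourier_mul_le _ _).trans_eq ?_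
    rw [e3, eLpNorm_tfShift g.continuous.aestronglyMeasurable, eLpNorm_congr_ae hk2.coeFn_toLp]
  have h3 : ‖∫ t, (𝓕 W : L2 d) t * k t‖ₑ ≤
      (eLpNorm (stft g W) 1 * (eLpNorm k 1 * eLpNorm g 1)) / ‖c‖ₑ := by
    rw [ENNReal.le_div_iff_mul_le (Or.inl (enorm_ne_zero.2 hg0)) (Or.inl enorm_ne_top),
      ← enorm_mul, ← h1]
    refine (enorm_integral_mul_le (p := 1) (q := ∞) hW.1
      (memLp_conj (memLp_stft (g.memLp 2) hF)).1).trans ?_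
    rw [eLpNorm_conj (stft g _)]
    exact mul_le_mul_right h2 _
  refine h3.trans_eq ?_
  simp only [div_eq_mul_inv]
  ring

/-- By Moyal and covariance, `|V_w h|` is dominated by a correlation of `|V_g w|` with `|V_g h|`,
both integrable. It makes the synthesis integral of the blur converge absolutely. -/
theorem memLp_one_stft {g : 𝓢(E d, ℂ)} (hg : g ≠ 0) {w : E d → ℂ} (hw : MemLp w 2)
    (hw1 : MemLp (stft g w) 1) (h : 𝓢(E d, ℂ)) : MemLp (stft w h) 1 := by
  have hg0 := integral_mul_conj_ne_zero hg
  have hm := (memLp_stft hw (h.memLp 2)).1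
  refine ⟨hm, ?_⟩
  have hb : ∀ z, ‖stft w h z‖ₑ * ‖∫ t, g t * conj (g t)‖ₑ ≤
      ∫⁻ z', ‖stft g w z'‖ₑ * ‖stftS g h (z' + z)‖ₑ := by
    intro z
    have e1 : ‖stft w h z‖ₑ = ‖∫ t, w t * conj (tfShiftS (-z) h t)‖ₑ := by
      rw [← ofReal_norm, stft_swap, ofReal_norm]
      simp_rw [tfShiftS_apply]
      rfl
    rw [e1, ← enorm_mul, ← integral_stft_mul_conj_stft (g.memLp 2) (g.memLp 2) hw
      ((tfShiftS (-z) h).memLp 2)]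
    refine (enorm_integral_le_lintegral_enorm _).trans_eq (lintegral_congr fun z' => ?_)
    rw [enorm_mul, RCLike.enorm_conj]
    congr 1
    rw [funext (tfShiftS_apply (-z) h), ← ofReal_norm, norm_stft_tfShift, sub_neg_eq_add,
      ofReal_norm, stftS_apply]
  have hfin : ∫⁻ z, ‖stft w h z‖ₑ * ‖∫ t, g t * conj (g t)‖ₑ < ∞ := by
    refine (lintegral_mono hb).trans_lt ?_
    rw [lintegral_lintegral_swap]
    · have e : ∀ z' : Phase d, ∫⁻ z, ‖stft g w z'‖ₑ * ‖stftS g h (z' + z)‖ₑ =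
          ‖stft g w z'‖ₑ * eLpNorm (stftS g h) 1 := by
        intro z'
        rw [lintegral_const_mul' _ _ enorm_ne_top, lintegral_add_left_eq_self
          (fun z => ‖stftS g h z‖ₑ), eLpNorm_one_eq_lintegral_enorm]
      simp_rw [e]
      have hS : eLpNorm (stftS g h) 1 < ∞ := ((stftS g h).memLp 1 volume).2
      rw [lintegral_mul_const' _ _ hS.ne, ← eLpNorm_one_eq_lintegral_enorm]
      exact ENNReal.mul_lt_top hw1.2 hS
    · have h1 : AEMeasurable fun p : Phase d × Phase d => ‖stft g w p.2‖ₑ :=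
        (hw1.1.enorm).comp_quasiMeasurePreserving
          (Measure.quasiMeasurePreserving_snd (μ := volume) (ν := volume))
      have h2 : AEMeasurable fun p : Phase d × Phase d => ‖stftS g h (p.2 + p.1)‖ₑ :=
        ((stftS g h).continuous.comp (continuous_snd.add continuous_fst)).enorm.aemeasurable
      exact h1.mul h2
  rw [lintegral_mul_const' _ _ enorm_ne_top, ← eLpNorm_one_eq_lintegral_enorm] at hfin
  by_contra h0
  rw [not_lt, top_le_iff] at h0
  rw [h0, ENNReal.top_mul (enorm_ne_zero.2 hg0)] at hfin
  exact lt_irrefl _ hfin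

end Modulation

/-! ### Fourier transforms on `L¹`, `L²` and `L^r` with `1 ≤ r ≤ 2`. -/

noncomputable section FourierIntegral

open Filter Topology

variable {d : ℕ}

/-! ### Fourier transforms of functions in `L^r`, `1 ≤ r ≤ 2` -/

section General

variable {V : Type*} [NormedAddCommGroup V] [InnerProductSpace ℝ V] [FiniteDimensional ℝ V]
  [MeasurableSpace V] [BorelSpace V]

theorem continuous_fourier_of_integrable {f : V → ℂ} (hf : Integrable f) : Continuous (𝓕 f) :=
  VectorFourier.fourierIntegral_continuous Real.continuous_fourierChar
    (by exact continuous_inner) hf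

theorem norm_fourier_le (f : V → ℂ) (ξ : V) : ‖𝓕 f ξ‖ ≤ ∫ x, ‖f x‖ :=
  VectorFourier.norm_fourierIntegral_le_integral_norm _ _ _ _ _

theorem memLp_top_fourier_of_integrable {f : V → ℂ} (hf : Integrable f) : MemLp (𝓕 f) ∞ :=
  memLp_top_of_bound (continuous_fourier_of_integrable hf).aestronglyMeasurable _
    (Eventually.of_forall (norm_fourier_le f))

theorem integral_fourier_mul_eq_flip {f g : V → ℂ} (hf : Integrable f) (hg : Integrable g) :
    ∫ x, 𝓕 f x * g x = ∫ x, f x * 𝓕 g x := by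
  have := VectorFourier.integral_fourierIntegral_smul_eq_flip (L := innerₗ V)
    Real.continuous_fourierChar (by exact continuous_inner) hf hg
  simpa using! this

theorem fourierInv_conj (f : V → ℂ) (ξ : V) : 𝓕⁻ (fun x => conj (f x)) ξ = conj (𝓕 f ξ) := by
  rw [Real.fourierInv_eq', Real.fourier_eq', ← integral_conj]
  congr 1; ext t
  simp only [smul_eq_mul, map_mul, ← Complex.exp_conj, Complex.conj_I, Complex.conj_ofReal]
  congr 2
  push_cast
  ring

theorem fourier_conj (f : V → ℂ) (ξ : V) : 𝓕 (fun x => conj (f x)) ξ = conj (𝓕⁻ f ξ) := by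
  rw [Real.fourierInv_eq', Real.fourier_eq', ← integral_conj]
  congr 1; ext t
  simp only [smul_eq_mul, map_mul, ← Complex.exp_conj, Complex.conj_I, Complex.conj_ofReal]
  congr 2
  push_cast
  ring

theorem integral_fourierInv_mul_conj {f g : V → ℂ} (hf : Integrable f) (hg : Integrable g) :
    ∫ x, 𝓕⁻ f x * conj (g x) = ∫ x, f x * conj (𝓕 g x) := by
  have hf' : Integrable fun x => conj (f x) := (memLp_one_iff_integrable.1
    (memLp_conj (memLp_one_iff_integrable.2 hf)))
  have := congrArg conj (integral_fourier_mul_eq_flip hf' hg)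
  rw [← integral_conj, ← integral_conj] at this
  simpa [fourier_conj] using this

theorem represents_fourier_toLp {f : V → ℂ} (hf : MemLp f 2) :
    Represents (𝓕 (hf.toLp f) : Lp ℂ 2 (volume : Measure V))
      (𝓕 (Lp.toTemperedDistribution (hf.toLp f))) := by
  rw [Lp.fourier_toTemperedDistribution_eq]
  exact represents_toTemperedDistribution _

/-- The Plancherel transform and the Fourier integral represent the same tempered distribution,
hence agree almost everywhere. -/
theorem fourier_toLp_ae_eq {f : V → ℂ} (hf1 : MemLp f 1) (hf2 : MemLp f 2) :
    (𝓕 (hf2.toLp f) : Lp ℂ 2 (volume : Measure V)) =ᵐ[volume] 𝓕 f := by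
  refine (represents_fourier_toLp hf2).ae_eq fun h => ?_
  have hfi := memLp_one_iff_integrable.1 hf1
  refine ⟨(memLp_top_fourier_of_integrable hfi).integrable_mul (h.memLp 1), ?_⟩
  rw [integral_fourier_mul_eq_flip hfi h.integrable, TemperedDistribution.fourier_apply,
    Lp.toTemperedDistribution_apply]
  refine integral_congr_ae ?_
  filter_upwards [hf2.coeFn_toLp] with x hx
  rw [hx, smul_eq_mul, mul_comm, SchwartzMap.fourier_coe]

end General

/-- Cut at height `1`: the set of large values has finite measure, so that part is in `L¹`, and the
rest is bounded and in `L^r`, hence in `L²`. -/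
theorem exists_add_memLp_one_two {α : Type*} [MeasurableSpace α] {μ : Measure α} {G : α → ℂ}
    {r : ℝ≥0∞} (hr : 1 ≤ r) (hr2 : r ≤ 2) (hG : MemLp G r μ) :
    ∃ G₁ G₂ : α → ℂ, MemLp G₁ 1 μ ∧ MemLp G₂ 2 μ ∧ G =ᵐ[μ] G₁ + G₂ := by
  set G₀ := hG.1.mk G
  have hG₀ : MemLp G₀ r μ := (memLp_congr_ae hG.1.ae_eq_mk).1 hG
  have hsm : StronglyMeasurable G₀ := hG.1.stronglyMeasurable_mk
  set s := {x | (1 : ℝ≥0) ≤ ‖G₀ x‖₊}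
  have hs : MeasurableSet s := measurableSet_le measurable_const hsm.measurable.nnnorm
  have hμ : μ s < ∞ := hG₀.meas_ge_lt_top (zero_lt_one.trans_le hr).ne'
    (hr2.trans_lt ENNReal.ofNat_lt_top).ne one_ne_zero
  refine ⟨s.indicator G₀, sᶜ.indicator G₀, ?_, ?_, ?_⟩
  · have : IsFiniteMeasure (μ.restrict s) := ⟨by simpa using hμ⟩
    rw [memLp_indicator_iff_restrict hs]
    exact (hG₀.restrict s).mono_exponent hr
  · refine memLp_of_memLp_top (hG₀.indicator hs.compl) ?_ hr hr2
    refine memLp_top_of_bound (hsm.indicator hs.compl).aestronglyMeasurable 1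
      (Eventually.of_forall fun x => ?_)
    by_cases hx : x ∈ s
    · simp [hx]
    · rw [Set.indicator_of_mem (by exact hx)]
      exact (lt_of_not_ge hx).le
  · refine hG.1.ae_eq_mk.trans (Eventually.of_forall fun x => ?_)
    exact (congrFun (Set.indicator_self_add_compl s G₀) x).symm

/-- A function in `L^r`, `1 ≤ r ≤ 2`, has an inverse Fourier transform that pairs with functions
in `L¹ ∩ L²`. -/
theorem exists_fourierInv_of_memLp {G : Phase d → ℂ} {r : ℝ≥0∞} (hr : 1 ≤ r) (hr2 : r ≤ 2)
    (hG : MemLp G r) : ∃ H : Phase d → ℂ, ∀ (V : Phase d → ℂ) (_ : MemLp V 1) (hV : MemLp V 2),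
      Integrable (fun z => H z * conj (V z)) ∧
      ∫ z, H z * conj (V z) = ∫ ξ, G ξ * conj ((𝓕 (hV.toLp V) : L2P d) ξ) := by
  obtain ⟨G₁, G₂, h₁, h₂, hGG⟩ := exists_add_memLp_one_two hr hr2 hG
  have h₁i := memLp_one_iff_integrable.1 h₁
  -- `H` is the sum of a bounded Fourier integral and an `L²` inverse transform, which is why the
  -- functions paired with it must lie in both `L¹` and `L²`.
  set H₂ : L2P d := 𝓕⁻ (h₂.toLp G₂)
  refine ⟨fun z => 𝓕⁻ G₁ z + H₂ z, fun V hV1 hV2 => ?_⟩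
  have hVi := memLp_one_iff_integrable.1 hV1
  have hae := fourier_toLp_ae_eq hV1 hV2
  have hH₁ : MemLp (𝓕⁻ G₁) ∞ := by
    have : 𝓕⁻ G₁ = fun z => 𝓕 G₁ (-z) := by ext z; rw [Real.fourierInv_eq_fourier_neg]
    rw [this]
    exact memLp_top_of_bound
      ((continuous_fourier_of_integrable h₁i).comp continuous_neg).aestronglyMeasurable _
      (Eventually.of_forall fun z => norm_fourier_le G₁ (-z))
  have hi₁ : Integrable fun z => 𝓕⁻ G₁ z * conj (V z) := hH₁.integrable_mul (memLp_conj hV1)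
  have hi₂ : Integrable fun z => H₂ z * conj (V z) :=
    (Lp.memLp H₂).integrable_mul (memLp_conj hV2)
  refine ⟨(hi₁.add hi₂).congr (Eventually.of_forall fun z => by simp [add_mul]), ?_⟩
  have hF : MemLp (𝓕 (hV2.toLp V) : L2P d) 2 := Lp.memLp _
  have hF' : MemLp (𝓕 (hV2.toLp V) : L2P d) ∞ :=
    (memLp_congr_ae hae).2 (memLp_top_fourier_of_integrable hVi)
  have e : ∫ ξ, G ξ * conj ((𝓕 (hV2.toLp V) : L2P d) ξ) =
      (∫ ξ, G₁ ξ * conj ((𝓕 (hV2.toLp V) : L2P d) ξ)) +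
        ∫ ξ, G₂ ξ * conj ((𝓕 (hV2.toLp V) : L2P d) ξ) := by
    have j₁ : Integrable fun ξ => G₁ ξ * conj ((𝓕 (hV2.toLp V) : L2P d) ξ) :=
      h₁.integrable_mul (memLp_conj hF')
    have j₂ : Integrable fun ξ => G₂ ξ * conj ((𝓕 (hV2.toLp V) : L2P d) ξ) :=
      h₂.integrable_mul (memLp_conj hF)
    rw [← integral_add j₁ j₂]
    refine integral_congr_ae ?_
    filter_upwards [hGG] with ξ hξ
    rw [hξ, Pi.add_apply, add_mul]
  simp_rw [add_mul]
  rw [integral_add hi₁ hi₂, e, integral_fourierInv_mul_conj h₁i hVi]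
  congr 1
  · refine integral_congr_ae ?_
    filter_upwards [hae] with ξ hξ
    rw [hξ]
  · have e2 := inner_fourierInv_L2P (𝓕 (hV2.toLp V) : L2P d) (h₂.toLp G₂)
    rw [FourierTransform.fourierInv_fourier_eq] at e2
    rw [← inner_eq_integral hV2.coeFn_toLp (ae_eq_refl H₂), e2,
      inner_eq_integral (ae_eq_refl _) h₂.coeFn_toLp]

end FourierIntegral

/-! ### Reduction of the phase-space multiplier to multiplication on `ℝᵈ`. -/

noncomputable section Multiplier

open Filter Topology

variable {d : ℕ}

/-! ### Weighted fibre integrals -/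

/-- The integral of `m` over the fibres `ξ ↦ (ξ, η)` with weight `|v(ξ)|²`. -/
def fibreMean (v : E d → ℂ) (m : Phase d → ℂ) (η : E d) : ℂ :=
  ∫ ξ, m (mkP (ξ, η)) * ((‖v ξ‖ ^ 2 : ℝ) : ℂ)

theorem aestronglyMeasurable_comp_mkP {m : Phase d → ℂ} (hm : AEStronglyMeasurable m) :
    AEStronglyMeasurable fun x : E d × E d => m (mkP (x.2, x.1)) :=
  (hm.comp_measurePreserving measurePreserving_mkP).prod_swap

theorem aestronglyMeasurable_fibreMean {v : E d → ℂ} {m : Phase d → ℂ}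
    (hv : AEStronglyMeasurable v) (hm : AEStronglyMeasurable m) :
    AEStronglyMeasurable (fibreMean v m) := by
  have h1 := aestronglyMeasurable_comp_mkP hm
  have h2 : AEStronglyMeasurable fun ξ => ((‖v ξ‖ ^ 2 : ℝ) : ℂ) :=
    Complex.continuous_ofReal.comp_aestronglyMeasurable (hv.norm.pow 2)
  exact (h1.mul h2.comp_snd).integral_prod_right'

theorem enorm_fibreMean_le (v : E d → ℂ) (m : Phase d → ℂ) (η : E d) :
    ‖fibreMean v m η‖ₑ ≤ ∫⁻ ξ, ‖m (mkP (ξ, η))‖ₑ * ‖v ξ‖ₑ ^ 2 := by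
  refine (enorm_integral_le_lintegral_enorm _).trans_eq (lintegral_congr fun ξ => ?_)
  rw [enorm_mul, ← ofReal_norm ((_ : ℝ) : ℂ), Complex.norm_real, Real.norm_of_nonneg (by positivity),
    ENNReal.ofReal_pow (norm_nonneg _), ofReal_norm]

/-- Hölder in each fibre with respect to the finite measure `|v|² dξ`, then `|v|² ≤ ‖v‖_∞²` returns
to Lebesgue measure and Tonelli integrates over the fibres. -/
theorem eLpNorm_fibreMean_le {v : E d → ℂ} (hv : MemLp v 2) (hv' : MemLp v ∞) {p : ℝ≥0∞}
    (hp : 1 ≤ p) : ∃ C : ℝ≥0, ∀ m : Phase d → ℂ, AEStronglyMeasurable m →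
      eLpNorm (fibreMean v m) p ≤ C * eLpNorm m p := by
  set A := ∫⁻ ξ, ‖v ξ‖ₑ ^ 2 with hAdef
  have hA : A ≠ ∞ := by
    have := (eLpNorm_lt_top_iff_lintegral_rpow_enorm_lt_top two_ne_zero
      ENNReal.ofNat_ne_top).1 hv.2
    simp only [ENNReal.toReal_ofNat, ENNReal.rpow_ofNat] at this
    exact this.ne
  have ha : AEMeasurable fun ξ => ‖v ξ‖ₑ ^ 2 := hv.1.enorm.pow_const 2
  rcases eq_or_ne p ∞ with rfl | hpt
  · refine ⟨A.toNNReal, fun m hm => ?_⟩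
    rw [ENNReal.coe_toNNReal hA]
    refine eLpNormEssSup_le_of_ae_enorm_bound ?_
    have h1 : ∀ᵐ x : E d × E d, ‖m (mkP (x.2, x.1))‖ₑ ≤ eLpNorm m ∞ := by
      have h2 : ∀ᵐ z : Phase d, ‖m z‖ₑ ≤ eLpNorm m ∞ := ae_le_eLpNormEssSup
      have h3 := measurePreserving_mkP.quasiMeasurePreserving.ae h2
      exact (Measure.measurePreserving_swap (μ := (volume : Measure (E d)))
        (ν := (volume : Measure (E d)))).quasiMeasurePreserving.ae h3
    filter_upwards [Measure.ae_ae_of_ae_prod h1] with η hη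
    refine (enorm_fibreMean_le v m η).trans ?_
    rw [mul_comm, hAdef, ← lintegral_const_mul'' _ ha]
    refine lintegral_mono_ae ?_
    filter_upwards [hη] with ξ hξ
    gcongr
  · have hp0 : p ≠ 0 := (zero_lt_one.trans_le hp).ne'
    set P := p.toReal
    have hP : 1 ≤ P := by simpa using ENNReal.toReal_mono hpt hp
    have hP0 : 0 < P := by linarith
    set K := eLpNorm v ∞ with hK
    have hKt : K ^ 2 ≠ ∞ := (ENNReal.pow_lt_top hv'.2).ne
    have hA1 : A ^ (P - 1) ≠ ∞ := (ENNReal.rpow_lt_top_of_nonneg (by linarith) hA).ne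
    have hC : (A ^ (P - 1) * K ^ 2) ^ (1 / P) ≠ ∞ :=
      (ENNReal.rpow_lt_top_of_nonneg (by positivity) (ENNReal.mul_ne_top hA1 hKt)).ne
    refine ⟨((A ^ (P - 1) * K ^ 2) ^ (1 / P)).toNNReal, fun m hm => ?_⟩
    rw [ENNReal.coe_toNNReal hC, eLpNorm_eq_lintegral_rpow_enorm_toReal hp0 hpt,
      eLpNorm_eq_lintegral_rpow_enorm_toReal hp0 hpt, ← ENNReal.mul_rpow_of_nonneg _ _ (by positivity)]
    refine ENNReal.rpow_le_rpow ?_ (by positivity)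
    have hpt : ∀ᵐ η : E d, ‖fibreMean v m η‖ₑ ^ P ≤
        A ^ (P - 1) * K ^ 2 * ∫⁻ ξ, ‖m (mkP (ξ, η))‖ₑ ^ P := by
      have hfib : ∀ᵐ η : E d, AEMeasurable fun ξ : E d => ‖m (mkP (ξ, η))‖ₑ := by
        filter_upwards [(aestronglyMeasurable_comp_mkP hm).prodMk_left] with η hη using hη.enorm
      filter_upwards [hfib] with η hη
      have hw : ∀ x a : ℝ≥0∞, a ≠ ∞ → x * a = (x ^ P * a) ^ (1 / P) * a ^ (1 - 1 / P) := by
        intro x a ha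
        have h4 : 1 / P ≤ 1 := by rw [div_le_one hP0]; exact hP
        rw [ENNReal.mul_rpow_of_nonneg _ _ (by positivity), ← ENNReal.rpow_mul,
          mul_one_div_cancel hP0.ne', ENNReal.rpow_one, mul_assoc,
          ← ENNReal.rpow_add_of_nonneg _ _ (by positivity) (by linarith)]
        simp
      have h3 : ‖fibreMean v m η‖ₑ ≤
          (∫⁻ ξ, ‖m (mkP (ξ, η))‖ₑ ^ P * ‖v ξ‖ₑ ^ 2) ^ (1 / P) * A ^ (1 - 1 / P) := by
        refine (enorm_fibreMean_le v m η).trans ?_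
        have h4 : 1 / P ≤ 1 := by rw [div_le_one hP0]; exact hP
        refine le_trans (le_of_eq (lintegral_congr fun ξ => hw _ _ (by simp)))
          (ENNReal.lintegral_mul_norm_pow_le ((hη.pow_const P).mul ha) ha (by positivity)
            (by linarith) (by ring))
      calc ‖fibreMean v m η‖ₑ ^ P ≤ ((∫⁻ ξ, ‖m (mkP (ξ, η))‖ₑ ^ P * ‖v ξ‖ₑ ^ 2) ^ (1 / P) *
            A ^ (1 - 1 / P)) ^ P := ENNReal.rpow_le_rpow h3 hP0.le
        _ = A ^ (P - 1) * ∫⁻ ξ, ‖m (mkP (ξ, η))‖ₑ ^ P * ‖v ξ‖ₑ ^ 2 := by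
            rw [ENNReal.mul_rpow_of_nonneg _ _ hP0.le, ← ENNReal.rpow_mul, ← ENNReal.rpow_mul,
              one_div_mul_cancel hP0.ne', ENNReal.rpow_one, sub_mul, one_mul,
              one_div_mul_cancel hP0.ne', mul_comm]
        _ ≤ A ^ (P - 1) * ∫⁻ ξ, K ^ 2 * ‖m (mkP (ξ, η))‖ₑ ^ P := by
            refine mul_le_mul_right (lintegral_mono_ae ?_) _
            filter_upwards [ae_le_eLpNormEssSup (f := v) (μ := volume)] with ξ hξ
            rw [mul_comm]
            gcongr
            exact hξ
        _ = _ := by rw [lintegral_const_mul' _ _ hKt, mul_assoc]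
    refine (lintegral_mono_ae hpt).trans_eq ?_
    rw [lintegral_const_mul' _ _ (ENNReal.mul_ne_top hA1 hKt), lintegral_phase]
    congr 1
    have hm2 : AEMeasurable fun x : E d × E d => ‖m (mkP x)‖ₑ ^ P :=
      (hm.comp_measurePreserving measurePreserving_mkP).enorm.pow_const P
    rw [Measure.volume_eq_prod] at hm2 ⊢
    exact (lintegral_prod_symm _ hm2).symm

theorem mul_rih_mul_conj_rih (v f k : E d → ℂ) (m : Phase d → ℂ) (ξ : Phase d) :
    m ξ * rih v f ξ * conj (rih v k ξ) =
      m ξ * ((‖v ξ.fst‖ ^ 2 : ℝ) : ℂ) * (f (-ξ.snd) * conj (k (-ξ.snd))) := by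
  have h1 := chi_mul_conj ξ.fst ξ.snd
  have h2 := Complex.mul_conj (v ξ.fst)
  rw [Complex.normSq_eq_norm_sq] at h2
  rw [← h2, rih, rih, map_mul, map_mul, Complex.conj_conj]
  linear_combination (m ξ * (conj (v ξ.fst) * f (-ξ.snd)) * v ξ.fst * conj (k (-ξ.snd))) * h1

/-- The Fubini step that exhibits the blur as a multiplication operator; `-t` stems from the
reflected signal in `rih`. -/
theorem integral_mul_rih_mul_conj_rih {v f k : E d → ℂ} {m : Phase d → ℂ}
    (hi : Integrable fun ξ => m ξ * rih v f ξ * conj (rih v k ξ)) :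
    ∫ ξ, m ξ * rih v f ξ * conj (rih v k ξ) =
      ∫ t, f t * fibreMean v m (-t) * conj (k t) := by
  simp_rw [mul_rih_mul_conj_rih] at hi ⊢
  rw [integrable_phase_iff, Measure.volume_eq_prod] at hi
  rw [integral_phase, Measure.volume_eq_prod, integral_prod_symm _ hi, ← integral_neg_eq_self]
  congr 1; ext t
  have e : ∀ ξ : E d, m (mkP (ξ, -t)) * ((‖v (mkP (ξ, -t)).fst‖ ^ 2 : ℝ) : ℂ) *
      (f (-(mkP (ξ, -t)).snd) * conj (k (-(mkP (ξ, -t)).snd))) =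
      m (mkP (ξ, -t)) * ((‖v ξ‖ ^ 2 : ℝ) : ℂ) * (f t * conj (k t)) := by
    intro ξ
    simp
  simp_rw [e]
  rw [integral_mul_const, fibreMean]
  ring

end Multiplier

/-! ### Existence, uniqueness and the bound for the blurring operator. -/

noncomputable section Blur

open Filter Topology

variable {d : ℕ}

/-! ### The blurring operator -/

/-- Each witness is determined up to null sets by the previous ones, from the window and signal to
`V_w f`, its Fourier transform, the product with `m`, and by Fourier inversion the convolution `H`.
-/
theorem IsBlur.unique {φ ψ u v : 𝓢'(E d, ℂ)} {μ : 𝓢'(Phase d, ℂ)} (h : IsBlur φ μ ψ u)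
    (h' : IsBlur φ μ ψ v) : v = u := by
  obtain ⟨w, f, H, -, -, hw, hf, ⟨TF, TH, m, Fh, hTF, hTH, hm, hFh, hG⟩, hs⟩ := h
  obtain ⟨w', f', H', -, -, hw', hf', ⟨TF', TH', m', Fh', hTF', hTH', hm', hFh', hG'⟩, hs'⟩ := h'
  have ew := hw.ae_eq hw'
  rw [stft_congr_ae ew (hf.ae_eq hf')] at hTF
  rw [hTF.eq hTF'] at hFh
  have eG : (fun ξ => m ξ * Fh ξ) =ᵐ[volume] fun ξ => m' ξ * Fh' ξ := by
    filter_upwards [hm.ae_eq hm', hFh.ae_eq hFh'] with ξ h1 h2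
    rw [h1, h2]
  have eT : 𝓕 TH = 𝓕 TH' := (hG.congr_ae eG).eq hG'
  replace eT := congrArg (fun T => 𝓕⁻ T) eT
  simp only [FourierTransform.fourierInv_fourier_eq] at eT
  rw [eT] at hTH
  have eH := hTH.ae_eq hTH'
  ext k
  rw [(hs k).2, (hs' k).2]
  refine integral_congr_ae ?_
  filter_upwards [eH] with z hz
  rw [hz]
  congr 1
  refine integral_congr_ae ?_
  filter_upwards [tfShift_congr_ae ew z] with t ht
  rw [ht]

theorem fourier_toLp_stft_ae_eq {w f : E d → ℂ} (hw : MemLp w 2) (hf : MemLp f 2)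
    (hV : MemLp (stft w f) 2) :
    (𝓕 (hV.toLp (stft w f)) : L2P d) =ᵐ[volume] rih (𝓕 (hw.toLp w) : L2 d) f := by
  have h1 : hV.toLp (stft w f) = 𝓕⁻ (rihL (𝓕 (hw.toLp w)) (hf.toLp f)) := by
    apply Lp.ext
    exact hV.coeFn_toLp.trans (stft_ae_eq_of_memLp hw hf)
  rw [h1, FourierTransform.fourier_fourierInv_eq]
  exact (coeFn_rihL _ _).trans (rih_congr_ae (ae_eq_refl _) hf.coeFn_toLp)

theorem eLpNorm_mul_le_of_holderTriple {α : Type*} [MeasurableSpace α] {μ : Measure α}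
    {f k : α → ℂ} {p q r : ℝ≥0∞} [p.HolderTriple q r] (hf : AEStronglyMeasurable f μ)
    (hk : AEStronglyMeasurable k μ) :
    eLpNorm (fun x => f x * k x) r μ ≤ eLpNorm f p μ * eLpNorm k q μ := by
  simpa using eLpNorm_le_eLpNorm_mul_eLpNorm_of_nnnorm hf hk (fun a b : ℂ => a * b) 1
    (Eventually.of_forall fun x => by simp)

theorem memLp_comp_neg {f : E d → ℂ} {p : ℝ≥0∞} (hf : MemLp f p) : MemLp (fun t => f (-t)) p :=
  hf.comp_measurePreserving (Measure.measurePreserving_neg volume)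

/-- The candidate is multiplication by the reflected fibre mean. As `m · 𝓕(V_w f)` is in `L^r` with
`r ≤ 2`, its inverse Fourier transform is a genuine function `H`; pairing `H` with `V_w (conjS h)`
and passing to the Fourier side recovers the candidate. -/
theorem exists_isBlur {p q' r r' : ℝ≥0∞} (hp : 1 ≤ p) (hq' : 2 ≤ q') (hr : 1 ≤ r) (hr2 : r ≤ 2)
    (hr' : 2 ≤ r') [p.HolderTriple q' r] [r.HolderConjugate r'] {w f : E d → ℂ}
    (hw : MemLp w 2) (hw' : MemLp (𝓕 (hw.toLp w) : L2 d) ∞)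
    (hw1 : ∀ h : 𝓢(E d, ℂ), MemLp (stft w h) 1) (hf : MemLp f 2) (hf' : MemLp f q')
    {m : Phase d → ℂ} (hm : MemLp m p) {φ ψ : 𝓢'(E d, ℂ)} {μ : 𝓢'(Phase d, ℂ)}
    (hφ : Represents w φ) (hψ : Represents f ψ) (hμ : Represents m (𝓕 μ)) :
    ∃ u : 𝓢'(E d, ℂ), IsBlur φ μ ψ u ∧
      MemLp (fun t => f t * fibreMean (𝓕 (hw.toLp w) : L2 d) m (-t)) r ∧
      Represents (fun t => f t * fibreMean (𝓕 (hw.toLp w) : L2 d) m (-t)) u := by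
  have hfour := fun (h : 𝓢(E d, ℂ)) (hV : MemLp (stft w h) 2) =>
    fourier_toLp_stft_ae_eq hw (h.memLp 2 volume) hV
  have hfourf := fourier_toLp_stft_ae_eq hw hf (memLp_stft hw hf)
  have hv2 : MemLp (𝓕 (hw.toLp w) : L2 d) 2 := Lp.memLp _
  generalize (𝓕 (hw.toLp w) : L2 d) = v at hw' hfour hfourf hv2 ⊢
  have hR : MemLp (rih v f) q' := memLp_rih (memLp_of_memLp_top hv2 hw' one_le_two hq') hf'
  have hG : MemLp (fun ξ => m ξ * rih v f ξ) r := hR.mul' hm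
  obtain ⟨TG, hTG⟩ := exists_represents hr hG
  obtain ⟨H, hH⟩ := exists_fourierInv_of_memLp hr hr2 hG
  obtain ⟨C, hC⟩ := eLpNorm_fibreMean_le hv2 hw' hp
  have hM : MemLp (fibreMean v m) p := ⟨aestronglyMeasurable_fibreMean hv2.1 hm.1,
    (hC m hm.1).trans_lt (ENNReal.mul_lt_top ENNReal.coe_lt_top hm.2)⟩
  have : q'.HolderTriple p r := ENNReal.HolderTriple.symm
  have hU : MemLp (fun t => f t * fibreMean v m (-t)) r := (memLp_comp_neg hM).mul' hf'
  obtain ⟨u, hu⟩ := exists_represents hr hU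
  refine ⟨u, ⟨w, f, H, hw, hf, hφ, hψ, ⟨Lp.toTemperedDistribution ((memLp_stft hw hf).toLp _),
    𝓕⁻ TG, m, rih v f, ?_, ?_, hμ, ?_, ?_⟩, ?_⟩, hU, hu⟩
  · exact (represents_toTemperedDistribution _).congr_ae (memLp_stft hw hf).coeFn_toLp
  · intro h
    have hc1 := memLp_conj (h.memLp 1 (volume : Measure (Phase d)))
    have hc2 := memLp_conj (h.memLp 2 (volume : Measure (Phase d)))
    obtain ⟨h1, h2⟩ := hH _ hc1 hc2
    simp only [Complex.conj_conj] at h1 h2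
    refine ⟨h1, ?_⟩
    rw [h2, TemperedDistribution.fourierInv_apply, (hTG _).2]
    refine integral_congr_ae ?_
    filter_upwards [fourier_toLp_ae_eq hc1 hc2] with ξ hξ
    rw [hξ, ← fourierInv_conj, SchwartzMap.fourierInv_coe]
    simp_rw [Complex.conj_conj]
  · exact (represents_fourier_toLp _).congr_ae hfourf
  · rwa [FourierTransform.fourier_fourierInv_eq]
  · intro h
    have hk := memLp_stft hw ((conjS h).memLp 2 volume)
    have hV : ∀ z, conj (stft w (conjS h) z) = ∫ t, tfShift z w t * h t := by
      intro z
      rw [stft, ← integral_conj]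
      congr 1; ext t
      rw [map_mul, Complex.conj_conj, conjS_apply, Complex.conj_conj, mul_comm]
    obtain ⟨h1, h2⟩ := hH _ (hw1 (conjS h)) hk
    simp_rw [hV] at h1 h2
    refine ⟨h1, ?_⟩
    have e1 : ∫ ξ, m ξ * rih v f ξ * conj ((𝓕 (hk.toLp _) : L2P d) ξ) =
        ∫ ξ, m ξ * rih v f ξ * conj (rih v (conjS h) ξ) := by
      refine integral_congr_ae ?_
      filter_upwards [hfour (conjS h) hk] with ξ hξ
      rw [hξ]
    -- Hölder with exponents `r` and `r'` gives the absolute convergence needed for Fubini.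
    have hRk : MemLp (rih v (conjS h)) r' :=
      memLp_rih (memLp_of_memLp_top hv2 hw' one_le_two hr') ((conjS h).memLp r')
    have hi : Integrable fun ξ => m ξ * rih v f ξ * conj (rih v (conjS h) ξ) :=
      hG.integrable_mul (memLp_conj hRk)
    rw [h2, e1, integral_mul_rih_mul_conj_rih hi, (hu h).2]
    simp_rw [conjS_apply, Complex.conj_conj]

theorem exists_enorm_dualPairing_le (d : ℕ) (p q r q' r' : ℝ≥0∞) (hp : 1 ≤ p)
    (hq : 1 ≤ q) (hq2 : q ≤ 2) (hr : 1 ≤ r) (hr2 : r ≤ 2)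
    (hpqr : p⁻¹ + q'⁻¹ + r'⁻¹ = 1) (hqq : q⁻¹ + q'⁻¹ = 1) (hrr : r⁻¹ + r'⁻¹ = 1)
    (g : 𝓢(E d, ℂ)) (hg : g ≠ 0)
    (φ : 𝓢'(E d, ℂ)) (hφ : MemMod g 1 φ) :
    ∃ C : ℝ≥0, ∀ (μ : 𝓢'(Phase d, ℂ)) (m : Phase d → ℂ)
      (ψ χ : 𝓢'(E d, ℂ)),
      Represents m (𝓕 μ) → MemLp m p →
      MemMod g q ψ → MemMod g r χ →
      ∃ u : 𝓢'(E d, ℂ), IsBlur φ μ ψ u ∧ (∀ v, IsBlur φ μ ψ v → v = u) ∧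
        Integrable (pairingIntegrand g u χ) ∧
        ‖dualPairing g u χ‖ₑ ≤
          C * eLpNorm m p * modNorm g q ψ * modNorm g r χ := by
  have hqc : q.HolderConjugate q' := ENNReal.holderConjugate_iff.2 hqq
  have hrc : r.HolderConjugate r' := ENNReal.holderConjugate_iff.2 hrr
  have hrc' : r'.HolderConjugate r := ENNReal.HolderTriple.symm
  have htwo : ∀ {a b : ℝ≥0∞}, a ≤ 2 → a⁻¹ + b⁻¹ = 1 → 2 ≤ b := by
    intro a b ha hab
    rw [← ENNReal.inv_le_inv]
    have h1 : (2 : ℝ≥0∞)⁻¹ + b⁻¹ ≤ 2⁻¹ + 2⁻¹ := by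
      rw [ENNReal.inv_two_add_inv_two, ← hab]
      gcongr
    exact (ENNReal.add_le_add_iff_left (by simp)).1 h1
  have hq'2 := htwo hq2 hqq
  have hr'2 := htwo hr2 hrr
  have hrt : r'⁻¹ ≠ ∞ := ENNReal.inv_ne_top.2 (zero_lt_two.trans_le hr'2).ne'
  -- Cancelling the finite `r'⁻¹` between the exponent relations leaves `p⁻¹ + q'⁻¹ = r⁻¹`.
  have htr : p.HolderTriple q' r := ⟨by
    rw [← hrr] at hpqr
    exact (ENNReal.add_left_inj hrt).1 hpqr⟩
  have htr' : q'.HolderTriple p r := ENNReal.HolderTriple.symm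
  obtain ⟨w, hw, hwφ⟩ := exists_represents_of_memMod hg le_rfl one_le_two (q' := ∞) hφ
  have hw1 : MemLp (stft g w) 1 := by
    rw [← hwφ.stftD_eq g]
    exact ⟨(stftD_spec g φ).1, hφ⟩
  have hv := memLp_top_fourier hg (hw.toLp w) (by
    rwa [stft_congr_ae (ae_eq_refl _) hw.coeFn_toLp])
  obtain ⟨C₁, hC₁⟩ := exists_eLpNorm_stft_le g hr hr2 hrr
  obtain ⟨C₂, hC₂⟩ := exists_eLpNorm_le_stft hg hq hq2 hqq
  obtain ⟨C₃, hC₃⟩ := eLpNorm_fibreMean_le (Lp.memLp _) hv hp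
  -- The factors are the normalization of the pairing, `V_g : L^r → L^{r'}`, the embedding of `M^q`
  -- in `L^{q'}`, and the fibre mean on `L^p`.
  refine ⟨‖((∫ t, ‖g t‖ ^ 2 : ℝ) : ℂ)⁻¹‖₊ * C₁ * C₂ * C₃, fun μ m ψ χ hμ hm hψ hχ => ?_⟩
  obtain ⟨f, hf, hfψ⟩ := exists_represents_of_memMod hg hq hq2 (q' := q') hψ
  have hfn : eLpNorm f q' ≤ C₂ * modNorm g q ψ := by
    rw [modNorm, hfψ.stftD_eq g]
    exact hC₂ f hf
  have hf' : MemLp f q' :=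
    ⟨hf.1, hfn.trans_lt (ENNReal.mul_lt_top ENNReal.coe_lt_top hψ)⟩
  obtain ⟨u, hu, hU, hUu⟩ := exists_isBlur hp hq'2 hr hr2 hr'2 hw hv
    (memLp_one_stft hg hw hw1) hf hf' hm hwφ hfψ hμ
  have hχm : MemLp (stftD g χ) r := ⟨(stftD_spec g χ).1, hχ⟩
  have hum := aestronglyMeasurable_stft g hU.1
  have hUn := hC₁ _ hU
  rw [← hUu.stftD_eq g] at hum hUn
  have huL : MemLp (stftD g u) r' :=
    ⟨hum, hUn.trans_lt (ENNReal.mul_lt_top ENNReal.coe_lt_top hU.2)⟩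
  refine ⟨u, hu, fun v hv => hu.unique hv, huL.integrable_mul (memLp_conj hχm), ?_⟩
  have hMm := aestronglyMeasurable_fibreMean (Lp.aestronglyMeasurable
    (𝓕 (hw.toLp w) : L2 d)) hm.1
  have hMm' : AEStronglyMeasurable fun t : E d => fibreMean (𝓕 (hw.toLp w) : L2 d) m (-t) :=
    hMm.comp_measurePreserving (Measure.measurePreserving_neg volume)
  have hUm : eLpNorm (fun t => f t * fibreMean (𝓕 (hw.toLp w) : L2 d) m (-t)) r ≤
      (C₂ * modNorm g q ψ) * (C₃ * eLpNorm m p) := by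
    refine (eLpNorm_mul_le_of_holderTriple (p := q') (q := p) hf.1 hMm').trans ?_
    rw [eLpNorm_comp_neg hMm]
    gcongr
    exact hC₃ m hm.1
  calc ‖dualPairing g u χ‖ₑ
      ≤ ‖((∫ t, ‖g t‖ ^ 2 : ℝ) : ℂ)⁻¹‖ₑ * (eLpNorm (stftD g u) r' * eLpNorm (stftD g χ) r) := by
        rw [dualPairing, enorm_mul]
        refine mul_le_mul_right ?_ _
        refine (enorm_integral_mul_le (p := r') (q := r) hum (memLp_conj hχm).1).trans_eq ?_
        rw [eLpNorm_conj (stftD g χ)]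
    _ ≤ ‖((∫ t, ‖g t‖ ^ 2 : ℝ) : ℂ)⁻¹‖ₑ * (C₁ * ((C₂ * modNorm g q ψ) * (C₃ * eLpNorm m p)) *
        modNorm g r χ) := by
        gcongr
        · exact hUn.trans (mul_le_mul_right hUm _)
        · exact le_rfl
    _ = _ := by
        rw [enorm_eq_nnnorm]
        push_cast
        ring

end Blur

end TFBlur

theorem mainTheorem6 (d : ℕ) (p q r q' r' : ℝ≥0∞) (hp : 1 ≤ p)
    (hq : 1 ≤ q) (hq2 : q ≤ 2) (hr : 1 ≤ r) (hr2 : r ≤ 2)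
    (hpqr : p⁻¹ + q'⁻¹ + r'⁻¹ = 1) (hqq : q⁻¹ + q'⁻¹ = 1) (hrr : r⁻¹ + r'⁻¹ = 1)
    (g : 𝓢(TFBlur.E d, ℂ)) (hg : g ≠ 0)
    (φ : 𝓢'(TFBlur.E d, ℂ)) (hφ : TFBlur.MemMod g 1 φ) :
    ∃ C : ℝ≥0, ∀ (μ : 𝓢'(TFBlur.Phase d, ℂ)) (m : TFBlur.Phase d → ℂ)
      (ψ χ : 𝓢'(TFBlur.E d, ℂ)),
      TFBlur.Represents m (𝓕 μ) → MemLp m p →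
      TFBlur.MemMod g q ψ → TFBlur.MemMod g r χ →
      ∃ u : 𝓢'(TFBlur.E d, ℂ), TFBlur.IsBlur φ μ ψ u ∧ (∀ v, TFBlur.IsBlur φ μ ψ v → v = u) ∧
        Integrable (TFBlur.pairingIntegrand g u χ) ∧
        ‖TFBlur.dualPairing g u χ‖ₑ ≤
          C * eLpNorm m p * TFBlur.modNorm g q ψ * TFBlur.modNorm g r χ :=
  TFBlur.exists_enorm_dualPairing_le d p q r q' r' hp hq hq2 hr hr2 hpqr hqq hrr g hg φ hφ
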